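/- Let $\mathbf H^3=\{x\in\mathbf R^{4}: x_0>0,\ \langle x,x\rangle=-1\}$ with $\langle x,y\rangle=-x_0y_0+x_1y_1+x_2y_2+x_3y_3$. A compact convex hyperbolic polyhedron is a compact set $P\subset\mathbf H^3$ with non-empty interior (relative to $\mathbf H^3$) that is the intersection of finitely many closed half-spaces $\{x\in\mathbf H^3:\langle n,x\rangle\le 0\}$ with $\langle n,n\rangle=1$. The Gaussian image (polar) $P^*$ of $P$ is the set of outward unit normals to the supporting planes of $P$, i.e. of all $n$ with $\langle n,n\rangle=1$, $\langle n,x\rangle\le 0$ for all $x\in P$, and $\langle n,x\rangle=0$ for some $x\in P$. It is the union of the convex spherical polygons $F_v=\{n\in P^*:\langle n,v\rangle=0\}$, where $v$ runs over the vertices of $P$ ($F_v$ is the spherical polar of the link of $P$ at $v$, with spherical distance $\arccos\langle n,n'\rangle$). The polar metric on $P^*$ is the gluing metric: the distance of two points of $P^*$ is the infimum of the lengths of paths joining them that are composed of finitely many great-circle arcs, each contained in one of the polygons $F_v$. A metric space $Q$ is called admissible if 1. $Q$ is homeomorphic to $\mathbf S^2$; 2. $Q$ is piecewise spherical, i.e.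 it is obtained by gluing finitely many convex spherical polygons isometrically along common sides and vertices, with the gluing metric; and, away from a finite set of cone points, $Q$ has constant curvature $1$, i.e. it is locally isometric to the unit sphere $\mathbf S^2$; 3. all cone angles are $>2\pi$, where $Q$ has cone angle $\theta$ at $q$ if a ball around $q$ is isometric to the ball of the same radius around the apex of the spherical cone over a circle of length $\theta$; 4. every closed geodesic of $Q$ has length $>2\pi$, where a closed geodesic of length $L>0$ is an $L$-periodic map $\gamma:\mathbf R\to Q$ such that each $t\in\mathbf R$ has a neighbourhood on which $d(\gamma(s),\gamma(s'))=|s-s'|$ (it need not be simple). **Proposition.** For every compact convex hyperbolic polyhedron $P$, the polar metric is a metric on $P^*$, and $P^*$ with this metric is an admissible metric space. In particular, every closed geodesic on it is longer than $2\pi$. -/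

import Mathlib

/-- Minkowski space `E^3_1`: the vector space `ℝ⁴` with coordinates `x₀, x₁, x₂, x₃`. -/
abbrev Minkowski : Type := Fin 4 → ℝ

/-- The Lorentzian scalar product `-x₀ y₀ + x₁ y₁ + x₂ y₂ + x₃ y₃`. -/
def lorentz (x y : Minkowski) : ℝ :=
  -(x 0 * y 0) + x 1 * y 1 + x 2 * y 2 + x 3 * y 3

/-- Hyperbolic space `H³` in the hyperboloid model. -/
def hyperbolicSpace : Set Minkowski :=
  {x | 0 < x 0 ∧ lorentz x x = -1}

/-- De Sitter space `S²₁`: the unit space-like vectors, i.e. the unit normals of oriented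
planes of `H³`. -/
def deSitter : Set Minkowski :=
  {n | lorentz n n = 1}

/-- The closed half-space of `H³` with outward unit normal `n`. -/
def halfSpace (n : Minkowski) : Set Minkowski :=
  {x | x ∈ hyperbolicSpace ∧ lorentz n x ≤ 0}

/-- A compact convex polyhedron in `H³`: a compact subset of `H³` that is the intersection of
finitely many half-spaces and has an interior point (relative to `H³`).  The topology of `H³` is
the one induced from `ℝ⁴`. -/
structure IsCompactConvexPolyhedron (P : Set Minkowski) : Prop where
  exists_halfSpaces : ∃ N : Set Minkowski, N.Finite ∧ N ⊆ deSitter ∧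
    P = {x | x ∈ hyperbolicSpace ∧ ∀ n ∈ N, x ∈ halfSpace n}
  isCompact : IsCompact P
  exists_interior : ∃ x ∈ hyperbolicSpace, P ∈ nhdsWithin x hyperbolicSpace

/-- `v` is a vertex of `P`: it lies in `P`, but not in the relative interior of a nondegenerate
geodesic segment contained in `P`.  In the hyperboloid model the points strictly between `x` and
`y` are the points of `H³` of the form `a • x + b • y` with `a, b > 0`. -/
def IsVertex (P : Set Minkowski) (v : Minkowski) : Prop :=
  v ∈ P ∧ ∀ x ∈ P, ∀ y ∈ P, ∀ a b : ℝ, 0 < a → 0 < b → v = a • x + b • y → x = v ∧ y = v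

/-- The Gaussian image (polar) of `P`, as a set: the outward unit vectors normal to the supporting
planes of `P`. -/
def polar (P : Set Minkowski) : Set Minkowski :=
  {n | n ∈ deSitter ∧ (∀ x ∈ P, lorentz n x ≤ 0) ∧ ∃ x ∈ P, lorentz n x = 0}

/-- `PathLength step x y L` says that `x` and `y` are joined by a finite chain of steps of total
length `L`, where `step a b ℓ` says that one may step from `a` to `b` at the cost `ℓ`. -/
inductive PathLength {X : Type*} (step : X → X → ℝ → Prop) : X → X → ℝ → Prop
  | refl (x : X) : PathLength step x x 0
  | cons {x y z : X} {ℓ L : ℝ} : step x y ℓ → PathLength step y z L →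
      PathLength step x z (ℓ + L)

/-- A step inside one 2-cell of the Gaussian image.  The cell of the vertex `v` of `P` consists of
the unit normals of supporting planes through `v`; it is the spherical polygon polar to the link of
`P` at `v`, in the unit sphere of the tangent space `v^⊥` of `H³` at `v`, on which `lorentz` is
positive definite.  The cost is the spherical distance. -/
def polarStep (P : Set Minkowski) (x y : polar P) (ℓ : ℝ) : Prop :=
  ∃ v, IsVertex P v ∧ lorentz x.1 v = 0 ∧ lorentz y.1 v = 0 ∧ ℓ = Real.arccos (lorentz x.1 y.1)

/-- `m` is the metric of the Gaussian image of `P`, i.e. the intrinsic (gluing) metric: the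
distance of two points is the infimum of the lengths of paths composed of finitely many
great-circle arcs, each of them inside one of the spherical polygons glued together. -/
def IsPolarMetric (P : Set Minkowski) (m : MetricSpace (polar P)) : Prop :=
  ∀ x y : polar P, IsGLB {L : ℝ | PathLength (polarStep P) x y L} (m.dist x y)

/-- Euclidean 3-space. -/
abbrev E3 : Type := EuclideanSpace ℝ (Fin 3)

/-- A convex spherical polygon (with at least three sides) in the unit sphere `S² ⊆ E³`: a finite
intersection of closed hemispheres that has an interior point and contains no two antipodal
points. -/
def IsConvexSphericalPolygon (p : Set E3) : Prop :=
  ∃ (k : ℕ) (a : Fin k → E3),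
    p = {x | ‖x‖ = 1 ∧ ∀ i, 0 ≤ inner ℝ (a i) x} ∧
    (∃ x ∈ p, ∀ i, 0 < inner ℝ (a i) x) ∧
    ∀ x ∈ p, -x ∉ p

/-- `f` is a proper face of the spherical polygon `p`: a side, a vertex, or the empty set. -/
def IsProperFace (p f : Set E3) : Prop :=
  f ≠ p ∧ ∃ b : E3, (∀ x ∈ p, 0 ≤ inner ℝ b x) ∧ f = {x | x ∈ p ∧ inner ℝ b x = 0}

/-- `Q` is piecewise spherical: it is obtained by gluing finitely many convex spherical polygons
isometrically along proper faces, and its distance is the infimum of the lengths of paths composed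
of finitely many great-circle arcs, each of them inside one polygon. -/
def IsPiecewiseSpherical (Q : Type*) [MetricSpace Q] : Prop :=
  ∃ (k : ℕ) (p : Fin k → Set E3) (φ : Fin k → E3 → Q),
    (∀ i, IsConvexSphericalPolygon (p i)) ∧
    (∀ i, Set.InjOn (φ i) (p i)) ∧
    (∀ q : Q, ∃ i, q ∈ φ i '' p i) ∧
    (∀ i j, i ≠ j → IsProperFace (p i) {x | x ∈ p i ∧ φ i x ∈ φ j '' p j}) ∧
    (∀ i j, ∀ x ∈ p i, ∀ x' ∈ p i, ∀ y ∈ p j, ∀ y' ∈ p j, φ i x = φ j y → φ i x' = φ j y' →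
      InnerProductGeometry.angle x x' = InnerProductGeometry.angle y y') ∧
    ∀ q q' : Q, IsGLB {L : ℝ | PathLength (fun a b ℓ => ∃ i, ∃ x ∈ p i, ∃ y ∈ p i,
      φ i x = a ∧ φ i y = b ∧ ℓ = InnerProductGeometry.angle x y) q q' L} (dist q q')

/-- `Q` has constant curvature `1` at `q`: a ball around `q` is isometric to a ball of the same
radius in the unit sphere `S²` with its angular metric. -/
def IsSphericalAt {Q : Type*} [MetricSpace Q] (q : Q) : Prop :=
  ∃ ε > 0, ∃ f : Q → E3,
    (∀ x ∈ Metric.ball q ε, ‖f x‖ = 1) ∧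
    (∀ x ∈ Metric.ball q ε, ∀ y ∈ Metric.ball q ε,
      dist x y = InnerProductGeometry.angle (f x) (f y)) ∧
    ∀ u : E3, ‖u‖ = 1 → InnerProductGeometry.angle (f q) u < ε →
      ∃ x ∈ Metric.ball q ε, f x = u

/-- `Q` has (spherical) cone angle `θ` at `q`: a ball around `q` is isometric to the ball of the
same radius around the apex of the spherical cone over a circle of length `θ`, with polar
coordinates `(r, α)`, `α ∈ ℝ/θℤ`; `f` is the inverse isometry, and `‖α - β‖` is the arc length
distance on the circle. -/
def HasConeAngle {Q : Type*} [MetricSpace Q] (q : Q) (θ : ℝ) : Prop :=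
  0 < θ ∧ ∃ ε > 0, ε ≤ Real.pi / 2 ∧ ∃ f : ℝ → AddCircle θ → Q,
    (∀ α, f 0 α = q) ∧
    (∀ x : Q, x ∈ Metric.ball q ε ↔ ∃ r ∈ Set.Ico 0 ε, ∃ α, f r α = x) ∧
    ∀ r ∈ Set.Ico 0 ε, ∀ s ∈ Set.Ico 0 ε, ∀ α β,
      dist (f r α) (f s β) = Real.arccos
        (Real.cos r * Real.cos s + Real.sin r * Real.sin s * Real.cos (min ‖α - β‖ Real.pi))

/-- `γ` is (the periodic extension of) a closed geodesic of length `L` in `Q`, parametrized by arc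
length: a map from the circle of length `L > 0` that locally preserves distances.  It need not be
simple. -/
def IsClosedGeodesic {Q : Type*} [MetricSpace Q] (L : ℝ) (γ : ℝ → Q) : Prop :=
  0 < L ∧ Function.Periodic γ L ∧
    ∀ t : ℝ, ∃ ε > 0, ∀ s ∈ Metric.ball t ε, ∀ s' ∈ Metric.ball t ε,
      dist (γ s) (γ s') = |s - s'|

/-- Admissible metric spaces. -/
structure IsAdmissible (Q : Type*) [MetricSpace Q] : Prop where
  homeomorphic_sphere : Nonempty (Q ≃ₜ Metric.sphere (0 : E3) 1)
  piecewiseSpherical : IsPiecewiseSpherical Q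
  /-- Constant curvature `1` away from a finite set of cone points, with all cone angles
  `> 2π`. -/
  conePoints : ∃ S : Set Q, S.Finite ∧ (∀ q, q ∉ S → IsSphericalAt q) ∧
    ∀ q ∈ S, ∃ θ, 2 * Real.pi < θ ∧ HasConeAngle q θ
  closedGeodesics : ∀ (L : ℝ) (γ : ℝ → Q), IsClosedGeodesic L γ → 2 * Real.pi < L

/-! ### The Lorentzian scalar product -/

/-! Everything rests on one Fenchel-type theorem, `IsBrokenGeodesic.two_pi_lt`, for closed curves in
de Sitter space made of unit speed great-circle arcs whose corners are bent towards the future: at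
each time the sum of the right direction and the backward left direction is zero or future timelike.
If no point is antipodal to the one reached after time `π`, the period `L` exceeds `2π`.

Suppose `L ≤ 2π`. Let `M` be the integral of the curve over a period. Direction plus running
integral is constant on arcs and jumps by the bends, so `M` is the total bend up to sign conventions
of the jumps: it pairs nonpositively with every vector with which all bends do (`momentum_drop`).
Hence `M` is future timelike, and Sturm comparison along the curve makes its product with every
point of the curve negative. Complete `p`, the normalization of `M`, to an orthonormal frame by
three spacelike vectors. The three spacelike coordinates of the curve have mean zero, so Wirtinger's
inequality gives nonnegative energies `∫ (k'² - k²)`. By Parseval these energies sum to that of the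
coordinate `⟨γ, p⟩`, which is negative because all the bends push it away from zero (`energy_drop`).
This is the contradiction.

The theorem is used twice. First for cone angles: near a point `q` the polar surface is the
spherical cone over its link, and the link depends only on the vertices orthogonal to `q`. In the
projective disc model of the future cone in `q^⊥`, these vertices form a finite planar set, and the
link is the curve whose height over the direction `φ` is the support function of that set
(`exists_linkCurve`). It is a closed broken geodesic. If the planar set has positive width in every
direction there are no antipodal points and the length exceeds `2π`; otherwise the link consists of
two half great circles and has length exactly `2π`.

Secondly for closed geodesics: the two directions of a geodesic at a point are at distance at least
`π` in the link there. The field `IsLinkCurve.bend` says that two such directions have zero or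
future timelike sum; if they did not, a causal vector would separate them from the polar body, and
strict Sturm comparison would leave no bends on an arc of length `π` between them, whose ends would
then be antipodal in less than a half turn. So a closed geodesic is itself a closed broken geodesic.
It has no antipodal points because the vertices span Minkowski space.

What remains is the passage to and from this local picture. A linear form normalized by the time
coordinate is maximal at a vertex, so the polar is determined by the finite vertex set
(`exists_vertexSet`). The intrinsic metric dominates the coordinate distance, so it is definite, and
short paths stay where cone coordinates apply (`exists_polarChart`). Radial projection identifies
the surface with the round sphere (`exists_equiv_sphere`). -/

theorem lorentz_comm (x y : Minkowski) : lorentz x y = lorentz y x := by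
  simp only [lorentz]; ring

@[simp] theorem lorentz_add_left (x y z : Minkowski) :
    lorentz (x + y) z = lorentz x z + lorentz y z := by
  simp only [lorentz, Pi.add_apply]; ring

@[simp] theorem lorentz_add_right (x y z : Minkowski) :
    lorentz x (y + z) = lorentz x y + lorentz x z := by
  simp only [lorentz, Pi.add_apply]; ring

@[simp] theorem lorentz_sub_left (x y z : Minkowski) :
    lorentz (x - y) z = lorentz x z - lorentz y z := by
  simp only [lorentz, Pi.sub_apply]; ring

@[simp] theorem lorentz_sub_right (x y z : Minkowski) :
    lorentz x (y - z) = lorentz x y - lorentz x z := by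
  simp only [lorentz, Pi.sub_apply]; ring

@[simp] theorem lorentz_smul_left (a : ℝ) (x y : Minkowski) :
    lorentz (a • x) y = a * lorentz x y := by
  simp only [lorentz, Pi.smul_apply, smul_eq_mul]; ring

@[simp] theorem lorentz_smul_right (a : ℝ) (x y : Minkowski) :
    lorentz x (a • y) = a * lorentz x y := by
  simp only [lorentz, Pi.smul_apply, smul_eq_mul]; ring

@[simp] theorem lorentz_neg_left (x y : Minkowski) : lorentz (-x) y = -lorentz x y := by
  simp only [lorentz, Pi.neg_apply]; ring

@[simp] theorem lorentz_neg_right (x y : Minkowski) : lorentz x (-y) = -lorentz x y := by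
  simp only [lorentz, Pi.neg_apply]; ring

@[simp] theorem lorentz_zero_left (y : Minkowski) : lorentz 0 y = 0 := by
  simp [lorentz]

@[simp] theorem lorentz_zero_right (y : Minkowski) : lorentz y 0 = 0 := by
  simp [lorentz]

theorem lorentz_sum_left {ι : Type*} (s : Finset ι) (f : ι → Minkowski) (y : Minkowski) :
    lorentz (∑ i ∈ s, f i) y = ∑ i ∈ s, lorentz (f i) y := by
  classical
  induction s using Finset.induction_on with
  | empty => simp
  | insert a s ha ih => simp [Finset.sum_insert ha, ih]

@[fun_prop]
theorem Continuous.lorentz {X : Type*} [TopologicalSpace X] {f g : X → Minkowski}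
    (hf : Continuous f) (hg : Continuous g) : Continuous fun x => lorentz (f x) (g x) := by
  unfold _root_.lorentz
  fun_prop

theorem eq_of_forall_lorentz_eq {x y : Minkowski} (h : ∀ z, lorentz x z = lorentz y z) : x = y := by
  funext i
  have := h (Pi.single i 1)
  fin_cases i <;> simpa [lorentz, Pi.single_apply] using this

/-- Nonzero causal vectors of the closed future cone. -/
def FutureCausal (y : Minkowski) : Prop := 0 < y 0 ∧ lorentz y y ≤ 0

/-- Vectors of the open future cone. -/
def FutureTimelike (y : Minkowski) : Prop := 0 < y 0 ∧ lorentz y y < 0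

theorem FutureTimelike.futureCausal {y : Minkowski} (h : FutureTimelike y) : FutureCausal y :=
  ⟨h.1, h.2.le⟩

theorem FutureTimelike.of_mem {v : Minkowski} (hv : v ∈ hyperbolicSpace) : FutureTimelike v :=
  ⟨hv.1, by rw [hv.2]; norm_num⟩

theorem FutureTimelike.exists_smul_mem {y : Minkowski} (h : FutureTimelike y) :
    ∃ c : ℝ, 0 < c ∧ c • y ∈ hyperbolicSpace := by
  have hs : 0 < Real.sqrt (-lorentz y y) := Real.sqrt_pos.2 (by linarith [h.2])
  refine ⟨(Real.sqrt (-lorentz y y))⁻¹, inv_pos.2 hs, by simpa using mul_pos (inv_pos.2 hs) h.1, ?_⟩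
  simp only [lorentz_smul_left, lorentz_smul_right]
  have h2 := Real.mul_self_sqrt (show 0 ≤ -lorentz y y by linarith [h.2])
  field_simp
  nlinarith

/-- The reversed Cauchy-Schwarz inequality: the spatial scalar product is dominated by the product
of the time coordinates. -/
theorem lorentz_neg_of_futureTimelike {a y : Minkowski} (ha : FutureTimelike a)
    (hy : FutureCausal y) : lorentz a y < 0 := by
  obtain ⟨ha0, ha1⟩ := ha
  obtain ⟨hy0, hy1⟩ := hy
  simp only [lorentz] at *
  have hA : (a 1) ^ 2 + (a 2) ^ 2 + (a 3) ^ 2 < (a 0) ^ 2 := by nlinarith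
  have hY : (y 1) ^ 2 + (y 2) ^ 2 + (y 3) ^ 2 ≤ (y 0) ^ 2 := by nlinarith
  have hcs : (a 1 * y 1 + a 2 * y 2 + a 3 * y 3) ^ 2 ≤
      ((a 1) ^ 2 + (a 2) ^ 2 + (a 3) ^ 2) * ((y 1) ^ 2 + (y 2) ^ 2 + (y 3) ^ 2) := by
    nlinarith [sq_nonneg (a 1 * y 2 - a 2 * y 1), sq_nonneg (a 1 * y 3 - a 3 * y 1),
      sq_nonneg (a 2 * y 3 - a 3 * y 2)]
  have hlt : (a 1 * y 1 + a 2 * y 2 + a 3 * y 3) ^ 2 < (a 0 * y 0) ^ 2 := by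
    have h1 : ((a 1) ^ 2 + (a 2) ^ 2 + (a 3) ^ 2) * ((y 1) ^ 2 + (y 2) ^ 2 + (y 3) ^ 2)
        ≤ ((a 1) ^ 2 + (a 2) ^ 2 + (a 3) ^ 2) * (y 0) ^ 2 := by gcongr
    have h2 : ((a 1) ^ 2 + (a 2) ^ 2 + (a 3) ^ 2) * (y 0) ^ 2 < (a 0) ^ 2 * (y 0) ^ 2 := by gcongr
    nlinarith
  have := abs_lt_of_sq_lt_sq hlt (by positivity)
  linarith [(abs_lt.1 this).2]

/-- The closed future cone is self-dual up to sign. In Fenchel's theorem this turns negativity of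
the pairings of the total vector into a position statement. -/
theorem futureTimelike_of_forall_lorentz_neg {a : Minkowski}
    (h : ∀ y, FutureCausal y → lorentz a y < 0) : FutureTimelike a := by
  have h0 : 0 < a 0 := by
    have := h ![1, 0, 0, 0] ⟨by simp, by simp [lorentz]⟩
    simpa [lorentz] using this
  refine ⟨h0, ?_⟩
  by_contra! hcon
  have hA : (a 0) ^ 2 ≤ (a 1) ^ 2 + (a 2) ^ 2 + (a 3) ^ 2 := by
    simp only [lorentz] at hcon; nlinarith
  set r := Real.sqrt ((a 1) ^ 2 + (a 2) ^ 2 + (a 3) ^ 2) with hr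
  have hr2 : r * r = (a 1) ^ 2 + (a 2) ^ 2 + (a 3) ^ 2 := Real.mul_self_sqrt (by positivity)
  have hra : a 0 ≤ r := Real.le_sqrt_of_sq_le hA
  -- The null vector with the same spatial part as `a`: its product with `a` is `r (r - a 0)`, which
  -- is nonnegative if `a` is not timelike.
  have := h ![r, a 1, a 2, a 3] ⟨by simp; linarith, by simp [lorentz]; nlinarith⟩
  simp only [lorentz, Matrix.cons_val] at this
  nlinarith

/-- A timelike (or null) vector is nonzero in its time coordinate. -/
theorem ne_zero_time {a : Minkowski} (h : lorentz a a ≤ 0) (ha : a ≠ 0) : a 0 ≠ 0 := by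
  intro h0
  apply ha
  simp only [lorentz, h0] at h
  have h1 : a 1 = 0 := by nlinarith [sq_nonneg (a 1), sq_nonneg (a 2), sq_nonneg (a 3)]
  have h2 : a 2 = 0 := by nlinarith [sq_nonneg (a 1), sq_nonneg (a 2), sq_nonneg (a 3)]
  have h3 : a 3 = 0 := by nlinarith [sq_nonneg (a 1), sq_nonneg (a 2), sq_nonneg (a 3)]
  funext i
  fin_cases i <;> assumption

theorem futureCausal_or_neg {a : Minkowski} (h : lorentz a a ≤ 0) (ha : a ≠ 0) :
    FutureCausal a ∨ FutureCausal (-a) := by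
  rcases lt_or_gt_of_ne (ne_zero_time h ha) with h0 | h0
  · exact Or.inr ⟨by simpa using h0, by simpa using h⟩
  · exact Or.inl ⟨h0, h⟩

theorem futureCausal_of_lorentz_neg {a o : Minkowski} (h : lorentz a a ≤ 0)
    (ho : FutureTimelike o) (hao : lorentz a o < 0) : FutureCausal a := by
  have ha : a ≠ 0 := by rintro rfl; simp at hao
  rcases futureCausal_or_neg h ha with h1 | h1
  · exact h1
  · have := lorentz_neg_of_futureTimelike ho h1
    rw [lorentz_comm, lorentz_neg_left] at this
    linarith

theorem futureTimelike_of_lorentz_neg {a o : Minkowski} (h : lorentz a a < 0)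
    (ho : FutureTimelike o) (hao : lorentz a o < 0) : FutureTimelike a :=
  ⟨(futureCausal_of_lorentz_neg h.le ho hao).1, h⟩

/-- On the orthogonal complement of `v ∈ H³` the Lorentzian product controls the coordinates. -/
theorem sq_apply_le_of_orthogonal {v n : Minkowski} (hv : v ∈ hyperbolicSpace)
    (hn : lorentz n v = 0) (i : Fin 4) : (n i) ^ 2 ≤ (v 0) ^ 2 * lorentz n n := by
  obtain ⟨hv0, hv1⟩ := hv
  simp only [lorentz] at *
  have hA : (n 0 * v 0) ^ 2 ≤ ((n 1) ^ 2 + (n 2) ^ 2 + (n 3) ^ 2) * ((v 0) ^ 2 - 1) := by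
    have e : n 0 * v 0 = n 1 * v 1 + n 2 * v 2 + n 3 * v 3 := by linarith
    have e2 : (v 0) ^ 2 - 1 = (v 1) ^ 2 + (v 2) ^ 2 + (v 3) ^ 2 := by nlinarith
    rw [e, e2]
    nlinarith [sq_nonneg (n 1 * v 2 - n 2 * v 1), sq_nonneg (n 1 * v 3 - n 3 * v 1),
      sq_nonneg (n 2 * v 3 - n 3 * v 2)]
  have hS : (n 1) ^ 2 + (n 2) ^ 2 + (n 3) ^ 2 ≤
      (v 0) ^ 2 * (-(n 0 * n 0) + n 1 * n 1 + n 2 * n 2 + n 3 * n 3) := by nlinarith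
  have h0 : (n 0) ^ 2 ≤ (n 1) ^ 2 + (n 2) ^ 2 + (n 3) ^ 2 := by
    have hpos : 0 < (v 0) ^ 2 := by positivity
    have : (v 0) ^ 2 * (n 0) ^ 2 ≤ (v 0) ^ 2 * ((n 1) ^ 2 + (n 2) ^ 2 + (n 3) ^ 2) := by
      nlinarith [sq_nonneg (n 1), sq_nonneg (n 2), sq_nonneg (n 3)]
    exact le_of_mul_le_mul_left this hpos
  refine le_trans ?_ hS
  fin_cases i
  · exact h0
  · simp; nlinarith [sq_nonneg (n 2), sq_nonneg (n 3)]
  · simp; nlinarith [sq_nonneg (n 1), sq_nonneg (n 3)]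
  · simp; nlinarith [sq_nonneg (n 2), sq_nonneg (n 1)]

theorem norm_le_of_orthogonal {v n : Minkowski} (hv : v ∈ hyperbolicSpace)
    (hn : lorentz n v = 0) : ‖n‖ ≤ v 0 * Real.sqrt (lorentz n n) := by
  have hv0 := hv.1.le
  rw [pi_norm_le_iff_of_nonneg (by positivity)]
  intro i
  have h := sq_apply_le_of_orthogonal hv hn i
  rw [Real.norm_eq_abs, ← Real.sqrt_sq_eq_abs, ← Real.sqrt_sq hv0, ← Real.sqrt_mul (sq_nonneg _)]
  exact Real.sqrt_le_sqrt h

theorem lorentz_self_pos {v n : Minkowski} (hv : v ∈ hyperbolicSpace)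
    (hn : lorentz n v = 0) (h : n ≠ 0) : 0 < lorentz n n := by
  by_contra! hcon
  apply h
  have := norm_le_of_orthogonal hv hn
  rw [Real.sqrt_eq_zero_of_nonpos hcon, mul_zero] at this
  exact norm_le_zero_iff.1 this

theorem lorentz_self_nonneg {v n : Minkowski} (hv : v ∈ hyperbolicSpace)
    (hn : lorentz n v = 0) : 0 ≤ lorentz n n := by
  by_cases h : n = 0
  · simp [h]
  · exact (lorentz_self_pos hv hn h).le

/-- The form is positive semidefinite on the complement of `v`; apply this to `x + y` and `x - y`.
-/
theorem abs_lorentz_le_one {v x y : Minkowski} (hv : v ∈ hyperbolicSpace)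
    (hx : lorentz x v = 0) (hy : lorentz y v = 0) (hx1 : lorentz x x = 1) (hy1 : lorentz y y = 1) :
    |lorentz x y| ≤ 1 := by
  have h1 := lorentz_self_nonneg (n := x + y) hv (by simp [hx, hy])
  have h2 := lorentz_self_nonneg (n := x - y) hv (by simp [hx, hy])
  simp only [lorentz_add_left, lorentz_add_right, lorentz_sub_left, lorentz_sub_right,
    lorentz_comm y x, hx1, hy1] at h1 h2
  rw [abs_le]; constructor <;> linarith

/-- Chords are shorter than arcs. -/
theorem norm_sub_le_arccos {v x y : Minkowski} (hv : v ∈ hyperbolicSpace)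
    (hx : lorentz x v = 0) (hy : lorentz y v = 0) (hx1 : lorentz x x = 1) (hy1 : lorentz y y = 1) :
    ‖x - y‖ ≤ v 0 * Real.arccos (lorentz x y) := by
  refine (norm_le_of_orthogonal hv (n := x - y) (by simp [hx, hy])).trans ?_
  refine mul_le_mul_of_nonneg_left ?_ hv.1.le
  rw [Real.sqrt_le_left (Real.arccos_nonneg _)]
  have hb := abs_le.1 (abs_lorentz_le_one hv hx hy hx1 hy1)
  have h := Real.one_sub_sq_div_two_le_cos (x := Real.arccos (lorentz x y))
  rw [Real.cos_arccos hb.1 hb.2] at h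
  simp only [lorentz_sub_left, lorentz_sub_right, lorentz_comm y x, hx1, hy1]
  linarith

/-! ### Isometries of the tangent spaces of `H³` with Euclidean space -/

/-- The Lorentz boost identifying Euclidean space with the orthogonal complement of `v`. -/
noncomputable def boost (v : Minkowski) (y : E3) : Minkowski :=
  let c := v 1 * y 0 + v 2 * y 1 + v 3 * y 2
  ![c, y 0 + c / (1 + v 0) * v 1, y 1 + c / (1 + v 0) * v 2, y 2 + c / (1 + v 0) * v 3]

/-- The inverse of `boost v`. -/
noncomputable def unboost (v n : Minkowski) : E3 :=
  !₂[n 1 - n 0 / (1 + v 0) * v 1, n 2 - n 0 / (1 + v 0) * v 2, n 3 - n 0 / (1 + v 0) * v 3]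

theorem inner_E3 (x y : E3) : inner ℝ x y = x 0 * y 0 + x 1 * y 1 + x 2 * y 2 := by
  simp only [PiLp.inner_apply, Fin.sum_univ_three, RCLike.inner_apply, conj_trivial]
  ring

theorem lorentz_boost_boost {v : Minkowski} (hv : v ∈ hyperbolicSpace) (x y : E3) :
    lorentz (boost v x) (boost v y) = inner ℝ x y := by
  obtain ⟨h0, h1⟩ := hv
  have hne : (1 + v 0) ≠ 0 := by positivity
  simp only [lorentz, boost, Matrix.cons_val] at *
  rw [inner_E3]
  -- The hyperboloid equation, factored so that the denominator `1 + v 0` of the boost cancels.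
  have e : (v 0 - 1) * (1 + v 0) = v 1 * v 1 + v 2 * v 2 + v 3 * v 3 := by linarith
  have e' : v 0 = (1 + v 0) - 1 := by ring
  generalize 1 + v 0 = k at *
  have hX : v 1 * x 0 + v 2 * x 1 + v 3 * x 2 =
      k * ((v 1 * x 0 + v 2 * x 1 + v 3 * x 2) / k) := by field_simp
  have hY : v 1 * y 0 + v 2 * y 1 + v 3 * y 2 =
      k * ((v 1 * y 0 + v 2 * y 1 + v 3 * y 2) / k) := by field_simp
  generalize (v 1 * x 0 + v 2 * x 1 + v 3 * x 2) / k = p at *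
  generalize (v 1 * y 0 + v 2 * y 1 + v 3 * y 2) / k = r at *
  rw [e'] at e
  have hk : v 1 * v 1 + v 2 * v 2 + v 3 * v 3 = k * k - 2 * k := by linarith
  rw [show -((v 1 * x 0 + v 2 * x 1 + v 3 * x 2) * (v 1 * y 0 + v 2 * y 1 + v 3 * y 2)) =
    -((k * p) * (k * r)) by rw [hX, hY]]
  linear_combination r * hX + p * hY + p * r * hk

theorem lorentz_boost_left {v : Minkowski} (hv : v ∈ hyperbolicSpace) (x : E3) :
    lorentz (boost v x) v = 0 := by
  obtain ⟨h0, h1⟩ := hv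
  have hne : (1 + v 0) ≠ 0 := by positivity
  simp only [lorentz, boost, Matrix.cons_val] at *
  have e : (v 0 - 1) * (1 + v 0) = v 1 * v 1 + v 2 * v 2 + v 3 * v 3 := by linarith
  set X := v 1 * x 0 + v 2 * x 1 + v 3 * x 2
  have : -(X * v 0) + (x 0 + X / (1 + v 0) * v 1) * v 1 + (x 1 + X / (1 + v 0) * v 2) * v 2 +
      (x 2 + X / (1 + v 0) * v 3) * v 3 =
      - (X * v 0) + X + X / (1 + v 0) * (v 1 * v 1 + v 2 * v 2 + v 3 * v 3) := by
    simp only [X]; ring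
  rw [this, ← e]
  field_simp
  ring

theorem boost_unboost {v n : Minkowski} (hv : v ∈ hyperbolicSpace) (hn : lorentz n v = 0) :
    boost v (unboost v n) = n := by
  obtain ⟨h0, h1⟩ := hv
  have hne : (1 + v 0) ≠ 0 := by positivity
  simp only [lorentz] at *
  have e : (v 0 - 1) * (1 + v 0) = v 1 * v 1 + v 2 * v 2 + v 3 * v 3 := by linarith
  have key : v 1 * (n 1 - n 0 / (1 + v 0) * v 1) + v 2 * (n 2 - n 0 / (1 + v 0) * v 2) +
      v 3 * (n 3 - n 0 / (1 + v 0) * v 3) = n 0 := by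
    have : v 1 * (n 1 - n 0 / (1 + v 0) * v 1) + v 2 * (n 2 - n 0 / (1 + v 0) * v 2) +
      v 3 * (n 3 - n 0 / (1 + v 0) * v 3) = (n 1 * v 1 + n 2 * v 2 + n 3 * v 3)
        - n 0 / (1 + v 0) * (v 1 * v 1 + v 2 * v 2 + v 3 * v 3) := by ring
    rw [this, ← e]
    field_simp
    linarith
  funext i
  fin_cases i <;> simp [boost, unboost, key]

theorem lorentz_boost_eq_inner_unboost {v n : Minkowski} (hv : v ∈ hyperbolicSpace)
    (hn : lorentz n v = 0) (x : E3) : lorentz (boost v x) n = inner ℝ x (unboost v n) := by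
  rw [← lorentz_boost_boost hv, boost_unboost hv hn]

theorem boost_injective {v : Minkowski} (hv : v ∈ hyperbolicSpace) :
    Function.Injective (boost v) := by
  intro x y h
  refine ext_inner_right ℝ fun z => ?_
  rw [← lorentz_boost_boost hv, ← lorentz_boost_boost hv, h]

section

/-! ### Two facts about real functions -/

open MeasureTheory in
/-- **Wirtinger's inequality**, for functions with a right derivative. -/
theorem integral_sq_le_integral_sq_deriv {L : ℝ} (hL : 0 < L) (hL2 : L ≤ 2 * Real.pi)
    {f f' : ℝ → ℝ} (hf : Continuous f)
    (hd : ∀ x, HasDerivWithinAt f (f' x) (Set.Ioi x) x) (hm : Measurable f') {C : ℝ}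
    (hC : ∀ x, |f' x| ≤ C) (hper : f L = f 0) (hmean : ∫ x in (0 : ℝ)..L, f x = 0) :
    ∫ x in (0 : ℝ)..L, f x ^ 2 ≤ ∫ x in (0 : ℝ)..L, f' x ^ 2 := by
  have hF : MemLp (fun x => (f x : ℂ)) 2 (volume.restrict (Set.Ioc 0 L)) := by
    obtain ⟨K, hK⟩ := isCompact_Icc.exists_bound_of_continuousOn (hf.continuousOn (s := Set.Icc 0 L))
    refine MemLp.of_bound (Continuous.aestronglyMeasurable (by fun_prop)) K ?_
    filter_upwards [ae_restrict_mem measurableSet_Ioc] with x hx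
    simpa using hK x ⟨hx.1.le, hx.2⟩
  have hF' : MemLp (fun x => (f' x : ℂ)) 2 (volume.restrict (Set.Ioc 0 L)) := by
    refine MemLp.of_bound (Measurable.aestronglyMeasurable (by fun_prop)) C ?_
    exact Filter.Eventually.of_forall fun x => by simpa using hC x
  have hi : IntervalIntegrable (fun x => (f' x : ℂ)) volume 0 L := by
    rw [intervalIntegrable_iff, Set.uIoc_of_le hL.le]
    exact hF'.integrable (by norm_num)
  have h1 := hasSum_sq_fourierCoeffOn hL hF
  have h2 := hasSum_sq_fourierCoeffOn hL hF'
  -- Coefficientwise: for `n ≠ 0` integration by parts gives the factor `L / (2π|n|)`, at most `1`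
  -- because `L ≤ 2π`; for `n = 0` the mean vanishes.
  have hle : ∀ n : ℤ, ‖fourierCoeffOn hL (fun x => (f x : ℂ)) n‖ ^ 2 ≤
      ‖fourierCoeffOn hL (fun x => (f' x : ℂ)) n‖ ^ 2 := by
    intro n
    by_cases hn : n = 0
    · have : fourierCoeffOn hL (fun x => (f x : ℂ)) n = 0 := by
        rw [fourierCoeffOn_eq_integral, hn]
        simp [intervalIntegral.integral_ofReal, hmean]
      rw [this]; simp
    · have := fourierCoeffOn_of_hasDeriv_right hL hn
        (f := fun x => (f x : ℂ)) (f' := fun x => (f' x : ℂ)) (by fun_prop)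
        (fun x _ => (hd x).ofReal_comp) hi
      rw [this, hper]
      simp only [sub_self, mul_zero, zero_sub, norm_mul, norm_neg, norm_div, norm_one]
      refine pow_le_pow_left₀ (by positivity) ?_ 2
      have hn1 : (1 : ℝ) ≤ ‖(n : ℂ)‖ := by
        rw [Complex.norm_intCast]; exact_mod_cast Int.one_le_abs hn
      have hLn : ‖((L : ℂ) - ((0 : ℝ) : ℂ))‖ = L := by
        rw [← Complex.ofReal_sub, Complex.norm_real]; simp [abs_of_pos hL]
      rw [hLn]
      have hp : ‖(Real.pi : ℂ)‖ = Real.pi := by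
        rw [Complex.norm_real]; simp [abs_of_pos Real.pi_pos]
      have h2' : ‖(2 : ℂ)‖ = 2 := by simp
      rw [hp, h2', Complex.norm_I, ← mul_assoc]
      refine mul_le_of_le_one_left (norm_nonneg _) ?_
      rw [one_div, inv_mul_le_iff₀ (by positivity)]
      nlinarith [Real.pi_pos]
  have := hasSum_le hle h1 h2
  simp only [sub_zero, smul_eq_mul, Complex.norm_real, Real.norm_eq_abs, sq_abs] at this
  exact le_of_mul_le_mul_left this (inv_pos.2 hL)

/-- A function which is locally antitone from both sides is antitone. -/
theorem le_of_locally_antitone {f : ℝ → ℝ} {a b : ℝ} (hab : a ≤ b)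
    (hr : ∀ t ∈ Set.Ico a b, ∃ δ > 0, ∀ s ∈ Set.Ico 0 δ, f (t + s) ≤ f t)
    (hl : ∀ t ∈ Set.Ioc a b, ∃ δ > 0, ∀ s ∈ Set.Ico 0 δ, f t ≤ f (t - s)) : f b ≤ f a := by
  -- Continuous induction: the left hypothesis carries the bound `f z ≤ f a` up to the supremum, the
  -- right one carries it beyond. No continuity of `f` is needed.
  set S := {x | x ∈ Set.Icc a b ∧ ∀ z ∈ Set.Icc a x, f z ≤ f a} with hS
  have haS : a ∈ S := ⟨⟨le_rfl, hab⟩, fun z hz => by rw [le_antisymm hz.2 hz.1]⟩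
  have hbdd : BddAbove S := ⟨b, fun x hx => hx.1.2⟩
  set c := sSup S
  have hac : a ≤ c := le_csSup hbdd haS
  have hcb : c ≤ b := csSup_le ⟨a, haS⟩ fun x hx => hx.1.2
  have hlt : ∀ z ∈ Set.Ico a c, f z ≤ f a := by
    intro z hz
    obtain ⟨x, hx, hzx⟩ := exists_lt_of_lt_csSup ⟨a, haS⟩ hz.2
    exact hx.2 z ⟨hz.1, hzx.le⟩
  have hc : f c ≤ f a := by
    rcases hac.eq_or_lt with h | h
    · rw [← h]
    · obtain ⟨δ, hδ, h1⟩ := hl c ⟨h, hcb⟩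
      have hm : 0 < min (δ / 2) (c - a) := lt_min (by linarith) (by linarith)
      refine (h1 (min (δ / 2) (c - a)) ⟨hm.le, ?_⟩).trans (hlt _ ⟨?_, by linarith⟩)
      · have := min_le_left (δ / 2) (c - a); linarith
      · have := min_le_right (δ / 2) (c - a); linarith
  rcases hcb.eq_or_lt with h | h
  · rw [← h]; exact hc
  · exfalso
    obtain ⟨δ, hδ, h1⟩ := hr c ⟨hac, h⟩
    have hm : 0 < min (δ / 2) (b - c) := lt_min (by linarith) (by linarith)
    have hmem : c + min (δ / 2) (b - c) ∈ S := by
      refine ⟨⟨by linarith, by have := min_le_right (δ / 2) (b - c); linarith⟩, fun z hz => ?_⟩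
      rcases lt_or_ge z c with hz1 | hz1
      · exact hlt z ⟨hz.1, hz1⟩
      · have := h1 (z - c) ⟨by linarith, by have := min_le_left (δ / 2) (b - c); linarith [hz.2]⟩
        rw [add_sub_cancel] at this
        exact this.trans hc
    have := le_csSup hbdd hmem
    linarith

/-! ### Broken geodesics of de Sitter space -/

/-- `γ` is a curve composed of unit speed great-circle arcs of de Sitter space, with right and left
unit directions `u t` and `w t` at `γ t`, which at its breakpoints is bent towards the future. -/
structure IsBrokenGeodesic (γ u w : ℝ → Minkowski) : Prop where
  self : ∀ t, lorentz (γ t) (γ t) = 1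
  right_self : ∀ t, lorentz (u t) (u t) = 1
  left_self : ∀ t, lorentz (w t) (w t) = 1
  right_orth : ∀ t, lorentz (γ t) (u t) = 0
  left_orth : ∀ t, lorentz (γ t) (w t) = 0
  bend : ∀ t, u t + w t = 0 ∨ FutureTimelike (u t + w t)
  arc : ∀ t, ∃ δ > 0, ∀ s ∈ Set.Ico 0 δ, γ (t + s) = Real.cos s • γ t + Real.sin s • u t ∧
    γ (t - s) = Real.cos s • γ t + Real.sin s • w t

theorem eq_of_arc_eq {x a b : Minkowski} {δ : ℝ} (hδ : 0 < δ)
    (h : ∀ s ∈ Set.Ico 0 δ, Real.cos s • x + Real.sin s • a = Real.cos s • x + Real.sin s • b) :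
    a = b := by
  -- Capping the parameter at `1 < π` keeps the sine positive.
  have hm : 0 < min (δ / 2) 1 := lt_min (by linarith) one_pos
  have h1 := h (min (δ / 2) 1) ⟨hm.le, by have := min_le_left (δ / 2) 1; linarith⟩
  have hs : 0 < Real.sin (min (δ / 2) 1) :=
    Real.sin_pos_of_pos_of_lt_pi hm (by have := min_le_right (δ / 2) 1; linarith [Real.pi_gt_three])
  exact smul_right_injective _ hs.ne' (add_left_cancel h1)

namespace IsBrokenGeodesic

variable {γ u w : ℝ → Minkowski}

theorem reverse (h : IsBrokenGeodesic γ u w) :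
    IsBrokenGeodesic (fun t => γ (-t)) (fun t => w (-t)) (fun t => u (-t)) where
  self t := h.self _
  right_self t := h.left_self _
  left_self t := h.right_self _
  right_orth t := h.left_orth _
  left_orth t := h.right_orth _
  bend t := by simpa only [add_comm] using h.bend (-t)
  arc t := by
    obtain ⟨δ, hδ, h1⟩ := h.arc (-t)
    refine ⟨δ, hδ, fun s hs => ⟨?_, ?_⟩⟩
    · rw [neg_add, ← sub_eq_add_neg]; exact (h1 s hs).2
    · rw [neg_sub', sub_neg_eq_add]; exact (h1 s hs).1

theorem right_unique (h : IsBrokenGeodesic γ u w) {t : ℝ} {a : Minkowski} {δ : ℝ} (hδ : 0 < δ)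
    (ha : ∀ s ∈ Set.Ico 0 δ, γ (t + s) = Real.cos s • γ t + Real.sin s • a) : u t = a := by
  obtain ⟨δ', hδ', h1⟩ := h.arc t
  refine eq_of_arc_eq (x := γ t) (lt_min hδ hδ') fun s hs => ?_
  rw [← ha s ⟨hs.1, hs.2.trans_le (min_le_left _ _)⟩,
    ← (h1 s ⟨hs.1, hs.2.trans_le (min_le_right _ _)⟩).1]

theorem left_unique (h : IsBrokenGeodesic γ u w) {t : ℝ} {a : Minkowski} {δ : ℝ} (hδ : 0 < δ)
    (ha : ∀ s ∈ Set.Ico 0 δ, γ (t - s) = Real.cos s • γ t + Real.sin s • a) : w t = a := by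
  obtain ⟨δ', hδ', h1⟩ := h.arc t
  refine eq_of_arc_eq (x := γ t) (lt_min hδ hδ') fun s hs => ?_
  rw [← ha s ⟨hs.1, hs.2.trans_le (min_le_left _ _)⟩,
    ← (h1 s ⟨hs.1, hs.2.trans_le (min_le_right _ _)⟩).2]

/-- The right directions on the two arcs issuing from `γ t`. -/
theorem directions (h : IsBrokenGeodesic γ u w) (t : ℝ) : ∃ δ > 0, ∀ s ∈ Set.Ico 0 δ,
    γ (t + s) = Real.cos s • γ t + Real.sin s • u t ∧
    γ (t - s) = Real.cos s • γ t + Real.sin s • w t ∧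
    u (t + s) = -Real.sin s • γ t + Real.cos s • u t ∧
    (0 < s → u (t - s) = Real.sin s • γ t - Real.cos s • w t) ∧
    (0 < s → u (t - s) + w (t - s) = 0) ∧ (0 < s → u (t + s) + w (t + s) = 0) := by
  obtain ⟨δ, hδ, h1⟩ := h.arc t
  have hr : ∀ s ∈ Set.Ico 0 δ, u (t + s) = -Real.sin s • γ t + Real.cos s • u t := by
    intro s hs
    refine h.right_unique (δ := δ - s) (by linarith [hs.2]) fun r hr => ?_
    rw [add_assoc, (h1 (s + r) ⟨by linarith [hs.1, hr.1], by linarith [hr.2]⟩).1, (h1 s hs).1,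
      Real.cos_add, Real.sin_add]
    module
  have hl : ∀ s ∈ Set.Ico 0 δ, 0 < s → u (t - s) = Real.sin s • γ t - Real.cos s • w t := by
    intro s hs hs0
    refine h.right_unique (δ := s) hs0 fun r hr => ?_
    rw [show t - s + r = t - (s - r) by ring, (h1 (s - r) ⟨by linarith [hr.2],
      by linarith [hr.1, hs.2]⟩).2, (h1 s hs).2, Real.cos_sub, Real.sin_sub]
    module
  have hl' : ∀ s ∈ Set.Ico 0 δ, 0 < s → w (t - s) = -(Real.sin s • γ t - Real.cos s • w t) := by
    intro s hs hs0
    refine h.left_unique (δ := δ - s) (by linarith [hs.2]) fun r hr => ?_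
    rw [show t - s - r = t - (s + r) by ring, (h1 (s + r) ⟨by linarith [hs.1, hr.1],
      by linarith [hr.2]⟩).2, (h1 s hs).2, Real.cos_add, Real.sin_add]
    module
  have hr' : ∀ s ∈ Set.Ico 0 δ, 0 < s → w (t + s) = -(-Real.sin s • γ t + Real.cos s • u t) := by
    intro s hs hs0
    refine h.left_unique (δ := s) hs0 fun r hr => ?_
    rw [show t + s - r = t + (s - r) by ring, (h1 (s - r) ⟨by linarith [hr.2],
      by linarith [hr.1, hs.2]⟩).1, (h1 s hs).1, Real.cos_sub, Real.sin_sub]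
    module
  refine ⟨δ, hδ, fun s hs => ⟨(h1 s hs).1, (h1 s hs).2, hr s hs, hl s hs, fun h0 => ?_,
    fun h0 => ?_⟩⟩
  · rw [hl s hs h0, hl' s hs h0]; abel
  · rw [hr s hs, hr' s hs h0]; abel

/-- The Wronskian of `⟨γ, y⟩` with `x ↦ sin (S - x)`. -/
noncomputable def wronskian (γ u : ℝ → Minkowski) (y : Minkowski) (t S x : ℝ) : ℝ :=
  lorentz (u (t + x)) y * Real.sin (S - x) + lorentz (γ (t + x)) y * Real.cos (S - x)

/-- On an arc both functions solve `k'' = -k`, so their Wronskian is constant. No jump is seen to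
the right of a breakpoint because `u` is the right direction. -/
theorem wronskian_right (h : IsBrokenGeodesic γ u w) (y : Minkowski) (t S x : ℝ) :
    ∃ δ > 0, ∀ s ∈ Set.Ico 0 δ, wronskian γ u y t S (x + s) = wronskian γ u y t S x := by
  obtain ⟨δ, hδ, h1⟩ := h.directions (t + x)
  refine ⟨δ, hδ, fun s hs => ?_⟩
  obtain ⟨e1, -, e2, -⟩ := h1 s hs
  simp only [wronskian, ← add_assoc, e1, e2, lorentz_add_left, lorentz_smul_left, ← sub_sub]
  rw [Real.sin_sub _ s, Real.cos_sub _ s]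
  linear_combination (lorentz (u (t + x)) y * Real.sin (S - x) +
    lorentz (γ (t + x)) y * Real.cos (S - x)) * Real.sin_sq_add_cos_sq s

/-- Just before the breakpoint the forward direction is governed by `-w`, not by `u`; the difference
`u + w` is the bend and produces the jump. -/
theorem wronskian_left (h : IsBrokenGeodesic γ u w) (y : Minkowski) (t S x : ℝ) :
    ∃ δ > 0, ∀ s ∈ Set.Ioo 0 δ, wronskian γ u y t S (x - s) = wronskian γ u y t S x -
      lorentz (u (t + x) + w (t + x)) y * Real.sin (S - x) := by
  obtain ⟨δ, hδ, h1⟩ := h.directions (t + x)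
  refine ⟨δ, hδ, fun s hs => ?_⟩
  obtain ⟨-, e1, -, e2, -⟩ := h1 s ⟨hs.1.le, hs.2⟩
  have e2 := e2 hs.1
  simp only [wronskian, ← add_sub_assoc, e1, e2, lorentz_add_left, lorentz_sub_left,
    lorentz_smul_left]
  rw [show S - (x - s) = S - x + s by ring, Real.sin_add _ s, Real.cos_add _ s]
  linear_combination (-lorentz (w (t + x)) y * Real.sin (S - x) +
    lorentz (γ (t + x)) y * Real.cos (S - x)) * Real.sin_sq_add_cos_sq s

theorem wronskian_antitone (h : IsBrokenGeodesic γ u w) {y : Minkowski} {t S a b : ℝ}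
    (ha : 0 ≤ a) (hab : a ≤ b) (hb : b ≤ S) (hS : S ≤ Real.pi)
    (hy : ∀ x ∈ Set.Ioo 0 S, lorentz (u (t + x) + w (t + x)) y ≤ 0) :
    wronskian γ u y t S b ≤ wronskian γ u y t S a := by
  refine le_of_locally_antitone hab (fun x _ => ?_) fun x hx => ?_
  · obtain ⟨δ, hδ, h1⟩ := h.wronskian_right y t S x
    exact ⟨δ, hδ, fun s hs => (h1 s hs).le⟩
  · obtain ⟨δ, hδ, h1⟩ := h.wronskian_left y t S x
    refine ⟨δ, hδ, fun s hs => ?_⟩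
    rcases hs.1.eq_or_lt with h0 | h0
    · rw [← h0, sub_zero]
    · rw [h1 s ⟨h0, hs.2⟩]
      have hle : lorentz (u (t + x) + w (t + x)) y * Real.sin (S - x) ≤ 0 := by
        rcases (hx.2.trans hb).eq_or_lt with h2 | h2
        · simp [h2]
        · exact mul_nonpos_of_nonpos_of_nonneg (hy x ⟨by linarith [hx.1], h2⟩)
            (Real.sin_nonneg_of_nonneg_of_le_pi (by linarith) (by linarith [hx.1]))
      linarith

/-- **Sturm comparison** along a broken geodesic. -/
theorem sturm (h : IsBrokenGeodesic γ u w) {y : Minkowski} {t S : ℝ} (h0 : 0 ≤ S)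
    (hS : S ≤ Real.pi) (hy : ∀ x ∈ Set.Ioo 0 S, lorentz (u (t + x) + w (t + x)) y ≤ 0) :
    lorentz (γ (t + S)) y ≤ Real.cos S * lorentz (γ t) y + Real.sin S * lorentz (u t) y := by
  have := h.wronskian_antitone le_rfl h0 le_rfl hS hy
  simp only [wronskian, sub_self, Real.sin_zero, Real.cos_zero, sub_zero, add_zero] at this
  linarith

/-- A single bend with strictly negative pairing at an interior time makes the Wronskian drop
strictly, since its weight `sin (S - x)` is positive there. -/
theorem sturm_strict (h : IsBrokenGeodesic γ u w) {y : Minkowski} {t S : ℝ}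
    (hS : S ≤ Real.pi) (hy : ∀ x ∈ Set.Ioo 0 S, lorentz (u (t + x) + w (t + x)) y ≤ 0)
    {x : ℝ} (hx : x ∈ Set.Ioo 0 S) (hxy : lorentz (u (t + x) + w (t + x)) y < 0) :
    lorentz (γ (t + S)) y < Real.cos S * lorentz (γ t) y + Real.sin S * lorentz (u t) y := by
  obtain ⟨δ, hδ, h1⟩ := h.wronskian_left y t S x
  have hm : 0 < min (δ / 2) x := lt_min (by linarith) hx.1
  have h2 := h1 (min (δ / 2) x) ⟨hm, by have := min_le_left (δ / 2) x; linarith⟩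
  have h3 := mul_neg_of_neg_of_pos hxy (Real.sin_pos_of_pos_of_lt_pi (x := S - x)
    (by linarith [hx.2]) (by linarith [hx.1]))
  have h4 := h.wronskian_antitone hx.1.le hx.2.le le_rfl hS hy
  have h5 := h.wronskian_antitone le_rfl (b := x - min (δ / 2) x)
    (by have := min_le_right (δ / 2) x; linarith) (by linarith [hx.2]) hS hy
  have e1 : wronskian γ u y t S S = lorentz (γ (t + S)) y := by simp [wronskian]
  have e2 : wronskian γ u y t S 0 =
    Real.cos S * lorentz (γ t) y + Real.sin S * lorentz (u t) y := by
      simp only [wronskian, add_zero, sub_zero]; ring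
  linarith

theorem sturm_reverse (h : IsBrokenGeodesic γ u w) {y : Minkowski} {t S : ℝ} (h0 : 0 ≤ S)
    (hS : S ≤ Real.pi) (hy : ∀ x ∈ Set.Ioo 0 S, lorentz (u (t - x) + w (t - x)) y ≤ 0) :
    lorentz (γ (t - S)) y ≤ Real.cos S * lorentz (γ t) y + Real.sin S * lorentz (w t) y := by
  have := h.reverse.sturm (t := -t) h0 hS (y := y)
    (fun x hx => by
      have := hy x hx
      rwa [neg_add, neg_neg, ← sub_eq_add_neg, add_comm (w _)])
  simpa [neg_add, ← sub_eq_add_neg, add_comm, sub_eq_add_neg] using this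

/-- Without breakpoints a broken geodesic is a great-circle arc. -/
theorem eq_arc (h : IsBrokenGeodesic γ u w) {t S : ℝ} (h0 : 0 ≤ S) (hS : S ≤ Real.pi)
    (hb : ∀ x ∈ Set.Ioo 0 S, u (t + x) + w (t + x) = 0) :
    γ (t + S) = Real.cos S • γ t + Real.sin S • u t := by
  refine eq_of_forall_lorentz_eq fun z => ?_
  -- With no bends Sturm comparison applies to both `z` and `-z`, giving equality.
  have h1 := h.sturm (y := z) (t := t) h0 hS fun x hx => by simp [hb x hx]
  have h2 := h.sturm (y := -z) (t := t) h0 hS fun x hx => by simp [hb x hx]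
  simp only [lorentz_neg_right, lorentz_add_left, lorentz_smul_left] at *
  linarith

theorem bend_lorentz_nonpos (h : IsBrokenGeodesic γ u w) (t : ℝ) {y : Minkowski}
    (hy : FutureCausal y) : lorentz (u t + w t) y ≤ 0 := by
  rcases h.bend t with h1 | h1
  · simp [h1]
  · exact (lorentz_neg_of_futureTimelike h1 hy).le

end IsBrokenGeodesic

end

/-- Parseval for the orthonormal frame consisting of `p` and the three boosted coordinate vectors.
The minus sign of the timelike direction is moved to the right. -/
theorem sum_sq_lorentz_boost {p : Minkowski} (hp : p ∈ hyperbolicSpace) (x : Minkowski) :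
    ∑ i : Fin 3, lorentz x (boost p (EuclideanSpace.single i 1)) ^ 2 =
      lorentz x x + lorentz x p ^ 2 := by
  have ho : lorentz (x + lorentz x p • p) p = 0 := by simp [hp.2]
  have hx : ∀ i : Fin 3, lorentz x (boost p (EuclideanSpace.single i 1)) =
      unboost p (x + lorentz x p • p) i := by
    intro i
    have h1 := lorentz_boost_eq_inner_unboost hp ho (EuclideanSpace.single i 1)
    rw [EuclideanSpace.inner_single_left] at h1
    simp only [map_one, one_mul, lorentz_add_right, lorentz_smul_right,
      lorentz_boost_left hp, mul_zero, add_zero] at h1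
    rw [lorentz_comm, h1]
  simp_rw [hx]
  have h2 := lorentz_boost_boost hp (unboost p (x + lorentz x p • p))
    (unboost p (x + lorentz x p • p))
  rw [boost_unboost hp ho, inner_E3] at h2
  simp only [lorentz_add_left, lorentz_add_right, lorentz_smul_left, lorentz_smul_right, hp.2,
    lorentz_comm p x] at h2
  rw [Fin.sum_univ_three]
  nlinarith

/-! ### Momentum and energy of broken geodesics -/

namespace IsBrokenGeodesic

variable {γ u w : ℝ → Minkowski}

theorem continuous (h : IsBrokenGeodesic γ u w) : Continuous γ := by
  rw [continuous_iff_continuousAt]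
  intro t
  obtain ⟨δ, hδ, h1⟩ := h.arc t
  rw [continuousAt_iff_continuous_left_right]
  constructor
  · have hc : ContinuousWithinAt (fun x => Real.cos (t - x) • γ t + Real.sin (t - x) • w t)
        (Set.Iic t) t := by
      apply Continuous.continuousWithinAt
      fun_prop
    refine hc.congr_of_eventuallyEq ?_ (by simp)
    filter_upwards [Ioc_mem_nhdsLE (show t - δ < t by linarith)] with x hx
    rw [← (h1 (t - x) ⟨by linarith [hx.2], by linarith [hx.1]⟩).2, sub_sub_cancel]
  · have hc : ContinuousWithinAt (fun x => Real.cos (x - t) • γ t + Real.sin (x - t) • u t)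
        (Set.Ici t) t := by
      apply Continuous.continuousWithinAt
      fun_prop
    refine hc.congr_of_eventuallyEq ?_ (by simp)
    filter_upwards [Ico_mem_nhdsGE (show t < t + δ by linarith)] with x hx
    rw [← (h1 (x - t) ⟨by linarith [hx.1], by linarith [hx.2]⟩).1, add_sub_cancel]

theorem hasDerivWithinAt (h : IsBrokenGeodesic γ u w) (y : Minkowski) (t : ℝ) :
    HasDerivWithinAt (fun x => lorentz (γ x) y) (lorentz (u t) y) (Set.Ioi t) t := by
  obtain ⟨δ, hδ, h1⟩ := h.arc t
  have hd : HasDerivAt (fun x => Real.cos (x - t) * lorentz (γ t) y +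
      Real.sin (x - t) * lorentz (u t) y) (lorentz (u t) y) t := by
    have h0 : HasDerivAt (fun x : ℝ => x - t) 1 t := (hasDerivAt_id t).sub_const t
    refine (((h0.cos).mul_const (lorentz (γ t) y)).add
      ((h0.sin).mul_const (lorentz (u t) y))).congr_deriv ?_
    simp
  refine hd.hasDerivWithinAt.congr_of_eventuallyEq ?_ (by simp)
  filter_upwards [Ioo_mem_nhdsGT (show t < t + δ by linarith)] with x hx
  have := (h1 (x - t) ⟨by linarith [hx.1], by linarith [hx.2]⟩).1
  rw [add_sub_cancel] at this
  rw [this]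
  simp

/-- The function is the right derivative of a continuous function. -/
theorem measurable_lorentz (h : IsBrokenGeodesic γ u w) (y : Minkowski) :
    Measurable fun x => lorentz (u x) y := by
  have : (fun x => lorentz (u x) y) =
      fun t => derivWithin (fun x => lorentz (γ x) y) (Set.Ioi t) t := by
    funext t
    exact ((h.hasDerivWithinAt y t).derivWithin (uniqueDiffWithinAt_Ioi t)).symm
  rw [this]
  exact measurable_derivWithin_Ioi _

theorem right_periodic (h : IsBrokenGeodesic γ u w) {L : ℝ} (hper : Function.Periodic γ L) :
    Function.Periodic u L := by
  intro t
  obtain ⟨δ, hδ, h1⟩ := h.arc t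
  refine h.right_unique hδ fun s hs => ?_
  rw [show t + L + s = t + s + L by ring, hper, hper, (h1 s hs).1]

theorem exists_bound (h : IsBrokenGeodesic γ u w) {L : ℝ} (hL : 0 < L)
    (hper : Function.Periodic γ L) (y : Minkowski) : ∃ C, ∀ x, |lorentz (u x) y| ≤ C := by
  have key : ∃ C, ∀ x ∈ Set.Icc 0 L, |lorentz (u x) y| ≤ C := by
    refine isCompact_Icc.induction_on (p := fun s => ∃ C, ∀ x ∈ s, |lorentz (u x) y| ≤ C)
      ⟨0, by simp⟩ (fun s t hst ⟨C, hC⟩ => ⟨C, fun x hx => hC x (hst hx)⟩)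
      (fun s t ⟨C, hC⟩ ⟨D, hD⟩ => ⟨max C D, fun x hx => ?_⟩) fun t _ => ?_
    · rcases hx with hx | hx
      · exact (hC x hx).trans (le_max_left _ _)
      · exact (hD x hx).trans (le_max_right _ _)
    · obtain ⟨δ, hδ, h1⟩ := h.directions t
      refine ⟨Set.Ioo (t - δ) (t + δ), mem_nhdsWithin_of_mem_nhds
        (Ioo_mem_nhds (by linarith) (by linarith)),
        |lorentz (γ t) y| + |lorentz (u t) y| + |lorentz (w t) y|, fun x hx => ?_⟩
      have tri : ∀ a b c d : ℝ, |a| ≤ 1 → |b| ≤ 1 → |a * c + b * d| ≤ |c| + |d| := by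
        intro a b c d ha hb
        refine (abs_add_le _ _).trans (add_le_add ?_ ?_) <;> rw [abs_mul] <;>
          exact mul_le_of_le_one_left (abs_nonneg _) (by assumption)
      rcases le_or_gt t x with hx1 | hx1
      · obtain ⟨-, -, e, -⟩ := h1 (x - t) ⟨by linarith, by linarith [hx.2]⟩
        rw [add_sub_cancel] at e
        rw [e, lorentz_add_left, lorentz_smul_left, lorentz_smul_left]
        refine (tri _ _ _ _ (by rw [abs_neg]; exact Real.abs_sin_le_one _)
          (Real.abs_cos_le_one _)).trans ?_
        linarith [abs_nonneg (lorentz (w t) y)]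
      · obtain ⟨-, -, -, e, -⟩ := h1 (t - x) ⟨by linarith, by linarith [hx.1]⟩
        have e := e (by linarith)
        rw [sub_sub_cancel] at e
        rw [e, lorentz_sub_left, lorentz_smul_left, lorentz_smul_left, sub_eq_add_neg, ← neg_mul]
        refine (tri _ _ _ _ (Real.abs_sin_le_one _)
          (by rw [abs_neg]; exact Real.abs_cos_le_one _)).trans ?_
        linarith [abs_nonneg (lorentz (u t) y)]
  obtain ⟨C, hC⟩ := key
  refine ⟨C, fun x => ?_⟩
  obtain ⟨z, hz, e⟩ := (h.right_periodic hper).exists_mem_Ico₀ hL x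
  rw [e]
  exact hC z ⟨hz.1, hz.2.le⟩

/-- The direction plus the integral of the curve is antitone along the curve. -/
noncomputable def momentum (γ u : ℝ → Minkowski) (y : Minkowski) (x : ℝ) : ℝ :=
  lorentz (u x) y + ∫ r in (0 : ℝ)..x, lorentz (γ r) y

/-- On an arc `γ'' = -γ`, so the derivative of the direction cancels that of the integral. Only the
jump of the direction at a breakpoint survives. -/
theorem momentum_local (h : IsBrokenGeodesic γ u w) (y : Minkowski) (x : ℝ) :
    ∃ δ > 0, ∀ s ∈ Set.Ioo 0 δ, momentum γ u y (x + s) = momentum γ u y x ∧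
      momentum γ u y (x - s) = momentum γ u y x - lorentz (u x + w x) y := by
  obtain ⟨δ, hδ, h1⟩ := h.directions x
  have hc : Continuous fun r => lorentz (γ r) y := h.continuous.lorentz continuous_const
  refine ⟨δ, hδ, fun s hs => ⟨?_, ?_⟩⟩
  · have e1 : ∫ r in x..(x + s), lorentz (γ r) y =
        ∫ r in (0 : ℝ)..s, (Real.cos r * lorentz (γ x) y + Real.sin r * lorentz (u x) y) := by
      have := intervalIntegral.integral_comp_add_left (a := 0) (b := s)
        (fun r => lorentz (γ r) y) x
      rw [add_zero] at this
      rw [← this]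
      refine intervalIntegral.integral_congr fun r hr => ?_
      rw [Set.uIcc_of_le hs.1.le] at hr
      simp only [(h1 r ⟨hr.1, hr.2.trans_lt hs.2⟩).1, lorentz_add_left, lorentz_smul_left]
    rw [intervalIntegral.integral_add (by apply Continuous.intervalIntegrable; fun_prop)
      (by apply Continuous.intervalIntegrable; fun_prop), intervalIntegral.integral_mul_const,
      intervalIntegral.integral_mul_const, integral_cos, integral_sin] at e1
    have e2 := intervalIntegral.integral_add_adjacent_intervals
      (hc.intervalIntegrable 0 x (μ := MeasureTheory.volume)) (hc.intervalIntegrable x (x + s))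
    simp only [momentum, ← e2, e1, (h1 s ⟨hs.1.le, hs.2⟩).2.2.1, lorentz_add_left,
      lorentz_smul_left, Real.sin_zero, Real.cos_zero]
    ring
  · have e1 : ∫ r in (x - s)..x, lorentz (γ r) y =
        ∫ r in (0 : ℝ)..s, (Real.cos r * lorentz (γ x) y + Real.sin r * lorentz (w x) y) := by
      have := intervalIntegral.integral_comp_sub_left (a := 0) (b := s)
        (fun r => lorentz (γ r) y) x
      rw [sub_zero] at this
      rw [← this]
      refine intervalIntegral.integral_congr fun r hr => ?_
      rw [Set.uIcc_of_le hs.1.le] at hr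
      simp only [(h1 r ⟨hr.1, hr.2.trans_lt hs.2⟩).2.1, lorentz_add_left, lorentz_smul_left]
    rw [intervalIntegral.integral_add (by apply Continuous.intervalIntegrable; fun_prop)
      (by apply Continuous.intervalIntegrable; fun_prop), intervalIntegral.integral_mul_const,
      intervalIntegral.integral_mul_const, integral_cos, integral_sin] at e1
    have e2 := intervalIntegral.integral_add_adjacent_intervals
      (hc.intervalIntegrable 0 (x - s) (μ := MeasureTheory.volume)) (hc.intervalIntegrable (x - s) x)
    simp only [momentum, ← e2, e1, (h1 s ⟨hs.1.le, hs.2⟩).2.2.2.1 hs.1, lorentz_add_left,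
      lorentz_sub_left, lorentz_smul_left, Real.sin_zero, Real.cos_zero]
    ring

/-- The energy defect `k k' - ∫ (k'² - k²)` of `k = ⟨γ, y⟩`. -/
noncomputable def energy (γ u : ℝ → Minkowski) (y : Minkowski) (x : ℝ) : ℝ :=
  lorentz (γ x) y * lorentz (u x) y -
    ∫ r in (0 : ℝ)..x, (lorentz (u r) y ^ 2 - lorentz (γ r) y ^ 2)

theorem intervalIntegrable_energy (h : IsBrokenGeodesic γ u w) {L : ℝ} (hL : 0 < L)
    (hper : Function.Periodic γ L) (y : Minkowski) (a b : ℝ) :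
    IntervalIntegrable (fun r => lorentz (u r) y ^ 2 - lorentz (γ r) y ^ 2)
      MeasureTheory.volume a b := by
  have hc : Continuous fun r => lorentz (γ r) y := h.continuous.lorentz continuous_const
  refine IntervalIntegrable.sub ?_ ((hc.pow 2).intervalIntegrable a b)
  obtain ⟨C, hC⟩ := h.exists_bound hL hper y
  refine (intervalIntegrable_const (c := C ^ 2)).mono_fun
    (((h.measurable_lorentz y).pow_const 2).aestronglyMeasurable) ?_
  refine Filter.Eventually.of_forall fun x => ?_
  simp only [Real.norm_eq_abs, abs_pow, sq_abs]
  exact sq_le_sq' (abs_le.1 (hC x)).1 (abs_le.1 (hC x)).2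

theorem integral_arc_energy (a b s : ℝ) :
    ∫ r in (0 : ℝ)..s, ((-Real.sin r * a + Real.cos r * b) ^ 2 -
      (Real.cos r * a + Real.sin r * b) ^ 2) =
    (Real.cos s * a + Real.sin s * b) * (-Real.sin s * a + Real.cos s * b) - a * b := by
  rw [intervalIntegral.integral_eq_sub_of_hasDerivAt
    (f := fun r => (Real.cos r * a + Real.sin r * b) * (-Real.sin r * a + Real.cos r * b))]
  · simp
  · intro r _
    have h1 := ((Real.hasDerivAt_cos r).mul_const a).add ((Real.hasDerivAt_sin r).mul_const b)
    have h2 := (((Real.hasDerivAt_sin r).neg).mul_const a).add ((Real.hasDerivAt_cos r).mul_const b)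
    refine (h1.mul h2).congr_deriv ?_
    dsimp
    ring
  · apply Continuous.intervalIntegrable
    fun_prop

/-- With `k = ⟨γ, y⟩` one has `(k k')' = k'² - k²` on arcs because `k'' = -k`. At a breakpoint `k`
is continuous and `k'` jumps by the pairing of the bend. -/
theorem energy_local (h : IsBrokenGeodesic γ u w) {L : ℝ} (hL : 0 < L)
    (hper : Function.Periodic γ L) (y : Minkowski) (x : ℝ) :
    ∃ δ > 0, ∀ s ∈ Set.Ioo 0 δ, energy γ u y (x + s) = energy γ u y x ∧
      energy γ u y (x - s) = energy γ u y x - lorentz (γ x) y * lorentz (u x + w x) y := by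
  obtain ⟨δ, hδ, h1⟩ := h.directions x
  have hi := h.intervalIntegrable_energy hL hper y
  refine ⟨δ, hδ, fun s hs => ⟨?_, ?_⟩⟩
  · have e1 : ∫ r in x..(x + s), (lorentz (u r) y ^ 2 - lorentz (γ r) y ^ 2) =
        ∫ r in (0 : ℝ)..s, ((-Real.sin r * lorentz (γ x) y + Real.cos r * lorentz (u x) y) ^ 2 -
          (Real.cos r * lorentz (γ x) y + Real.sin r * lorentz (u x) y) ^ 2) := by
      have := intervalIntegral.integral_comp_add_left (a := 0) (b := s)
        (fun r => lorentz (u r) y ^ 2 - lorentz (γ r) y ^ 2) x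
      rw [add_zero] at this
      rw [← this]
      refine intervalIntegral.integral_congr fun r hr => ?_
      rw [Set.uIcc_of_le hs.1.le] at hr
      simp only [(h1 r ⟨hr.1, hr.2.trans_lt hs.2⟩).1, (h1 r ⟨hr.1, hr.2.trans_lt hs.2⟩).2.2.1,
        lorentz_add_left, lorentz_smul_left]
    rw [integral_arc_energy] at e1
    have e2 := intervalIntegral.integral_add_adjacent_intervals (hi 0 x) (hi x (x + s))
    simp only [energy, ← e2, e1, (h1 s ⟨hs.1.le, hs.2⟩).1, (h1 s ⟨hs.1.le, hs.2⟩).2.2.1,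
      lorentz_add_left, lorentz_smul_left]
    ring
  · have e1 : ∫ r in (x - s)..x, (lorentz (u r) y ^ 2 - lorentz (γ r) y ^ 2) =
        ∫ r in (0 : ℝ)..s, ((-Real.sin r * lorentz (γ x) y + Real.cos r * lorentz (w x) y) ^ 2 -
          (Real.cos r * lorentz (γ x) y + Real.sin r * lorentz (w x) y) ^ 2) := by
      have := intervalIntegral.integral_comp_sub_left (a := 0) (b := s)
        (fun r => lorentz (u r) y ^ 2 - lorentz (γ r) y ^ 2) x
      rw [sub_zero] at this
      rw [← this]
      refine intervalIntegral.integral_congr_ae (Filter.Eventually.of_forall fun r hr => ?_)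
      rw [Set.uIoc_of_le hs.1.le] at hr
      simp only [(h1 r ⟨hr.1.le, hr.2.trans_lt hs.2⟩).2.1,
        (h1 r ⟨hr.1.le, hr.2.trans_lt hs.2⟩).2.2.2.1 hr.1,
        lorentz_add_left, lorentz_smul_left, lorentz_sub_left]
      ring
    rw [integral_arc_energy] at e1
    have e2 := intervalIntegral.integral_add_adjacent_intervals (hi 0 (x - s)) (hi (x - s) x)
    simp only [energy, ← e2, e1, (h1 s ⟨hs.1.le, hs.2⟩).2.1, (h1 s ⟨hs.1.le, hs.2⟩).2.2.2.1 hs.1,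
      lorentz_add_left, lorentz_smul_left, lorentz_sub_left]
    ring

/-- A periodic-up-to-a-constant function with nonpositive jumps decreases over a period. -/
theorem drop_of_jumps {f j : ℝ → ℝ} {L D : ℝ} (hL : 0 < L) (hD : f L = f 0 + D)
    (hfL : ∀ x, f (x + L) = f x + (f L - f 0))
    (hloc : ∀ x, ∃ δ > 0, ∀ s ∈ Set.Ioo 0 δ, f (x + s) = f x ∧ f (x - s) = f x - j x)
    (hj : ∀ x, j x ≤ 0) : D ≤ 0 ∧ ∀ x, j x < 0 → D < 0 := by
  have hanti : ∀ a b, a ≤ b → f b ≤ f a := by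
    intro a b hab
    refine le_of_locally_antitone hab (fun x _ => ?_) fun x _ => ?_
    · obtain ⟨δ, hδ, h1⟩ := hloc x
      refine ⟨δ, hδ, fun s hs => ?_⟩
      rcases hs.1.eq_or_lt with h0 | h0
      · rw [← h0, add_zero]
      · exact (h1 s ⟨h0, hs.2⟩).1.le
    · obtain ⟨δ, hδ, h1⟩ := hloc x
      refine ⟨δ, hδ, fun s hs => ?_⟩
      rcases hs.1.eq_or_lt with h0 | h0
      · rw [← h0, sub_zero]
      · rw [(h1 s ⟨h0, hs.2⟩).2]; linarith [hj x]
  refine ⟨by linarith [hanti 0 L hL.le], fun x hx => ?_⟩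
  obtain ⟨δ, hδ, h1⟩ := hloc x
  have hm : 0 < min (δ / 2) L := lt_min (by linarith) hL
  have h2 := (h1 (min (δ / 2) L) ⟨hm, by have := min_le_left (δ / 2) L; linarith⟩).2
  -- Start the period just before the strict jump: over that period the function has fallen at least
  -- by the jump at `x`.
  have h3 := hanti x (x - min (δ / 2) L + L) (by have := min_le_right (δ / 2) L; linarith)
  rw [hfL] at h3
  linarith

end IsBrokenGeodesic

/-! ### Fenchel's theorem in de Sitter space -/

namespace IsBrokenGeodesic

variable {γ u w : ℝ → Minkowski}

/-- An unbent arc of length `π` would end at the antipode of its start. -/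
theorem exists_bend (h : IsBrokenGeodesic γ u w) (hanti : ∀ t, γ (t + Real.pi) ≠ -γ t) (t : ℝ) :
    ∃ x ∈ Set.Ioo 0 Real.pi, FutureTimelike (u (t + x) + w (t + x)) := by
  by_contra! hcon
  refine hanti t ?_
  rw [h.eq_arc Real.pi_pos.le le_rfl fun x hx => (h.bend (t + x)).resolve_right (hcon x hx)]
  simp

theorem bend_right (h : IsBrokenGeodesic γ u w) (t : ℝ) :
    lorentz (u t) (u t + w t) = lorentz (u t + w t) (u t + w t) / 2 ∧
    lorentz (w t) (u t + w t) = lorentz (u t + w t) (u t + w t) / 2 := by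
  simp only [lorentz_add_left, lorentz_add_right, h.right_self, h.left_self, lorentz_comm (w t)]
  constructor <;> ring

/-- Sturm comparison with the bend itself as test vector: the curve starts orthogonal to it, with
slope half of its negative square, and the later bends can only lower the product. -/
theorem lorentz_bend_neg (h : IsBrokenGeodesic γ u w) {t S : ℝ}
    (ha : FutureTimelike (u t + w t)) (hS : S ∈ Set.Ioo 0 Real.pi) :
    lorentz (γ (t + S)) (u t + w t) < 0 := by
  have h1 := h.sturm (y := u t + w t) (t := t) hS.1.le hS.2.le
    fun x _ => h.bend_lorentz_nonpos _ ha.futureCausal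
  rw [lorentz_add_right (γ t), h.right_orth, h.left_orth, (h.bend_right t).1] at h1
  have := mul_neg_of_pos_of_neg (Real.sin_pos_of_pos_of_lt_pi hS.1 hS.2) ha.2
  linarith

theorem lorentz_bend_nonpos (h : IsBrokenGeodesic γ u w) {L : ℝ} (hL : 0 < L)
    (hL2 : L ≤ 2 * Real.pi) (hper : Function.Periodic γ L) {t : ℝ}
    (ha : FutureTimelike (u t + w t)) (s : ℝ) : lorentz (γ s) (u t + w t) ≤ 0 := by
  obtain ⟨z, hz, e⟩ := hper.exists_mem_Ico hL s t
  rw [e]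
  -- A period of at most `2π` leaves every point within `π` of time `t` in one direction or the
  -- other, so one of the two Sturm comparisons reaches it.
  rcases le_total (z - t) Real.pi with h1 | h1
  · have h2 := h.sturm (y := u t + w t) (t := t) (S := z - t) (by linarith [hz.1]) h1
      fun x _ => h.bend_lorentz_nonpos _ ha.futureCausal
    rw [lorentz_add_right (γ t), h.right_orth, h.left_orth, (h.bend_right t).1,
      add_sub_cancel] at h2
    have := mul_nonpos_of_nonneg_of_nonpos
      (Real.sin_nonneg_of_nonneg_of_le_pi (by linarith [hz.1]) h1) ha.2.le
    linarith
  · have h0 : 0 ≤ t + L - z := by linarith [hz.2]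
    have h2 := h.sturm_reverse (y := u t + w t) (t := t) (S := t + L - z) h0 (by linarith)
      fun x _ => h.bend_lorentz_nonpos _ ha.futureCausal
    rw [lorentz_add_right (γ t), h.right_orth, h.left_orth, (h.bend_right t).2,
      ← hper (t - (t + L - z)), show t - (t + L - z) + L = z by ring] at h2
    have := mul_nonpos_of_nonneg_of_nonpos
      (Real.sin_nonneg_of_nonneg_of_le_pi h0 (by linarith)) ha.2.le
    linarith

/-- The total curve vector. -/
noncomputable def total (γ : ℝ → Minkowski) (L : ℝ) : Minkowski :=
  fun i => ∫ r in (0 : ℝ)..L, γ r i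

theorem lorentz_total (h : IsBrokenGeodesic γ u w) (L : ℝ) (y : Minkowski) :
    lorentz (total γ L) y = ∫ r in (0 : ℝ)..L, lorentz (γ r) y := by
  have hc := h.continuous
  have hi : ∀ (i : Fin 4) (c : ℝ), IntervalIntegrable (fun r => γ r i * c)
      MeasureTheory.volume 0 L := fun i c => by
    apply Continuous.intervalIntegrable
    fun_prop
  have hn : IntervalIntegrable (fun r => -(γ r 0 * y 0)) MeasureTheory.volume 0 L := (hi 0 _).neg
  simp only [lorentz]
  rw [intervalIntegral.integral_add ((hn.add (hi 1 _)).add (hi 2 _)) (hi 3 _),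
    intervalIntegral.integral_add (hn.add (hi 1 _)) (hi 2 _),
    intervalIntegral.integral_add hn (hi 1 _)]
  simp [total, intervalIntegral.integral_neg]

/-- Over a period the direction returns to itself, so the change of momentum is the pairing with the
total vector; by the local jumps it is also a sum of bend pairings. -/
theorem momentum_drop (h : IsBrokenGeodesic γ u w) {L : ℝ} (hL : 0 < L)
    (hper : Function.Periodic γ L) {y : Minkowski} (hy : ∀ t, lorentz (u t + w t) y ≤ 0) :
    lorentz (total γ L) y ≤ 0 ∧
      ∀ t, lorentz (u t + w t) y < 0 → lorentz (total γ L) y < 0 := by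
  have hc : Continuous fun r => lorentz (γ r) y := h.continuous.lorentz continuous_const
  have hp : Function.Periodic (fun r => lorentz (γ r) y) L := fun r => by simp only [hper r]
  have h0 : momentum γ u y L = momentum γ u y 0 + lorentz (total γ L) y := by
    have := h.right_periodic hper 0
    rw [zero_add] at this
    simp [momentum, h.lorentz_total, this]
  refine drop_of_jumps hL h0 (fun x => ?_) (h.momentum_local y) hy
  rw [h0]
  have e := intervalIntegral.integral_add_adjacent_intervals
    (hc.intervalIntegrable 0 x (μ := MeasureTheory.volume)) (hc.intervalIntegrable x (x + L))
  have e2 := hp.intervalIntegral_add_eq x 0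
  rw [zero_add] at e2
  simp only [momentum, h.right_periodic hper x, h.lorentz_total, ← e, e2]
  ring

/-- The boundary term `k k'` is periodic, so the integral over a period is minus the sum of the
jumps of `k k'`, each of which is nonnegative. -/
theorem energy_drop (h : IsBrokenGeodesic γ u w) {L : ℝ} (hL : 0 < L)
    (hper : Function.Periodic γ L) {y : Minkowski} {t : ℝ}
    (hy : ∀ t, 0 ≤ lorentz (γ t) y * lorentz (u t + w t) y)
    (ht : 0 < lorentz (γ t) y * lorentz (u t + w t) y) :
    ∫ r in (0 : ℝ)..L, (lorentz (u r) y ^ 2 - lorentz (γ r) y ^ 2) < 0 := by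
  have hi := h.intervalIntegrable_energy hL hper y
  have hp : Function.Periodic (fun r => lorentz (u r) y ^ 2 - lorentz (γ r) y ^ 2) L :=
    fun r => by simp only [hper r, h.right_periodic hper r]
  have h0 : -energy γ u y L = -energy γ u y 0 +
      ∫ r in (0 : ℝ)..L, (lorentz (u r) y ^ 2 - lorentz (γ r) y ^ 2) := by
    have := h.right_periodic hper 0
    have h2 := hper 0
    rw [zero_add] at this h2
    simp only [energy, this, h2, intervalIntegral.integral_same]
    ring
  refine (drop_of_jumps (f := fun x => -energy γ u y x)
    (j := fun x => -(lorentz (γ x) y * lorentz (u x + w x) y)) hL h0 (fun x => ?_) (fun x => ?_)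
    fun x => neg_nonpos.2 (hy x)).2 t (neg_lt_zero.2 ht)
  · rw [h0]
    have e := intervalIntegral.integral_add_adjacent_intervals (hi 0 x) (hi x (x + L))
    have e2 := hp.intervalIntegral_add_eq x 0
    rw [zero_add] at e2
    simp only [energy, h.right_periodic hper x, hper x, ← e, e2]
    ring
  · obtain ⟨δ, hδ, h1⟩ := h.energy_local hL hper y x
    refine ⟨δ, hδ, fun s hs => ⟨by rw [(h1 s hs).1], by rw [(h1 s hs).2]; ring⟩⟩

/-- **Fenchel's theorem** for broken geodesics of de Sitter space: closed ones without
antipodal points are longer than `2π`. -/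
theorem two_pi_lt (h : IsBrokenGeodesic γ u w) {L : ℝ} (hL : 0 < L)
    (hper : Function.Periodic γ L) (hanti : ∀ t, γ (t + Real.pi) ≠ -γ t) : 2 * Real.pi < L := by
  by_contra! hL2
  set M := total γ L with hM
  have hneg : ∀ y, FutureCausal y → lorentz M y < 0 := by
    intro y hy
    obtain ⟨x, -, hx⟩ := h.exists_bend hanti 0
    exact (h.momentum_drop hL hper fun t => h.bend_lorentz_nonpos t hy).2 _
      (lorentz_neg_of_futureTimelike hx hy)
  -- Every bend pairs negatively with future causal vectors, and at least one bend exists;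
  -- self-duality of the cone then locates `M`.
  have hMt : FutureTimelike M := futureTimelike_of_forall_lorentz_neg hneg
  have hbend : ∀ t s, lorentz (u t + w t) (γ s) ≤ 0 := by
    intro t s
    rcases h.bend t with h1 | h1
    · simp [h1]
    · rw [lorentz_comm]; exact h.lorentz_bend_nonpos hL hL2 hper h1 s
  have hg : ∀ s, lorentz (γ s) M < 0 := by
    intro s
    -- Strictness at `s` requires a bend whose pairing with `γ s` is strictly negative: one lying
    -- less than `π` before `s` will do.
    obtain ⟨x, hx, hx2⟩ := h.exists_bend hanti (s - Real.pi)
    rw [lorentz_comm]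
    refine (h.momentum_drop hL hper fun t => hbend t s).2 _ (?_ : lorentz (u (s - Real.pi + x) + _) _ < 0)
    rw [lorentz_comm]
    have := h.lorentz_bend_neg hx2 (S := Real.pi - x) ⟨by linarith [hx.2], by linarith [hx.1]⟩
    rwa [show s - Real.pi + x + (Real.pi - x) = s by ring] at this
  obtain ⟨c, hc, hp⟩ := hMt.exists_smul_mem
  set p := c • M with hpdef
  have hpt : FutureTimelike p := FutureTimelike.of_mem hp
  have hgp : ∀ s, lorentz (γ s) p < 0 := fun s => by
    rw [hpdef, lorentz_smul_right]; exact mul_neg_of_pos_of_neg hc (hg s)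
  have henergy : ∫ r in (0 : ℝ)..L, (lorentz (u r) p ^ 2 - lorentz (γ r) p ^ 2) < 0 := by
    obtain ⟨x, -, hx⟩ := h.exists_bend hanti 0
    exact h.energy_drop hL hper
      (fun t => mul_nonneg_of_nonpos_of_nonpos (hgp t).le
        (h.bend_lorentz_nonpos t hpt.futureCausal))
      (mul_pos_of_neg_of_neg (hgp _) (lorentz_neg_of_futureTimelike hx hpt.futureCausal))
  have hwirt : ∀ i : Fin 3,
      0 ≤ ∫ r in (0 : ℝ)..L, (lorentz (u r) (boost p (EuclideanSpace.single i 1)) ^ 2 -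
        lorentz (γ r) (boost p (EuclideanSpace.single i 1)) ^ 2) := by
    intro i
    set e := boost p (EuclideanSpace.single i 1)
    have hcont : Continuous fun r => lorentz (γ r) e := h.continuous.lorentz continuous_const
    obtain ⟨C, hC⟩ := h.exists_bound hL hper e
    -- The mean vanishes because `p` was chosen proportional to the total vector and `e` is
    -- orthogonal to `p`.
    have hmean : ∫ r in (0 : ℝ)..L, lorentz (γ r) e = 0 := by
      rw [← h.lorentz_total]
      have h1 : lorentz e p = 0 := lorentz_boost_left hp _
      rw [hpdef, lorentz_smul_right, lorentz_comm] at h1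
      exact (mul_eq_zero.1 h1).resolve_left hc.ne'
    have hw := integral_sq_le_integral_sq_deriv hL hL2 hcont (h.hasDerivWithinAt e)
      (h.measurable_lorentz e) hC (by have := hper 0; rw [zero_add] at this; rw [this]) hmean
    have hi := h.intervalIntegrable_energy hL hper e 0 L
    have hi2 : IntervalIntegrable (fun r => lorentz (γ r) e ^ 2) MeasureTheory.volume 0 L :=
      (hcont.pow 2).intervalIntegrable 0 L
    have hi3 := hi.add hi2
    have e3 : ((fun r => lorentz (u r) e ^ 2 - lorentz (γ r) e ^ 2) +
      fun r => lorentz (γ r) e ^ 2) = fun r => lorentz (u r) e ^ 2 := by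
        funext r; simp
    have hi4 : IntervalIntegrable (fun r => lorentz (u r) e ^ 2) MeasureTheory.volume 0 L := by
      rw [← e3]; exact hi3
    rw [intervalIntegral.integral_sub hi4 hi2]
    linarith
  have hsum : ∑ i : Fin 3, ∫ r in (0 : ℝ)..L,
      (lorentz (u r) (boost p (EuclideanSpace.single i 1)) ^ 2 -
        lorentz (γ r) (boost p (EuclideanSpace.single i 1)) ^ 2) =
      ∫ r in (0 : ℝ)..L, (lorentz (u r) p ^ 2 - lorentz (γ r) p ^ 2) := by
    rw [← intervalIntegral.integral_finsetSum
      fun i _ => h.intervalIntegrable_energy hL hper _ 0 L]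
    refine intervalIntegral.integral_congr fun r _ => ?_
    -- Position and direction are both unit vectors, so the constant terms of the two Parseval
    -- identities cancel.
    simp only [Finset.sum_sub_distrib, sum_sq_lorentz_boost hp, h.self, h.right_self]
    ring
  have := Finset.sum_nonneg fun i (_ : i ∈ Finset.univ) => hwirt i
  linarith

end IsBrokenGeodesic

section

/-! ### Spherical cones -/

/-- The distance in a spherical cone of points at distance `r` and `s` from the apex and at angular
distance `a`. -/
noncomputable def coneDist (r s a : ℝ) : ℝ :=
  Real.arccos (Real.cos r * Real.cos s + Real.sin r * Real.sin s * Real.cos (min a Real.pi))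

/-- Polar coordinates on the unit sphere. -/
noncomputable def sphPt (r a : ℝ) : E3 :=
  !₂[Real.sin r * Real.cos a, Real.sin r * Real.sin a, Real.cos r]

theorem inner_sphPt (r a s b : ℝ) : inner ℝ (sphPt r a) (sphPt s b) =
    Real.cos r * Real.cos s + Real.sin r * Real.sin s * Real.cos (a - b) := by
  rw [inner_E3, Real.cos_sub]
  simp [sphPt]
  ring

theorem norm_sphPt (r a : ℝ) : ‖sphPt r a‖ = 1 := by
  have h := real_inner_self_eq_norm_sq (sphPt r a)
  rw [inner_sphPt, sub_self, Real.cos_zero] at h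
  have h2 := Real.sin_sq_add_cos_sq r
  nlinarith [norm_nonneg (sphPt r a)]

theorem angle_sphPt (r a s b : ℝ) : InnerProductGeometry.angle (sphPt r a) (sphPt s b) =
    Real.arccos (Real.cos r * Real.cos s + Real.sin r * Real.sin s * Real.cos (a - b)) := by
  rw [InnerProductGeometry.angle, norm_sphPt, norm_sphPt, inner_sphPt]
  simp

theorem coneDist_eq_angle (r s a b : ℝ) (h : |a - b| ≤ Real.pi) :
    coneDist r s |a - b| = InnerProductGeometry.angle (sphPt r a) (sphPt s b) := by
  rw [angle_sphPt, coneDist, min_eq_left h, Real.cos_abs]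

theorem coneDist_min (r s a : ℝ) : coneDist r s (min a Real.pi) = coneDist r s a := by
  simp [coneDist]

theorem coneDist_mono {r s a b : ℝ} (hr : r ∈ Set.Icc 0 Real.pi) (hs : s ∈ Set.Icc 0 Real.pi)
    (ha : 0 ≤ a) (hab : a ≤ b) : coneDist r s a ≤ coneDist r s b := by
  refine Real.arccos_le_arccos ?_
  have h1 := Real.sin_nonneg_of_mem_Icc hr
  have h2 := Real.sin_nonneg_of_mem_Icc hs
  have h3 : Real.cos (min b Real.pi) ≤ Real.cos (min a Real.pi) :=
    Real.cos_le_cos_of_nonneg_of_le_pi (le_min ha Real.pi_pos.le) (min_le_right _ _)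
      (min_le_min_right _ hab)
  gcongr

theorem cos_coneDist (r s a : ℝ) : Real.cos (coneDist r s a) =
    Real.cos r * Real.cos s + Real.sin r * Real.sin s * Real.cos (min a Real.pi) := by
  have h := abs_real_inner_le_norm (sphPt r (min a Real.pi)) (sphPt s 0)
  rw [norm_sphPt, norm_sphPt, inner_sphPt, sub_zero, mul_one, abs_le] at h
  exact Real.cos_arccos h.1 h.2

theorem coneDist_comm (r s a : ℝ) : coneDist r s a = coneDist s r a := by
  simp only [coneDist]
  congr 1
  ring

/-- Shorten `a` and `b` so that their sum is at most `π`, without losing the truncated value of `c`.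
The three points then lie in one spherical sector, where the angle triangle inequality applies. -/
theorem coneDist_triangle {r s t a b c : ℝ} (hr : r ∈ Set.Icc 0 Real.pi)
    (hs : s ∈ Set.Icc 0 Real.pi) (ht : t ∈ Set.Icc 0 Real.pi) (ha : 0 ≤ a) (hb : 0 ≤ b)
    (hc : 0 ≤ c) (habc : c ≤ a + b) :
    coneDist r t c ≤ coneDist r s a + coneDist s t b := by
  set a' := min a Real.pi with ha'
  set b' := min b (Real.pi - a') with hb'
  have ha0 : 0 ≤ a' := le_min ha Real.pi_pos.le
  have ha1 : a' ≤ Real.pi := min_le_right _ _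
  have hb0 : 0 ≤ b' := le_min hb (by linarith)
  have hb1 : b' ≤ Real.pi - a' := min_le_right _ _
  have hc' : min c Real.pi ≤ a' + b' := by
    rcases min_choice a Real.pi with h | h <;> rcases min_choice b (Real.pi - a') with h' | h' <;>
      rw [← ha'] at h <;> rw [← hb'] at h'
    · rw [h, h']; exact (min_le_left _ _).trans habc
    · rw [h']; exact (min_le_right _ _).trans (by linarith)
    · rw [h, h']; exact (min_le_right _ _).trans (by linarith)
    · rw [h']; exact (min_le_right _ _).trans (by linarith)
  have e1 : coneDist r s a = InnerProductGeometry.angle (sphPt r 0) (sphPt s a') := by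
    rw [← coneDist_min, ← ha', ← coneDist_eq_angle _ _ _ _ (by simpa [abs_of_nonneg ha0] using ha1)]
    simp [abs_of_nonneg ha0]
  have e2 : coneDist s t b' = InnerProductGeometry.angle (sphPt s a') (sphPt t (a' + b')) := by
    rw [← coneDist_eq_angle _ _ _ _ (by simp [abs_of_nonneg hb0]; linarith)]
    simp [abs_of_nonneg hb0]
  have e3 : coneDist r t (a' + b') =
      InnerProductGeometry.angle (sphPt r 0) (sphPt t (a' + b')) := by
    have h0 : 0 ≤ a' + b' := by linarith
    have h1 : |0 - (a' + b')| = a' + b' := by rw [zero_sub, abs_neg, abs_of_nonneg h0]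
    rw [← coneDist_eq_angle _ _ _ _ (by rw [h1]; linarith), h1]
  calc coneDist r t c = coneDist r t (min c Real.pi) := (coneDist_min _ _ _).symm
    _ ≤ coneDist r t (a' + b') := coneDist_mono hr ht (le_min hc Real.pi_pos.le) hc'
    _ ≤ coneDist r s a + coneDist s t b' := by
      rw [e1, e2, e3]; exact InnerProductGeometry.angle_le_angle_add_angle _ _ _
    _ ≤ coneDist r s a + coneDist s t b := by
      have := coneDist_mono hs ht hb0 (min_le_left b (Real.pi - a'))
      linarith

theorem coneDist_of_pi_le {r s a : ℝ} (hr : 0 ≤ r) (hs : 0 ≤ s) (hrs : r + s ≤ Real.pi)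
    (ha : Real.pi ≤ a) : coneDist r s a = r + s := by
  rw [coneDist, min_eq_right ha, Real.cos_pi]
  rw [show Real.cos r * Real.cos s + Real.sin r * Real.sin s * -1 = Real.cos (r + s) by
    rw [Real.cos_add]; ring]
  exact Real.arccos_cos (by linarith) hrs

theorem coneDist_le_add {r s a : ℝ} (hr : 0 ≤ r) (hs : 0 ≤ s) (hrs : r + s ≤ Real.pi)
    (ha : 0 ≤ a) : coneDist r s a ≤ r + s := by
  rw [← coneDist_of_pi_le hr hs hrs (le_max_right a Real.pi)]
  exact coneDist_mono ⟨hr, by linarith⟩ ⟨hs, by linarith⟩ ha (le_max_left _ _)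

theorem coneDist_zero_left {s : ℝ} (a : ℝ) (hs : s ∈ Set.Icc 0 Real.pi) : coneDist 0 s a = s := by
  simp [coneDist, Real.arccos_cos hs.1 hs.2]

theorem coneDist_zero_right {s : ℝ} (a : ℝ) (hs : s ∈ Set.Icc 0 Real.pi) : coneDist s 0 a = s := by
  rw [coneDist_comm, coneDist_zero_left a hs]

/-- Equality in the law of cosines forces the angular cosine to be `1`. For geodesics this says that
points on the same side of a centre lie on one ray. -/
theorem eq_zero_of_coneDist {r s a : ℝ} (hr : r ∈ Set.Ioo 0 Real.pi) (hs : s ∈ Set.Ioo 0 Real.pi)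
    (ha : 0 ≤ a) (h : coneDist r s a = |r - s|) : a = 0 := by
  have h1 := cos_coneDist r s a
  rw [h, Real.cos_abs, Real.cos_sub] at h1
  have hpos := mul_pos (Real.sin_pos_of_mem_Ioo hr) (Real.sin_pos_of_mem_Ioo hs)
  have h2 : Real.cos (min a Real.pi) = Real.cos 0 := by
    rw [Real.cos_zero]
    have : Real.sin r * Real.sin s * (Real.cos (min a Real.pi) - 1) = 0 := by linarith
    linarith [(mul_eq_zero.1 this).resolve_left hpos.ne']
  have h3 := Real.injOn_cos ⟨le_min ha Real.pi_pos.le, min_le_right _ _⟩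
    ⟨le_rfl, Real.pi_pos.le⟩ h2
  rcases min_choice a Real.pi with h4 | h4
  · rw [← h4, h3]
  · rw [h4] at h3; exact absurd h3 Real.pi_pos.ne'

/-- Equality in the law of cosines forces the truncated angular cosine to be `-1`. For geodesics
this separates the two directions at a point by at least `π`. -/
theorem pi_le_of_coneDist {r s a : ℝ} (hr : r ∈ Set.Ioo 0 Real.pi) (hs : s ∈ Set.Ioo 0 Real.pi)
    (ha : 0 ≤ a) (h : coneDist r s a = r + s) : Real.pi ≤ a := by
  have h1 := cos_coneDist r s a
  rw [h, Real.cos_add] at h1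
  have hpos := mul_pos (Real.sin_pos_of_mem_Ioo hr) (Real.sin_pos_of_mem_Ioo hs)
  have h2 : Real.cos (min a Real.pi) = Real.cos Real.pi := by
    rw [Real.cos_pi]
    have : Real.sin r * Real.sin s * (Real.cos (min a Real.pi) + 1) = 0 := by linarith
    linarith [(mul_eq_zero.1 this).resolve_left hpos.ne']
  have h3 := Real.injOn_cos ⟨le_min ha Real.pi_pos.le, min_le_right _ _⟩
    ⟨Real.pi_pos.le, le_rfl⟩ h2
  exact min_eq_right_iff.1 h3

open scoped NNReal in
/-- Geodesics of a spherical sector cross the intermediate rays. -/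
theorem exists_coneDist_add {ε r s a b : ℝ} (hε : ε ≤ Real.pi / 2) (hr : r ∈ Set.Ico 0 ε)
    (hs : s ∈ Set.Ico 0 ε) (ha : 0 ≤ a) (hb : 0 ≤ b) (hab : a + b < Real.pi) :
    ∃ t ∈ Set.Ico 0 ε, coneDist r t a + coneDist t s b = coneDist r s (a + b) := by
  have hpi := Real.pi_pos
  have hrI : r ∈ Set.Icc 0 Real.pi := ⟨hr.1, by linarith [hr.2]⟩
  have hsI : s ∈ Set.Icc 0 Real.pi := ⟨hs.1, by linarith [hs.2]⟩
  have h0I : (0 : ℝ) ∈ Set.Icc 0 Real.pi := ⟨le_rfl, hpi.le⟩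
  have hε0 : 0 < ε := hr.1.trans_lt hr.2
  rcases hr.1.eq_or_lt with hr0 | hr0
  · exact ⟨0, ⟨le_rfl, hε0⟩, by
      rw [← hr0, coneDist_zero_left _ h0I, coneDist_zero_left _ hsI, coneDist_zero_left _ hsI,
        zero_add]⟩
  rcases hs.1.eq_or_lt with hs0 | hs0
  · exact ⟨0, ⟨le_rfl, hε0⟩, by
      rw [← hs0, coneDist_zero_left _ h0I, coneDist_zero_right _ hrI, coneDist_zero_right _ hrI,
        add_zero]⟩
  rcases ha.eq_or_lt with ha0 | ha0
  · refine ⟨r, hr, ?_⟩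
    have : coneDist r r 0 = 0 := by
      rw [coneDist, min_eq_left hpi.le, Real.cos_zero, mul_one, ← sq, ← sq, Real.cos_sq_add_sin_sq,
        Real.arccos_one]
    rw [← ha0, this, zero_add, zero_add]
  have hsr := Real.sin_pos_of_pos_of_lt_pi hr0 (by linarith [hr.2])
  have hss := Real.sin_pos_of_pos_of_lt_pi hs0 (by linarith [hs.2])
  have hsa := Real.sin_pos_of_pos_of_lt_pi ha0 (by linarith)
  have hsb := Real.sin_nonneg_of_nonneg_of_le_pi hb (by linarith)
  have hsab := Real.sin_pos_of_pos_of_lt_pi (show 0 < a + b by linarith) hab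
  -- The weights `l` and `m` are chosen so that the positive combination of the two end vectors has
  -- direction angle `a`; `k` and `g` are its horizontal and vertical parts, and `R` is its length.
  set l := Real.sin s * Real.sin b with hl
  set m := Real.sin r * Real.sin a with hm
  set k := Real.sin r * Real.sin s * Real.sin (a + b) with hk
  set g := l * Real.cos r + m * Real.cos s with hg
  have hl0 : 0 ≤ l := by positivity
  have hm0 : 0 < m := by positivity
  have hk0 : 0 < k := by positivity
  have hcr : Real.cos ε < Real.cos r := Real.cos_lt_cos_of_nonneg_of_le_pi_div_two hr.1 hε hr.2
  have hcs : Real.cos ε < Real.cos s := Real.cos_lt_cos_of_nonneg_of_le_pi_div_two hs.1 hε hs.2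
  have hcε : 0 ≤ Real.cos ε := Real.cos_nonneg_of_neg_pi_div_two_le_of_le (by linarith) hε
  have hg1 : (l + m) * Real.cos ε < g := by nlinarith
  set R := Real.sqrt (k ^ 2 + g ^ 2) with hR
  have hR2 : R ^ 2 = k ^ 2 + g ^ 2 := Real.sq_sqrt (by positivity)
  have hR0 : 0 < R := Real.sqrt_pos.2 (by positivity)
  have hgR : |g / R| ≤ 1 := by
    rw [abs_div, abs_of_pos hR0, div_le_one hR0]
    exact abs_le_of_sq_le_sq (by nlinarith [sq_nonneg k]) hR0.le
  set t := Real.arccos (g / R) with ht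
  have hct : Real.cos t = g / R := Real.cos_arccos (abs_le.1 hgR).1 (abs_le.1 hgR).2
  have hst : Real.sin t = k / R := by
    rw [ht, Real.sin_arccos, ← Real.sqrt_sq (show 0 ≤ k / R by positivity)]
    congr 1
    field_simp
    linarith
  have hy1 : Real.sin b + Real.sin a * Real.cos (a + b) = Real.sin (a + b) * Real.cos a := by
    have := Real.sin_sub (a + b) a
    rw [add_sub_cancel_left] at this
    linarith
  have hvec : R • sphPt t a = l • sphPt r 0 + m • sphPt s (a + b) := by
    ext i
    fin_cases i
    · simp only [sphPt, PiLp.smul_apply, PiLp.add_apply, smul_eq_mul, hct, hst, Real.cos_zero]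
      simp
      field_simp
      simp only [hk, hl, hm]
      linear_combination (-Real.sin r * Real.sin s) * hy1
    · simp only [sphPt, PiLp.smul_apply, PiLp.add_apply, smul_eq_mul, hct, hst, Real.sin_zero]
      simp
      field_simp
      simp only [hk, hm]
      ring
    · simp only [sphPt, PiLp.smul_apply, PiLp.add_apply, smul_eq_mul, hct]
      simp [Matrix.cons_val]
      field_simp
      simp only [hg]
  have hRle : R ≤ l + m := by
    have h1 := congrArg norm hvec
    rw [norm_smul, norm_sphPt, mul_one, Real.norm_eq_abs, abs_of_pos hR0] at h1
    rw [h1]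
    refine (norm_add_le _ _).trans ?_
    rw [norm_smul, norm_smul, norm_sphPt, norm_sphPt, Real.norm_eq_abs, Real.norm_eq_abs,
      abs_of_nonneg hl0, abs_of_pos hm0, mul_one, mul_one]
  -- The ball of radius at most `π/2` is convex: the vertical part exceeds `(l + m) cos ε`, while
  -- the length is at most `l + m`.
  have htε : t < ε := by
    by_contra! hcon
    have := Real.cos_le_cos_of_nonneg_of_le_pi hε0.le (Real.arccos_le_pi _) hcon
    rw [hct, div_le_iff₀ hR0] at this
    nlinarith
  refine ⟨t, ⟨Real.arccos_nonneg _, htε⟩, ?_⟩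
  have e1 : coneDist r t a = InnerProductGeometry.angle (sphPt r 0) (sphPt t a) := by
    have h1 : |0 - a| = a := by rw [zero_sub, abs_neg, abs_of_nonneg ha]
    rw [← coneDist_eq_angle _ _ _ _ (by rw [h1]; linarith), h1]
  have e2 : coneDist t s b = InnerProductGeometry.angle (sphPt t a) (sphPt s (a + b)) := by
    have h1 : |a - (a + b)| = b := by rw [sub_add_cancel_left, abs_neg, abs_of_nonneg hb]
    rw [← coneDist_eq_angle _ _ _ _ (by rw [h1]; linarith), h1]
  have e3 : coneDist r s (a + b) = InnerProductGeometry.angle (sphPt r 0) (sphPt s (a + b)) := by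
    have h1 : |0 - (a + b)| = a + b := by
      rw [zero_sub, abs_neg, abs_of_nonneg (by linarith)]
    rw [← coneDist_eq_angle _ _ _ _ (by rw [h1]; linarith), h1]
  rw [e1, e2, e3]
  have hne : sphPt t a ≠ 0 := by
    intro h; have := norm_sphPt t a; rw [h, norm_zero] at this; exact zero_ne_one this
  refine (InnerProductGeometry.angle_eq_angle_add_add_angle_add_of_mem_span hne ?_).symm
  rw [Submodule.mem_span_pair]
  -- The intermediate vector lies in the convex cone spanned by the ends, which is the equality case
  -- of the triangle inequality for angles.
  refine ⟨Real.toNNReal (l / R), Real.toNNReal (m / R), ?_⟩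
  rw [NNReal.smul_def, NNReal.smul_def, Real.coe_toNNReal _ (by positivity),
    Real.coe_toNNReal _ (by positivity)]
  rw [← smul_right_injective _ hR0.ne' |>.eq_iff]
  simp only [smul_add, smul_smul]
  rw [mul_div_cancel₀ _ hR0.ne', mul_div_cancel₀ _ hR0.ne', hvec]

end

/-! ### Support functions of finite sets in the open unit disc -/

/-- The value at the direction of angle `φ` of the linear form given by `w`. -/
noncomputable def height (w : ℝ × ℝ) (φ : ℝ) : ℝ := w.1 * Real.cos φ + w.2 * Real.sin φ

/-- The derivative of `height w`. -/
noncomputable def tilt (w : ℝ × ℝ) (φ : ℝ) : ℝ := -w.1 * Real.sin φ + w.2 * Real.cos φ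

/-- The discriminant of a point of the unit disc. -/
noncomputable def disc (w : ℝ × ℝ) : ℝ := 1 - w.1 ^ 2 - w.2 ^ 2

/-- The angular speed of the arc polar to `w`. -/
noncomputable def angSpeed (w : ℝ × ℝ) (φ : ℝ) : ℝ := Real.sqrt (disc w) / (1 - height w φ ^ 2)

theorem one_sub_height_sq (w : ℝ × ℝ) (φ : ℝ) :
    1 - height w φ ^ 2 = disc w + tilt w φ ^ 2 := by
  simp only [height, tilt, disc]
  linear_combination (-w.1 ^ 2 - w.2 ^ 2) * Real.sin_sq_add_cos_sq φ

theorem one_sub_height_sq_pos {w : ℝ × ℝ} (hw : 0 < disc w) (φ : ℝ) : 0 < 1 - height w φ ^ 2 := by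
  rw [one_sub_height_sq]; positivity

theorem hasDerivAt_height (w : ℝ × ℝ) (φ : ℝ) : HasDerivAt (height w) (tilt w φ) φ := by
  refine (((Real.hasDerivAt_cos φ).const_mul w.1).add
    ((Real.hasDerivAt_sin φ).const_mul w.2)).congr_deriv ?_
  simp [tilt]

@[fun_prop]
theorem continuous_height (w : ℝ × ℝ) : Continuous (height w) := by
  unfold height; fun_prop

theorem height_add (w : ℝ × ℝ) (φ x : ℝ) :
    height w (φ + x) = height w φ * Real.cos x + tilt w φ * Real.sin x := by
  simp only [height, tilt, Real.cos_add, Real.sin_add]; ring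

theorem height_add_pi (w : ℝ × ℝ) (φ : ℝ) : height w (φ + Real.pi) = -height w φ := by
  simp [height_add]

theorem height_add_two_pi (w : ℝ × ℝ) (φ : ℝ) : height w (φ + 2 * Real.pi) = height w φ := by
  simp [height]

theorem continuous_angSpeed {w : ℝ × ℝ} (hw : 0 < disc w) : Continuous (angSpeed w) :=
  continuous_const.div (by fun_prop) fun φ => (one_sub_height_sq_pos hw φ).ne'

/-- The coordinate `z` of the unit vector of angle `φ` on the arc polar to `w`. -/
noncomputable def arcPos (w : ℝ × ℝ) (z : Fin 3 → ℝ) (φ : ℝ) : ℝ :=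
  (height w φ * z 0 + Real.cos φ * z 1 + Real.sin φ * z 2) * (Real.sqrt (1 - height w φ ^ 2))⁻¹

/-- The coordinate `z` of the unit tangent vector of the arc polar to `w`. -/
noncomputable def arcDir (w : ℝ × ℝ) (z : Fin 3 → ℝ) (φ : ℝ) : ℝ :=
  (tilt w φ * z 0 + (-Real.sin φ + w.2 * height w φ) * z 1 +
    (Real.cos φ - w.1 * height w φ) * z 2) *
    ((Real.sqrt (disc w))⁻¹ * (Real.sqrt (1 - height w φ ^ 2))⁻¹)

theorem hasDerivAt_inv_sqrt {w : ℝ × ℝ} (hw : 0 < disc w) (φ : ℝ) :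
    HasDerivAt (fun x => (Real.sqrt (1 - height w x ^ 2))⁻¹)
      (height w φ * tilt w φ * (Real.sqrt (1 - height w φ ^ 2))⁻¹ ^ 3) φ := by
  have hN := one_sub_height_sq_pos hw φ
  have hs : Real.sqrt (1 - height w φ ^ 2) ≠ 0 := (Real.sqrt_pos.2 hN).ne'
  refine (((((hasDerivAt_height w φ).pow 2).const_sub 1).sqrt hN.ne').inv hs).congr_deriv ?_
  simp only [Nat.cast_ofNat, Nat.add_one_sub_one, pow_one, Pi.pow_apply]
  field_simp

theorem hasDerivAt_tilt (w : ℝ × ℝ) (φ : ℝ) :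
    HasDerivAt (tilt w) (-height w φ) φ := by
  refine (((Real.hasDerivAt_sin φ).const_mul (-w.1)).add
    ((Real.hasDerivAt_cos φ).const_mul w.2)).congr_deriv ?_
  simp [height]; ring

/-- The triple `z` will hold the products of a test vector with the frame `o, e₁, e₂`, so that
scalar differential equations prove vector identities. Together with the next lemma this says that
position and direction rotate into each other. -/
theorem hasDerivAt_arcPos {w : ℝ × ℝ} (hw : 0 < disc w) (z : Fin 3 → ℝ) (φ : ℝ) :
    HasDerivAt (arcPos w z) (angSpeed w φ * arcDir w z φ) φ := by
  have hN := one_sub_height_sq_pos hw φ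
  have hsN := Real.sqrt_pos.2 hN
  have hsD := Real.sqrt_pos.2 hw
  have h1 := (((hasDerivAt_height w φ).mul_const (z 0)).add
    ((Real.hasDerivAt_cos φ).mul_const (z 1))).add ((Real.hasDerivAt_sin φ).mul_const (z 2))
  refine (h1.mul (hasDerivAt_inv_sqrt hw φ)).congr_deriv ?_
  dsimp only [angSpeed, arcDir, Pi.add_apply]
  have e : ∀ k : ℝ, k / (1 - height w φ ^ 2) = k * (Real.sqrt (1 - height w φ ^ 2))⁻¹ ^ 2 := by
    intro k
    rw [inv_pow, Real.sq_sqrt hN.le, div_eq_mul_inv]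
  have e2 : (1 - height w φ ^ 2) * (Real.sqrt (1 - height w φ ^ 2))⁻¹ ^ 2 = 1 := by
    rw [inv_pow, Real.sq_sqrt hN.le, mul_inv_cancel₀ hN.ne']
  have e3 : Real.sqrt (disc w) * (Real.sqrt (disc w))⁻¹ = 1 := mul_inv_cancel₀ hsD.ne'
  rw [e]
  generalize (Real.sqrt (1 - height w φ ^ 2))⁻¹ = r at *
  generalize (Real.sqrt (disc w))⁻¹ = d' at *
  generalize Real.sqrt (disc w) = d at *
  have hid : (1 - height w φ ^ 2) * (tilt w φ * z 0 + -Real.sin φ * z 1 + Real.cos φ * z 2) +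
      height w φ * tilt w φ * (height w φ * z 0 + Real.cos φ * z 1 + Real.sin φ * z 2) =
      tilt w φ * z 0 + (-Real.sin φ + w.2 * height w φ) * z 1 +
      (Real.cos φ - w.1 * height w φ) * z 2 := by
    have hb : w.2 = height w φ * Real.sin φ + tilt w φ * Real.cos φ := by
      simp only [height, tilt]
      linear_combination (-w.2) * Real.sin_sq_add_cos_sq φ
    have ha : w.1 = height w φ * Real.cos φ - tilt w φ * Real.sin φ := by
      simp only [height, tilt]
      linear_combination (-w.1) * Real.sin_sq_add_cos_sq φ
    linear_combination (-height w φ * z 1) * hb + (height w φ * z 2) * ha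
  linear_combination (r ^ 3) * hid - (tilt w φ * z 0 + -Real.sin φ * z 1 + Real.cos φ * z 2)
    * r * e2 - (tilt w φ * z 0 + (-Real.sin φ + w.2 * height w φ) * z 1 +
      (Real.cos φ - w.1 * height w φ) * z 2) * r ^ 3 * e3

theorem hasDerivAt_arcDir {w : ℝ × ℝ} (hw : 0 < disc w) (z : Fin 3 → ℝ) (φ : ℝ) :
    HasDerivAt (arcDir w z) (-(angSpeed w φ * arcPos w z φ)) φ := by
  have hN := one_sub_height_sq_pos hw φ
  have hsN := Real.sqrt_pos.2 hN
  have hsD := Real.sqrt_pos.2 hw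
  have h1 := (((hasDerivAt_tilt w φ).mul_const (z 0)).add
    (((Real.hasDerivAt_sin φ).neg.add ((hasDerivAt_height w φ).const_mul w.2)).mul_const (z 1))).add
    (((Real.hasDerivAt_cos φ).sub ((hasDerivAt_height w φ).const_mul w.1)).mul_const (z 2))
  refine (h1.mul ((hasDerivAt_inv_sqrt hw φ).const_mul (Real.sqrt (disc w))⁻¹)).congr_deriv ?_
  dsimp only [angSpeed, arcPos, Pi.add_apply, Pi.sub_apply, Pi.neg_apply]
  have e : ∀ k : ℝ, k / (1 - height w φ ^ 2) = k * (Real.sqrt (1 - height w φ ^ 2))⁻¹ ^ 2 := by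
    intro k
    rw [inv_pow, Real.sq_sqrt hN.le, div_eq_mul_inv]
  have e2 : (1 - height w φ ^ 2) * (Real.sqrt (1 - height w φ ^ 2))⁻¹ ^ 2 = 1 := by
    rw [inv_pow, Real.sq_sqrt hN.le, mul_inv_cancel₀ hN.ne']
  have e3 : disc w * (Real.sqrt (disc w))⁻¹ = Real.sqrt (disc w) := by
    rw [← div_eq_mul_inv, Real.div_sqrt]
  rw [e]
  have hD : disc w = 1 - height w φ ^ 2 - tilt w φ ^ 2 := by
    rw [one_sub_height_sq]; ring
  generalize (Real.sqrt (1 - height w φ ^ 2))⁻¹ = r at *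
  generalize (Real.sqrt (disc w))⁻¹ = d' at *
  generalize Real.sqrt (disc w) = d at *
  generalize disc w = D at *
  have hb : w.2 = height w φ * Real.sin φ + tilt w φ * Real.cos φ := by
    simp only [height, tilt]
    linear_combination (-w.2) * Real.sin_sq_add_cos_sq φ
  have ha : w.1 = height w φ * Real.cos φ - tilt w φ * Real.sin φ := by
    simp only [height, tilt]
    linear_combination (-w.1) * Real.sin_sq_add_cos_sq φ
  rw [ha, hb]
  generalize height w φ = p at *
  generalize tilt w φ = p' at *
  generalize Real.sin φ = s at *
  generalize Real.cos φ = c at *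
  subst hD
  linear_combination (-(p * z 0 + c * z 1 + s * z 2) * r ^ 3) * e3 -
    (-p * z 0 + (-c + (p * s + p' * c) * p') * z 1 + (-s - (p * c - p' * s) * p') * z 2) *
      d' * r * e2

theorem angSpeed_pos {w : ℝ × ℝ} (hw : 0 < disc w) (φ : ℝ) : 0 < angSpeed w φ :=
  div_pos (Real.sqrt_pos.2 hw) (one_sub_height_sq_pos hw φ)

/-- Along the arc polar to `w`, position and direction rotate with angular speed `angSpeed w`. -/
theorem arcPos_eq {w : ℝ × ℝ} (hw : 0 < disc w) (z : Fin 3 → ℝ) (φ ψ : ℝ) :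
    arcPos w z ψ = Real.cos (∫ x in φ..ψ, angSpeed w x) * arcPos w z φ +
      Real.sin (∫ x in φ..ψ, angSpeed w x) * arcDir w z φ := by
  set A : ℝ → ℝ := fun y => ∫ x in φ..y, angSpeed w x with hA
  have hAd : ∀ y, HasDerivAt A (angSpeed w y) y := fun y =>
    ((continuous_angSpeed hw).integral_hasStrictDerivAt φ y).hasDerivAt
  have hA0 : A φ = 0 := by simp [hA]
  -- Rotating position and direction back through the angle `A y` yields two constants of motion,
  -- evaluated at `φ` and `ψ`.
  have h1 : ∀ y, HasDerivAt (fun y => Real.cos (A y) * arcPos w z y - Real.sin (A y) * arcDir w z y)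
      0 y := fun y => by
    refine ((((hAd y).cos).mul (hasDerivAt_arcPos hw z y)).sub
      (((hAd y).sin).mul (hasDerivAt_arcDir hw z y))).congr_deriv ?_
    ring
  have h2 : ∀ y, HasDerivAt (fun y => Real.sin (A y) * arcPos w z y + Real.cos (A y) * arcDir w z y)
      0 y := fun y => by
    refine ((((hAd y).sin).mul (hasDerivAt_arcPos hw z y)).add
      (((hAd y).cos).mul (hasDerivAt_arcDir hw z y))).congr_deriv ?_
    ring
  have c1 := is_const_of_deriv_eq_zero (fun y => (h1 y).differentiableAt)
    (fun y => (h1 y).deriv) ψ φ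
  have c2 := is_const_of_deriv_eq_zero (fun y => (h2 y).differentiableAt)
    (fun y => (h2 y).deriv) ψ φ
  simp only [hA0, Real.cos_zero, Real.sin_zero, one_mul, zero_mul, sub_zero, zero_add] at c1 c2
  rw [show (∫ x in φ..ψ, angSpeed w x) = A ψ from rfl]
  rw [← c1, ← c2]
  linear_combination (-arcPos w z ψ) * Real.sin_sq_add_cos_sq (A ψ)

/-- A sinusoid dominated by another one at both ends of an interval shorter than `π` is dominated
on the interval. -/
theorem height_le_between {w w' : ℝ × ℝ} {φ ψ x : ℝ} (h1 : φ ≤ x) (h2 : x ≤ ψ)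
    (h3 : ψ < φ + Real.pi) (hφ : height w φ ≤ height w' φ) (hψ : height w ψ ≤ height w' ψ) :
    height w x ≤ height w' x := by
  rcases (h1.trans h2).eq_or_lt with h | h
  · have : x = φ := le_antisymm (h ▸ h2) h1
    rwa [this]
  -- Interpolation of a sinusoid from its end values; on an interval shorter than `π` the weights
  -- are nonnegative.
  have key : ∀ w : ℝ × ℝ, Real.sin (ψ - φ) * height w x =
      Real.sin (ψ - x) * height w φ + Real.sin (x - φ) * height w ψ := by
    intro w
    simp only [height, Real.sin_sub]
    ring
  have hs := Real.sin_pos_of_pos_of_lt_pi (x := ψ - φ) (by linarith) (by linarith)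
  have hs1 := Real.sin_nonneg_of_nonneg_of_le_pi (x := ψ - x) (by linarith) (by linarith)
  have hs2 := Real.sin_nonneg_of_nonneg_of_le_pi (x := x - φ) (by linarith) (by linarith)
  refine le_of_mul_le_mul_left ?_ hs
  rw [key, key]
  gcongr

/-- Two different linear forms agree on a line only, so the common directions are congruent modulo
`π`. These ties are negligible for arc length. -/
theorem countable_height_eq {w w' : ℝ × ℝ} (hne : w ≠ w') :
    {φ | height w φ = height w' φ}.Countable := by
  rcases Set.eq_empty_or_nonempty {φ | height w φ = height w' φ} with h | ⟨φ₀, h0⟩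
  · rw [h]; exact Set.countable_empty
  refine (Set.countable_range fun k : ℤ => φ₀ + k * Real.pi).mono fun φ hφ => ?_
  simp only [Set.mem_ofPred_eq, height] at h0 hφ
  have hs : Real.sin (φ - φ₀) = 0 := by
    by_contra hs
    apply hne
    rw [Real.sin_sub] at hs
    refine Prod.ext ?_ ?_
    · have : (w.1 - w'.1) * (Real.sin φ * Real.cos φ₀ - Real.cos φ * Real.sin φ₀) = 0 := by
        linear_combination Real.sin φ * h0 - Real.sin φ₀ * hφ
      linarith [(mul_eq_zero.1 this).resolve_right hs]
    · have : (w.2 - w'.2) * (Real.sin φ * Real.cos φ₀ - Real.cos φ * Real.sin φ₀) = 0 := by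
        linear_combination Real.cos φ₀ * hφ - Real.cos φ * h0
      linarith [(mul_eq_zero.1 this).resolve_right hs]
  obtain ⟨k, hk⟩ := Real.sin_eq_zero_iff.1 hs
  exact ⟨k, by simp only; linarith⟩

/-! ### Arc length of the curve polar to a finite planar set -/

section

open MeasureTheory

/-- The support function of a finite planar set. -/
noncomputable def support (W : Finset (ℝ × ℝ)) (hW : W.Nonempty) (φ : ℝ) : ℝ :=
  W.sup' hW fun w => height w φ

/-- The set of directions in which `w` supports `W`. -/
def cell (W : Finset (ℝ × ℝ)) (w : ℝ × ℝ) : Set ℝ := {φ | ∀ w' ∈ W, height w' φ ≤ height w φ}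

/-- The speed of the curve polar to `W`. -/
noncomputable def linkSpeed (W : Finset (ℝ × ℝ)) (φ : ℝ) : ℝ :=
  ∑ w ∈ W, (cell W w).indicator (angSpeed w) φ

/-- The arc length of the curve polar to `W`. -/
noncomputable def linkLength (W : Finset (ℝ × ℝ)) (φ : ℝ) : ℝ :=
  ∫ x in (0 : ℝ)..φ, linkSpeed W x

section PolarCurve

variable {W : Finset (ℝ × ℝ)} {w : ℝ × ℝ}

theorem height_le_support (hW : W.Nonempty) (hw : w ∈ W) (φ : ℝ) :
    height w φ ≤ support W hW φ :=
  Finset.le_sup' (fun w => height w φ) hw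

theorem support_eq_of_mem_cell (hW : W.Nonempty) (hw : w ∈ W) {φ : ℝ} (h : φ ∈ cell W w) :
    support W hW φ = height w φ :=
  le_antisymm (Finset.sup'_le _ _ h) (height_le_support hW hw φ)

theorem mem_cell_of_support_eq (hW : W.Nonempty) {φ : ℝ} (h : support W hW φ = height w φ) :
    φ ∈ cell W w := fun _ hw' => h ▸ height_le_support hW hw' φ

theorem exists_mem_cell (hW : W.Nonempty) (φ : ℝ) : ∃ w ∈ W, φ ∈ cell W w := by
  obtain ⟨w, hw, h⟩ := Finset.exists_max_image W (fun w => height w φ) hW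
  exact ⟨w, hw, h⟩

theorem isClosed_cell (W : Finset (ℝ × ℝ)) (w : ℝ × ℝ) : IsClosed (cell W w) := by
  have : cell W w = ⋂ w' ∈ W, {φ | height w' φ ≤ height w φ} := by
    ext φ; simp [cell]
  rw [this]
  exact isClosed_biInter fun w' _ => isClosed_le (continuous_height w') (continuous_height w)

theorem Icc_subset_cell {φ ψ : ℝ} (h : ψ < φ + Real.pi) (hφ : φ ∈ cell W w)
    (hψ : ψ ∈ cell W w) : Set.Icc φ ψ ⊆ cell W w :=
  fun _ hx w' hw' => height_le_between hx.1 hx.2 h (hφ w' hw') (hψ w' hw')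

theorem exists_frequently_cell (hW : W.Nonempty) {l : Filter ℝ} [l.NeBot] :
    ∃ w ∈ W, ∃ᶠ x in l, x ∈ cell W w := by
  by_contra! hcon
  have : ∀ᶠ x in l, ∀ w ∈ W, x ∉ cell W w :=
    (Filter.eventually_all_finset W).2 fun w hw => hcon w hw
  obtain ⟨x, hx⟩ := this.exists
  obtain ⟨w, hw, h⟩ := exists_mem_cell hW x
  exact hx w hw h

/-- Among finitely many cells one is met arbitrarily close to `φ` on the right. Being closed it
contains `φ`, and being convex on scales below `π` it contains an interval. -/
theorem exists_cell_right (hW : W.Nonempty) (φ : ℝ) :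
    ∃ w ∈ W, ∃ δ > 0, Set.Icc φ (φ + δ) ⊆ cell W w := by
  obtain ⟨w, hw, hf⟩ := exists_frequently_cell hW (l := nhdsWithin φ (Set.Ioi φ))
  have h0 : φ ∈ cell W w := (isClosed_cell W w).mem_of_frequently_of_tendsto
    (b := nhdsWithin φ (Set.Ioi φ)) hf (tendsto_nhdsWithin_of_tendsto_nhds Filter.tendsto_id)
  obtain ⟨x, hx, hx2⟩ := (hf.and_eventually
    (Ioo_mem_nhdsGT (show φ < φ + Real.pi by linarith [Real.pi_pos]))).exists
  refine ⟨w, hw, x - φ, by linarith [hx2.1], ?_⟩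
  rw [add_sub_cancel]
  exact Icc_subset_cell hx2.2 h0 hx

theorem exists_cell_left (hW : W.Nonempty) (φ : ℝ) :
    ∃ w ∈ W, ∃ δ > 0, Set.Icc (φ - δ) φ ⊆ cell W w := by
  obtain ⟨w, hw, hf⟩ := exists_frequently_cell hW (l := nhdsWithin φ (Set.Iio φ))
  have h0 : φ ∈ cell W w := (isClosed_cell W w).mem_of_frequently_of_tendsto
    (b := nhdsWithin φ (Set.Iio φ)) hf (tendsto_nhdsWithin_of_tendsto_nhds Filter.tendsto_id)
  obtain ⟨x, hx, hx2⟩ := (hf.and_eventually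
    (Ioo_mem_nhdsLT (show φ - Real.pi < φ by linarith [Real.pi_pos]))).exists
  refine ⟨w, hw, φ - x, by linarith [hx2.2], ?_⟩
  rw [sub_sub_cancel]
  exact Icc_subset_cell (by linarith [hx2.1]) hx h0

theorem cell_add_two_pi (φ : ℝ) : φ + 2 * Real.pi ∈ cell W w ↔ φ ∈ cell W w := by
  simp [cell, height_add_two_pi]

theorem support_add_two_pi (hW : W.Nonempty) (φ : ℝ) :
    support W hW (φ + 2 * Real.pi) = support W hW φ := by
  simp [support, height_add_two_pi]

theorem angSpeed_add_two_pi (φ : ℝ) : angSpeed w (φ + 2 * Real.pi) = angSpeed w φ := by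
  simp [angSpeed, height_add_two_pi]

theorem linkSpeed_periodic : Function.Periodic (linkSpeed W) (2 * Real.pi) := by
  intro φ
  refine Finset.sum_congr rfl fun w _ => ?_
  by_cases h : φ ∈ cell W w
  · rw [Set.indicator_of_mem h, Set.indicator_of_mem (cell_add_two_pi φ |>.2 h),
      angSpeed_add_two_pi]
  · rw [Set.indicator_of_notMem h, Set.indicator_of_notMem (mt (cell_add_two_pi φ).1 h)]

theorem intervalIntegrable_linkSpeed (hD : ∀ w ∈ W, 0 < disc w) (a b : ℝ) :
    IntervalIntegrable (linkSpeed W) volume a b := by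
  have : linkSpeed W = ∑ w ∈ W, (cell W w).indicator (angSpeed w) := by
    funext φ; simp [linkSpeed]
  rw [this]
  refine IntervalIntegrable.sum _ fun w hw => ?_
  refine ((continuous_angSpeed (hD w hw)).intervalIntegrable a b).mono_fun ?_ ?_
  · exact ((continuous_angSpeed (hD w hw)).measurable.indicator
      (isClosed_cell W w).measurableSet).aestronglyMeasurable
  · exact Filter.Eventually.of_forall fun x => norm_indicator_le_norm_self _ _

theorem linkLength_sub (hD : ∀ w ∈ W, 0 < disc w) (φ ψ : ℝ) :
    linkLength W ψ - linkLength W φ = ∫ x in φ..ψ, linkSpeed W x :=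
  intervalIntegral.integral_interval_sub_left (intervalIntegrable_linkSpeed hD _ _)
    (intervalIntegrable_linkSpeed hD _ _)

/-- On an interval of directions supported by `w`, arc length is the integral of `angSpeed w`. -/
theorem linkLength_sub_of_cell (hD : ∀ w ∈ W, 0 < disc w) (hw : w ∈ W) {φ ψ : ℝ}
    (h : Set.uIcc φ ψ ⊆ cell W w) :
    linkLength W ψ - linkLength W φ = ∫ x in φ..ψ, angSpeed w x := by
  rw [linkLength_sub hD]
  refine intervalIntegral.integral_congr_ae ?_
  -- `linkSpeed` counts a direction once for every supporting element; multiple counting occurs only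
  -- at ties, a countable set.
  have hc : (⋃ w' ∈ W.erase w, {φ | height w' φ = height w φ}).Countable :=
    (W.erase w).countable_toSet.biUnion fun w' hw' =>
      countable_height_eq (Finset.ne_of_mem_erase hw')
  filter_upwards [hc.ae_notMem volume] with x hx hxI
  have hxc : x ∈ cell W w := h (Set.uIoc_subset_uIcc hxI)
  rw [linkSpeed, Finset.sum_eq_single w]
  · exact Set.indicator_of_mem hxc _
  · intro w' hw' hne
    refine Set.indicator_of_notMem (fun hx' => hx ?_) _
    simp only [Set.mem_iUnion]
    exact ⟨w', Finset.mem_erase.2 ⟨hne, hw'⟩, le_antisymm (hxc w' hw') (hx' w hw)⟩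
  · exact fun h => absurd hw h

/-- A supporting arc has speed at least `√disc`, because its denominator is at most `1`. The uniform
bound makes arc length a bijection of the line. -/
theorem exists_le_linkSpeed (hW : W.Nonempty) (hD : ∀ w ∈ W, 0 < disc w) :
    ∃ κ > 0, ∀ φ, κ ≤ linkSpeed W φ := by
  obtain ⟨w₀, hw₀, h⟩ := Finset.exists_min_image W (fun w => Real.sqrt (disc w)) hW
  refine ⟨Real.sqrt (disc w₀), Real.sqrt_pos.2 (hD w₀ hw₀), fun φ => ?_⟩
  obtain ⟨w, hw, hφ⟩ := exists_mem_cell hW φ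
  have hN := one_sub_height_sq_pos (hD w hw) φ
  calc Real.sqrt (disc w₀) ≤ Real.sqrt (disc w) := h w hw
    _ ≤ angSpeed w φ := by
      rw [angSpeed, le_div_iff₀ hN]
      nlinarith [Real.sqrt_nonneg (disc w), sq_nonneg (height w φ)]
    _ = (cell W w).indicator (angSpeed w) φ := (Set.indicator_of_mem hφ _).symm
    _ ≤ linkSpeed W φ := Finset.single_le_sum (f := fun w => (cell W w).indicator (angSpeed w) φ)
        (fun w' hw' => Set.indicator_nonneg (fun x _ => (angSpeed_pos (hD w' hw') x).le) φ) hw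

theorem exists_mul_le_linkLength_sub (hW : W.Nonempty) (hD : ∀ w ∈ W, 0 < disc w) :
    ∃ κ > 0, ∀ φ ψ, φ ≤ ψ → κ * (ψ - φ) ≤ linkLength W ψ - linkLength W φ := by
  obtain ⟨κ, hκ, h⟩ := exists_le_linkSpeed hW hD
  refine ⟨κ, hκ, fun φ ψ hle => ?_⟩
  rw [linkLength_sub hD]
  have := intervalIntegral.integral_mono_on hle (intervalIntegrable_const (c := κ))
    (intervalIntegrable_linkSpeed hD φ ψ) fun x _ => h x
  rw [intervalIntegral.integral_const, smul_eq_mul] at this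
  linarith

theorem linkLength_strictMono (hW : W.Nonempty) (hD : ∀ w ∈ W, 0 < disc w) :
    StrictMono (linkLength W) := by
  obtain ⟨κ, hκ, h⟩ := exists_mul_le_linkLength_sub hW hD
  intro φ ψ hlt
  have := h φ ψ hlt.le
  have := mul_pos hκ (sub_pos.2 hlt)
  linarith

theorem continuous_linkLength (hD : ∀ w ∈ W, 0 < disc w) : Continuous (linkLength W) :=
  intervalIntegral.continuous_primitive (fun a b => intervalIntegrable_linkSpeed hD a b) 0

theorem linkLength_surjective (hW : W.Nonempty) (hD : ∀ w ∈ W, 0 < disc w) :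
    Function.Surjective (linkLength W) := by
  obtain ⟨κ, hκ, h⟩ := exists_mul_le_linkLength_sub hW hD
  have h0 : linkLength W 0 = 0 := by simp [linkLength]
  refine (continuous_linkLength hD).surjective ?_ ?_
  · refine Filter.tendsto_atTop_mono' _ ?_ (Filter.tendsto_id.const_mul_atTop hκ)
    filter_upwards [Filter.eventually_ge_atTop 0] with x hx
    have := h 0 x hx
    simpa [h0] using this
  · refine Filter.tendsto_atBot_mono' _ ?_ (Filter.tendsto_id.const_mul_atBot hκ)
    filter_upwards [Filter.eventually_le_atBot 0] with x hx
    have := h x 0 hx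
    simp only [h0, zero_sub, mul_neg] at this
    simpa using this

theorem linkLength_add_two_pi (hD : ∀ w ∈ W, 0 < disc w) (φ : ℝ) :
    linkLength W (φ + 2 * Real.pi) = linkLength W φ + linkLength W (2 * Real.pi) := by
  have h1 := linkLength_sub hD φ (φ + 2 * Real.pi)
  have h2 := (linkSpeed_periodic (W := W)).intervalIntegral_add_eq φ 0
  rw [zero_add] at h2
  rw [h2] at h1
  rw [← sub_eq_iff_eq_add', h1, linkLength]

/-- The sine of the arc length inside a cell. -/
theorem sin_integral_angSpeed (hw : 0 < disc w) (φ x : ℝ) :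
    Real.sin (∫ y in φ..(φ + x), angSpeed w y) = Real.sin x * (Real.sqrt (disc w) *
      ((Real.sqrt (1 - height w φ ^ 2))⁻¹ * (Real.sqrt (1 - height w (φ + x) ^ 2))⁻¹)) := by
  have h1 := arcPos_eq hw ![0, 1, 0] φ (φ + x)
  have h2 := arcPos_eq hw ![0, 0, 1] φ (φ + x)
  set A := ∫ y in φ..(φ + x), angSpeed w y
  have hN := one_sub_height_sq_pos hw φ
  have hN' := one_sub_height_sq_pos hw (φ + x)
  simp only [arcPos, arcDir, Matrix.cons_val, mul_zero, mul_one, zero_add, add_zero] at h1 h2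
  have e2 : (1 - height w φ ^ 2) * (Real.sqrt (1 - height w φ ^ 2))⁻¹ ^ 2 = 1 := by
    rw [inv_pow, Real.sq_sqrt hN.le, mul_inv_cancel₀ hN.ne']
  have e4 : Real.sqrt (disc w) * (Real.sqrt (disc w))⁻¹ = 1 :=
    mul_inv_cancel₀ (Real.sqrt_pos.2 hw).ne'
  generalize (Real.sqrt (1 - height w φ ^ 2))⁻¹ = r at *
  generalize (Real.sqrt (1 - height w (φ + x) ^ 2))⁻¹ = r' at *
  generalize (Real.sqrt (disc w))⁻¹ = d' at *
  generalize Real.sqrt (disc w) = d at *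
  have key : (Real.cos φ * (Real.cos φ - w.1 * height w φ) -
      Real.sin φ * (-Real.sin φ + w.2 * height w φ)) = 1 - height w φ ^ 2 := by
    simp only [height]
    linear_combination Real.sin_sq_add_cos_sq φ
  have h3 : Real.sin x * r' * r = Real.sin A * d' * (r ^ 2 * (1 - height w φ ^ 2)) := by
    have e3 : Real.sin x = Real.sin (φ + x) * Real.cos φ - Real.cos (φ + x) * Real.sin φ := by
      rw [← Real.sin_sub]; congr 1; ring
    rw [e3, ← key]
    linear_combination (r * Real.cos φ) * h2 - (r * Real.sin φ) * h1
  rw [mul_comm (r ^ 2), e2, mul_one] at h3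
  linear_combination (-d) * h3 - Real.sin A * e4

/-- Inside a cell, points at angle less than `π` are at distance less than `π`. -/
theorem integral_angSpeed_le_pi (hw : 0 < disc w) {φ x : ℝ} (h0 : 0 ≤ x) (hx : x ≤ Real.pi) :
    ∫ y in φ..(φ + x), angSpeed w y ≤ Real.pi := by
  by_contra! hcon
  set A : ℝ → ℝ := fun x => ∫ y in φ..(φ + x), angSpeed w y with hA
  have hAd : ∀ y, HasDerivAt A (angSpeed w (φ + y)) y := fun y => by
    have := ((continuous_angSpeed hw).integral_hasStrictDerivAt φ (φ + y)).hasDerivAt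
    simpa using this.comp_const_add φ y
  have hAc : Continuous A := continuous_iff_continuousAt.2 fun y => (hAd y).continuousAt
  have hA0 : A 0 = 0 := by simp [hA]
  -- If the length exceeded `π`, it would equal `π` at an earlier angle strictly between `0` and
  -- `π`, where its sine is positive.
  have hex : ∃ y ∈ Set.Ioo 0 x, A y = Real.pi :=
    intermediate_value_Ioo h0 hAc.continuousOn ⟨by rw [hA0]; exact Real.pi_pos, hcon⟩
  obtain ⟨y, hy, e⟩ := hex
  have h1 := sin_integral_angSpeed hw φ y
  rw [show (∫ z in φ..(φ + y), angSpeed w z) = A y from rfl, e, Real.sin_pi] at h1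
  have h2 := Real.sin_pos_of_pos_of_lt_pi hy.1 (hy.2.trans_le hx)
  have := Real.sqrt_pos.2 hw
  have := Real.sqrt_pos.2 (one_sub_height_sq_pos hw φ)
  have := Real.sqrt_pos.2 (one_sub_height_sq_pos hw (φ + y))
  have : 0 < Real.sin y * (Real.sqrt (disc w) *
      ((Real.sqrt (1 - height w φ ^ 2))⁻¹ * (Real.sqrt (1 - height w (φ + y) ^ 2))⁻¹)) := by
    positivity
  linarith

/-- In a direction in which `W` has no width, one element supports a half-circle. -/
theorem exists_half_cell (hW : W.Nonempty) {φ : ℝ}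
    (h : support W hW (φ + Real.pi) = -support W hW φ) :
    ∃ w ∈ W, Set.Icc φ (φ + Real.pi) ⊆ cell W w := by
  -- Zero width puts `W` on a line orthogonal to `φ`. The element extreme along that line is then
  -- extreme throughout the half turn.
  have heq : ∀ w ∈ W, height w φ = support W hW φ := fun w hw => by
    have h1 := height_le_support hW hw φ
    have h2 := height_le_support hW hw (φ + Real.pi)
    rw [height_add_pi, h] at h2
    linarith
  obtain ⟨w, hw, hc⟩ := exists_mem_cell hW (φ + Real.pi / 2)
  refine ⟨w, hw, fun x hx w' hw' => ?_⟩
  have h1 := hc w' hw'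
  have e : ∀ w, height w x = height w φ * Real.cos (x - φ) +
      height w (φ + Real.pi / 2) * Real.sin (x - φ) := by
    intro w
    rw [height_add w φ (Real.pi / 2), Real.cos_pi_div_two, Real.sin_pi_div_two]
    have := height_add w φ (x - φ)
    rw [add_sub_cancel] at this
    rw [this]; ring
  rw [e w', e w, heq w' hw', heq w hw]
  have := Real.sin_nonneg_of_nonneg_of_le_pi (x := x - φ) (by linarith [hx.1]) (by linarith [hx.2])
  gcongr

/-- One arc covers the half turn. Its length is positive, at most `π`, and has vanishing sine. -/
theorem linkLength_half (hW : W.Nonempty) (hD : ∀ w ∈ W, 0 < disc w) {φ : ℝ}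
    (h : support W hW (φ + Real.pi) = -support W hW φ) :
    linkLength W (φ + Real.pi) - linkLength W φ = Real.pi := by
  obtain ⟨w, hw, hc⟩ := exists_half_cell hW h
  rw [linkLength_sub_of_cell hD hw
    (by rwa [Set.uIcc_of_le (by linarith [Real.pi_pos] : φ ≤ φ + Real.pi)])]
  have hwD := hD w hw
  have h1 := integral_angSpeed_le_pi hwD (φ := φ) Real.pi_pos.le le_rfl
  have h0 : 0 ≤ ∫ y in φ..(φ + Real.pi), angSpeed w y :=
    intervalIntegral.integral_nonneg (by linarith [Real.pi_pos])
      fun y _ => (angSpeed_pos hwD y).le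
  have hs : Real.sin (∫ y in φ..(φ + Real.pi), angSpeed w y) = 0 := by
    rw [sin_integral_angSpeed hwD]; simp
  have hpos : 0 < ∫ y in φ..(φ + Real.pi), angSpeed w y :=
    intervalIntegral.intervalIntegral_pos_of_pos
      ((continuous_angSpeed hwD).intervalIntegrable _ _) (angSpeed_pos hwD)
      (by linarith [Real.pi_pos])
  by_contra hne
  exact (Real.sin_pos_of_pos_of_lt_pi hpos (lt_of_le_of_ne h1 hne)).ne' hs

/-- Zero width is symmetric under adding `π`, so both half turns have length `π`. -/
theorem linkLength_two_pi_of_half (hW : W.Nonempty) (hD : ∀ w ∈ W, 0 < disc w) {φ : ℝ}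
    (h : support W hW (φ + Real.pi) = -support W hW φ) :
    linkLength W (2 * Real.pi) = 2 * Real.pi := by
  have h1 := linkLength_half hW hD h
  have h2 : support W hW (φ + Real.pi + Real.pi) = -support W hW (φ + Real.pi) := by
    rw [h, neg_neg, ← support_add_two_pi hW φ]; congr 1; ring
  have h3 := linkLength_half hW hD h2
  rw [show φ + Real.pi + Real.pi = φ + 2 * Real.pi by ring, linkLength_add_two_pi hD] at h3
  linarith

end PolarCurve

end

/-! ### The link in an orthonormal frame -/

/-- `o, e₁, e₂` complete the unit vector `q` to an orthonormal frame of Minkowski space. -/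
structure LinkFrame (q o e₁ e₂ : Minkowski) : Prop where
  o_mem : o ∈ hyperbolicSpace
  qq : lorentz q q = 1
  oq : lorentz o q = 0
  e₁q : lorentz e₁ q = 0
  e₂q : lorentz e₂ q = 0
  oe₁ : lorentz o e₁ = 0
  oe₂ : lorentz o e₂ = 0
  e₁₁ : lorentz e₁ e₁ = 1
  e₂₂ : lorentz e₂ e₂ = 1
  e₁₂ : lorentz e₁ e₂ = 0
  parseval : ∀ x z, lorentz x z = lorentz x q * lorentz z q - lorentz x o * lorentz z o +
    lorentz x e₁ * lorentz z e₁ + lorentz x e₂ * lorentz z e₂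

/-- The boost at `o` carries Euclidean space isometrically to the complement of `o`; there the
preimage of `q` extends to an orthonormal basis. -/
theorem exists_linkFrame {q o : Minkowski} (ho : o ∈ hyperbolicSpace) (hq : lorentz q q = 1)
    (hoq : lorentz o q = 0) : ∃ e₁ e₂, LinkFrame q o e₁ e₂ := by
  have hqo : lorentz q o = 0 := by rw [lorentz_comm, hoq]
  set y := unboost o q
  have hby : boost o y = q := boost_unboost ho hqo
  have hy : ‖y‖ = 1 := by
    have := lorentz_boost_boost ho y y
    rw [hby, hq, real_inner_self_eq_norm_sq] at this
    nlinarith [norm_nonneg y]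
  have hon : Orthonormal ℝ (fun i : ({0} : Set (Fin 3)) => (fun _ : Fin 3 => y) i) := by
    refine ⟨fun i => hy, fun i j hij => absurd (Subsingleton.elim i j) hij⟩
  obtain ⟨b, hb⟩ := Orthonormal.exists_orthonormalBasis_extension_of_card_eq
    (ι := Fin 3) (𝕜 := ℝ) (E := E3) (by simp) (v := fun _ => y) (s := {0}) hon
  have hb0 : b 0 = y := hb 0 rfl
  have hbb : ∀ i j, lorentz (boost o (b i)) (boost o (b j)) = if i = j then 1 else 0 := by
    intro i j
    rw [lorentz_boost_boost ho]
    exact orthonormal_iff_ite.1 b.orthonormal i j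
  have hq0 : q = boost o (b 0) := by rw [hb0, hby]
  refine ⟨boost o (b 1), boost o (b 2), ho, hq, hoq, ?_, ?_, ?_, ?_, ?_, ?_, ?_, ?_⟩
  · rw [hq0, hbb]; simp
  · rw [hq0, hbb]; simp
  · rw [lorentz_comm, lorentz_boost_left ho]
  · rw [lorentz_comm, lorentz_boost_left ho]
  · rw [hbb]; simp
  · rw [hbb]; simp
  · rw [hbb]; simp
  · intro x z
    have hx : lorentz (x + lorentz x o • o) o = 0 := by simp [ho.2]
    have hz : lorentz (z + lorentz z o • o) o = 0 := by simp [ho.2]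
    have h1 := b.sum_inner_mul_inner (unboost o (x + lorentz x o • o))
      (unboost o (z + lorentz z o • o))
    have h2 : ∀ x, lorentz (x + lorentz x o • o) o = 0 → ∀ i,
        inner ℝ (unboost o (x + lorentz x o • o)) (b i) = lorentz x (boost o (b i)) := by
      intro x hx i
      rw [← lorentz_boost_boost ho, boost_unboost ho hx, lorentz_add_left, lorentz_smul_left,
        lorentz_comm o, lorentz_boost_left ho]
      ring
    have h3 : ∀ i, inner ℝ (b i) (unboost o (z + lorentz z o • o)) =
        lorentz z (boost o (b i)) := fun i => by rw [real_inner_comm, h2 z hz]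
    simp only [h2 x hx, h3, Fin.sum_univ_three] at h1
    rw [← lorentz_boost_boost ho, boost_unboost ho hx, boost_unboost ho hz] at h1
    simp only [lorentz_add_left, lorentz_add_right, lorentz_smul_left, lorentz_smul_right,
      ho.2, lorentz_comm o] at h1
    rw [hq0]
    linarith

/-- The planar coordinates of the point `v` with respect to a frame. -/
noncomputable def toPlane (o e₁ e₂ v : Minkowski) : ℝ × ℝ :=
  (lorentz e₁ v / -lorentz o v, lorentz e₂ v / -lorentz o v)

/-- Unnormalized vector of angle `φ` and height `h`. -/
noncomputable def rayVec (o e₁ e₂ : Minkowski) (h φ : ℝ) : Minkowski :=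
  h • o + Real.cos φ • e₁ + Real.sin φ • e₂

/-- The normalization of `rayVec`. -/
noncomputable def unitVec (o e₁ e₂ : Minkowski) (h φ : ℝ) : Minkowski :=
  (Real.sqrt (1 - h ^ 2))⁻¹ • rayVec o e₁ e₂ h φ

/-- The unit tangent vector of the arc polar to `w`. -/
noncomputable def dirVec (o e₁ e₂ : Minkowski) (w : ℝ × ℝ) (φ : ℝ) : Minkowski :=
  ((Real.sqrt (disc w))⁻¹ * (Real.sqrt (1 - height w φ ^ 2))⁻¹) •
    (tilt w φ • o + (-Real.sin φ + w.2 * height w φ) • e₁ +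
      (Real.cos φ - w.1 * height w φ) • e₂)

namespace LinkFrame

variable {q o e₁ e₂ : Minkowski}

theorem lorentz_unitVec_right (z : Minkowski) (w : ℝ × ℝ) (φ : ℝ) :
    lorentz (unitVec o e₁ e₂ (height w φ) φ) z =
      arcPos w ![lorentz o z, lorentz e₁ z, lorentz e₂ z] φ := by
  simp [unitVec, rayVec, arcPos]; ring

theorem lorentz_dirVec_right (z : Minkowski) (w : ℝ × ℝ) (φ : ℝ) :
    lorentz (dirVec o e₁ e₂ w φ) z =
      arcDir w ![lorentz o z, lorentz e₁ z, lorentz e₂ z] φ := by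
  simp [dirVec, arcDir]; ring

theorem rayVec_self (F : LinkFrame q o e₁ e₂) (h φ : ℝ) :
    lorentz (rayVec o e₁ e₂ h φ) (rayVec o e₁ e₂ h φ) = 1 - h ^ 2 := by
  simp only [rayVec, lorentz_add_left, lorentz_add_right, lorentz_smul_left, lorentz_smul_right,
    lorentz_comm e₁ o, lorentz_comm e₂ o, lorentz_comm e₂ e₁, F.oe₁, F.oe₂, F.e₁₁, F.e₂₂, F.e₁₂,
    F.o_mem.2]
  linear_combination Real.sin_sq_add_cos_sq φ

theorem unitVec_self (F : LinkFrame q o e₁ e₂) {h : ℝ} (hh : 0 < 1 - h ^ 2) (φ : ℝ) :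
    lorentz (unitVec o e₁ e₂ h φ) (unitVec o e₁ e₂ h φ) = 1 := by
  rw [unitVec, lorentz_smul_left, lorentz_smul_right, F.rayVec_self, ← mul_assoc, ← mul_inv,
    Real.mul_self_sqrt hh.le, inv_mul_cancel₀ hh.ne']

theorem unitVec_q (F : LinkFrame q o e₁ e₂) (h φ : ℝ) :
    lorentz (unitVec o e₁ e₂ h φ) q = 0 := by
  simp [unitVec, rayVec, F.oq, F.e₁q, F.e₂q]

/-- Rewriting in the radial and angular directions at `φ` makes arcs through the same point
comparable: they differ only in `tilt` and the normalization. -/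
theorem dirVec_eq (w : ℝ × ℝ) (φ : ℝ) : dirVec o e₁ e₂ w φ =
    ((Real.sqrt (disc w))⁻¹ * (Real.sqrt (1 - height w φ ^ 2))⁻¹) •
    (tilt w φ • o + (tilt w φ * height w φ) • (Real.cos φ • e₁ + Real.sin φ • e₂) +
      (1 - height w φ ^ 2) • (-Real.sin φ • e₁ + Real.cos φ • e₂)) := by
  have hb : w.2 = height w φ * Real.sin φ + tilt w φ * Real.cos φ := by
    simp only [height, tilt]
    linear_combination (-w.2) * Real.sin_sq_add_cos_sq φ
  have ha : w.1 = height w φ * Real.cos φ - tilt w φ * Real.sin φ := by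
    simp only [height, tilt]
    linear_combination (-w.1) * Real.sin_sq_add_cos_sq φ
  unfold dirVec
  congr 1
  rw [show -Real.sin φ + w.2 * height w φ = -Real.sin φ +
    (height w φ * Real.sin φ + tilt w φ * Real.cos φ) * height w φ by rw [← hb],
    show Real.cos φ - w.1 * height w φ = Real.cos φ -
    (height w φ * Real.cos φ - tilt w φ * Real.sin φ) * height w φ by rw [← ha]]
  module

theorem lorentz_dirVec_dirVec (F : LinkFrame q o e₁ e₂) {w w' : ℝ × ℝ} {φ : ℝ}
    (h : height w φ = height w' φ) (hw : 0 < disc w) :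
    lorentz (dirVec o e₁ e₂ w φ) (dirVec o e₁ e₂ w' φ) =
      (Real.sqrt (disc w))⁻¹ * (Real.sqrt (disc w'))⁻¹ *
        (1 - height w φ ^ 2 - tilt w φ * tilt w' φ) := by
  have hN := one_sub_height_sq_pos hw φ
  have e2 : (Real.sqrt (1 - height w φ ^ 2))⁻¹ ^ 2 * (1 - height w φ ^ 2) = 1 := by
    rw [inv_pow, Real.sq_sqrt hN.le, inv_mul_cancel₀ hN.ne']
  rw [dirVec_eq, dirVec_eq, ← h]
  generalize (Real.sqrt (1 - height w φ ^ 2))⁻¹ = r at *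
  generalize (Real.sqrt (disc w))⁻¹ = d at *
  generalize (Real.sqrt (disc w'))⁻¹ = d' at *
  simp only [lorentz_add_left, lorentz_add_right, lorentz_smul_left, lorentz_smul_right,
    lorentz_comm e₁ o, lorentz_comm e₂ o, lorentz_comm e₂ e₁, F.oe₁, F.oe₂, F.e₁₁, F.e₂₂, F.e₁₂,
    F.o_mem.2]
  generalize height w φ = p at *
  generalize tilt w φ = t at *
  generalize tilt w' φ = t' at *
  have hcs := Real.sin_sq_add_cos_sq φ
  generalize Real.sin φ = s at *
  generalize Real.cos φ = c at *
  linear_combination (d * d' * (1 - p ^ 2 - t * t')) * e2 +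
    (d * d' * r ^ 2 * (t * t' * p ^ 2 + (1 - p ^ 2) ^ 2)) * hcs

theorem dirVec_self (F : LinkFrame q o e₁ e₂) {w : ℝ × ℝ} (hw : 0 < disc w) (φ : ℝ) :
    lorentz (dirVec o e₁ e₂ w φ) (dirVec o e₁ e₂ w φ) = 1 := by
  rw [F.lorentz_dirVec_dirVec rfl hw, one_sub_height_sq]
  have : (Real.sqrt (disc w))⁻¹ * (Real.sqrt (disc w))⁻¹ * disc w = 1 := by
    rw [← mul_inv, Real.mul_self_sqrt hw.le, inv_mul_cancel₀ hw.ne']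
  linear_combination this

theorem unitVec_dirVec (F : LinkFrame q o e₁ e₂) (w : ℝ × ℝ) (φ : ℝ) :
    lorentz (unitVec o e₁ e₂ (height w φ) φ) (dirVec o e₁ e₂ w φ) = 0 := by
  rw [unitVec, dirVec_eq]
  simp only [rayVec, lorentz_add_left, lorentz_add_right, lorentz_smul_left, lorentz_smul_right,
    lorentz_comm e₁ o, lorentz_comm e₂ o, lorentz_comm e₂ e₁, F.oe₁, F.oe₂, F.e₁₁, F.e₂₂, F.e₁₂,
    F.o_mem.2]
  have hcs := Real.sin_sq_add_cos_sq φ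
  linear_combination ((Real.sqrt (1 - height w φ ^ 2))⁻¹ * ((Real.sqrt (disc w))⁻¹ *
    (Real.sqrt (1 - height w φ ^ 2))⁻¹) * tilt w φ * height w φ) * hcs

/-- At a breakpoint the polar curve bends towards the future. -/
theorem dirVec_bend (F : LinkFrame q o e₁ e₂) {w w' : ℝ × ℝ} {φ : ℝ} (hw : 0 < disc w)
    (hw' : 0 < disc w') (h : height w φ = height w' φ) (ht : tilt w' φ ≤ tilt w φ) :
    dirVec o e₁ e₂ w φ - dirVec o e₁ e₂ w' φ = 0 ∨
      FutureTimelike (dirVec o e₁ e₂ w φ - dirVec o e₁ e₂ w' φ) := by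
  rcases ht.eq_or_lt with ht | ht
  · left
    have : w = w' := by
      simp only [height, tilt] at h ht
      refine Prod.ext ?_ ?_
      · linear_combination Real.cos φ * h + Real.sin φ * ht +
          (w'.1 - w.1) * Real.sin_sq_add_cos_sq φ
      · linear_combination Real.sin φ * h - Real.cos φ * ht +
          (w'.2 - w.2) * Real.sin_sq_add_cos_sq φ
    rw [this, sub_self]
  right
  have hsw := Real.sqrt_pos.2 hw
  have hsw' := Real.sqrt_pos.2 hw'
  have hN := one_sub_height_sq_pos hw φ
  have hsN := Real.sqrt_pos.2 hN
  -- the timelike vector polar to the arc of `w'`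
  set T : Minkowski := o + w'.1 • e₁ + w'.2 • e₂ with hT
  have hTT : lorentz T T < 0 := by
    simp only [hT, lorentz_add_left, lorentz_add_right, lorentz_smul_left, lorentz_smul_right,
      lorentz_comm e₁ o, lorentz_comm e₂ o, lorentz_comm e₂ e₁, F.oe₁, F.oe₂, F.e₁₁, F.e₂₂,
      F.e₁₂, F.o_mem.2]
    unfold disc at hw'
    nlinarith
  have hTF : FutureTimelike T := futureTimelike_of_lorentz_neg hTT (FutureTimelike.of_mem F.o_mem)
    (by
      simp only [hT, lorentz_add_left, lorentz_smul_left, lorentz_comm e₁ o, lorentz_comm e₂ o,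
        F.oe₁, F.oe₂, F.o_mem.2]
      norm_num)
  refine futureTimelike_of_lorentz_neg ?_ hTF ?_
  · simp only [lorentz_sub_left, lorentz_sub_right, F.dirVec_self hw, F.dirVec_self hw',
      lorentz_comm (dirVec o e₁ e₂ w' φ) (dirVec o e₁ e₂ w φ), F.lorentz_dirVec_dirVec h hw]
    have hD := one_sub_height_sq w φ
    have hD' := one_sub_height_sq w' φ
    rw [← h] at hD'
    -- A difference of unit vectors is timelike when their product exceeds `1`. With `N = 1 -
    -- height²` and tilts `t, t'` this reads `(N - t t')² > (N - t²)(N - t'²)`, and the two sides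
    -- differ by `N (t - t')²`.
    suffices hs : 1 < (Real.sqrt (disc w))⁻¹ * (Real.sqrt (disc w'))⁻¹ *
        (1 - height w φ ^ 2 - tilt w φ * tilt w' φ) by linarith
    rw [← mul_inv, inv_mul_eq_div, one_lt_div (by positivity), ← Real.sqrt_mul hw.le]
    have hpos : 0 < 1 - height w φ ^ 2 - tilt w φ * tilt w' φ := by
      nlinarith [sq_nonneg (tilt w φ - tilt w' φ)]
    rw [Real.sqrt_lt' hpos]
    have e1 : disc w = (1 - height w φ ^ 2) - tilt w φ ^ 2 := by linarith
    have e2 : disc w' = (1 - height w φ ^ 2) - tilt w' φ ^ 2 := by linarith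
    rw [e1, e2]
    have : 0 < (1 - height w φ ^ 2) * (tilt w φ - tilt w' φ) ^ 2 := by
      have : tilt w φ - tilt w' φ ≠ 0 := by linarith
      positivity
    nlinarith
  -- `T` is orthogonal to the arc of `w'`, so the pairing sees only the direction belonging to `w`;
  -- its sign is that of `tilt w' φ - tilt w φ`.
  · have e : ∀ v : ℝ × ℝ, height v φ = height w φ → lorentz (dirVec o e₁ e₂ v φ) T =
        (Real.sqrt (disc v))⁻¹ * (Real.sqrt (1 - height w φ ^ 2))⁻¹ *
          (-(1 - height w φ ^ 2) * (tilt v φ - tilt w' φ)) := by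
      intro v hv
      have hb : w'.2 = height w φ * Real.sin φ + tilt w' φ * Real.cos φ := by
        rw [h]; simp only [height, tilt]
        linear_combination (-w'.2) * Real.sin_sq_add_cos_sq φ
      have ha : w'.1 = height w φ * Real.cos φ - tilt w' φ * Real.sin φ := by
        rw [h]; simp only [height, tilt]
        linear_combination (-w'.1) * Real.sin_sq_add_cos_sq φ
      rw [dirVec_eq, hv, hT, ha, hb]
      simp only [lorentz_add_left, lorentz_add_right, lorentz_smul_left,
        lorentz_smul_right, lorentz_comm e₁ o, lorentz_comm e₂ o, lorentz_comm e₂ e₁, F.oe₁,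
        F.oe₂, F.e₁₁, F.e₂₂, F.e₁₂, F.o_mem.2]
      linear_combination ((Real.sqrt (disc v))⁻¹ * (Real.sqrt (1 - height w φ ^ 2))⁻¹ *
        (tilt v φ * height w φ ^ 2 + (1 - height w φ ^ 2) * tilt w' φ)) *
          Real.sin_sq_add_cos_sq φ
    rw [lorentz_sub_left, e w rfl, e w' h.symm, sub_self, mul_zero, mul_zero, sub_zero]
    refine mul_neg_of_pos_of_neg (by positivity) ?_
    have := mul_pos hN (sub_pos.2 ht)
    linarith

end LinkFrame

/-- Two distinct supporting unit normals whose sum is neither zero nor timelike are separated from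
the polar body by a causal vector. -/
theorem exists_causal_of_not_bend {u u' o v v' : Minkowski} (ho : o ∈ hyperbolicSpace)
    (hu : lorentz u u = 1) (hu' : lorentz u' u' = 1) (hv : FutureTimelike v)
    (hv' : FutureTimelike v') (huv : lorentz u v = 0) (huv' : lorentz u v' ≤ 0)
    (hu'v' : lorentz u' v' = 0) (hu'v : lorentz u' v ≤ 0) (hne : u ≠ u') (h0 : u + u' ≠ 0)
    (hF : ¬ FutureTimelike (u + u')) :
    ∃ y, FutureCausal y ∧ lorentz u y = lorentz u' y ∧ 0 ≤ lorentz u y := by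
  have haa : lorentz (u + u') (u + u') = 2 + 2 * lorentz u u' := by
    simp only [lorentz_add_left, lorentz_add_right, hu, hu', lorentz_comm u' u]; ring
  -- Here the sum itself is causal and serves as separator up to sign; if it points to the future it
  -- is null, by the assumption that it is not timelike.
  rcases le_or_gt (lorentz u u') (-1) with hg | hg
  · rcases futureCausal_or_neg (a := u + u') (by rw [haa]; linarith) h0 with h1 | h1
    · have h2 : lorentz (u + u') (u + u') = 0 :=
        le_antisymm h1.2 (not_lt.1 fun h => hF ⟨h1.1, h⟩)
      refine ⟨u + u', h1, ?_, ?_⟩ <;>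
        simp only [lorentz_add_right, hu, hu', lorentz_comm u' u] <;> linarith
    · refine ⟨-(u + u'), h1, ?_, ?_⟩ <;>
        simp only [lorentz_neg_right, lorentz_add_right, hu, hu', lorentz_comm u' u] <;> linarith
  rcases lt_or_ge (lorentz u u') 1 with hg' | hg'
  · set g := lorentz u u' with hgdef
    have hD : 0 < 1 - g ^ 2 := by nlinarith
    set p := lorentz o u
    set p' := lorentz o u'
    -- When `|g| < 1` the plane of `u` and `u'` is spacelike, and the separator is the projection of
    -- `o` to its orthogonal complement.
    set y := o - ((p - g * p') / (1 - g ^ 2)) • u - ((p' - g * p) / (1 - g ^ 2)) • u' with hy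
    have h1 : lorentz u y = 0 := by
      simp only [hy, lorentz_sub_right, lorentz_smul_right, hu, lorentz_comm u o, ← hgdef]
      field_simp
      ring
    have h2 : lorentz u' y = 0 := by
      simp only [hy, lorentz_sub_right, lorentz_smul_right, hu', lorentz_comm u' o,
        lorentz_comm u' u, ← hgdef]
      field_simp
      ring
    have h3 : lorentz y y = lorentz y o := by
      have e : ∀ z, lorentz y z = lorentz o z - ((p - g * p') / (1 - g ^ 2)) * lorentz u z -
          ((p' - g * p) / (1 - g ^ 2)) * lorentz u' z := fun z => by
        rw [hy]; simp only [lorentz_sub_left, lorentz_smul_left]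
      rw [e y, h1, h2, mul_zero, mul_zero, sub_zero, sub_zero, lorentz_comm]
    have h4 : lorentz y o ≤ -1 := by
      simp only [hy, lorentz_sub_left, lorentz_smul_left, lorentz_comm u o, lorentz_comm u' o,
        ho.2]
      have e : -1 - (p - g * p') / (1 - g ^ 2) * p - (p' - g * p) / (1 - g ^ 2) * p' =
        -1 - ((p - g * p') ^ 2 / (1 - g ^ 2) + p' ^ 2) := by
          field_simp; ring
      rw [e]
      have : 0 ≤ (p - g * p') ^ 2 / (1 - g ^ 2) + p' ^ 2 := by positivity
      linarith
    exact ⟨y, futureCausal_of_lorentz_neg (by linarith) (FutureTimelike.of_mem ho) (by linarith),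
      by rw [h1, h2], h1.ge⟩
  -- When the product is at least `1` the difference is causal; its time orientation contradicts one
  -- of the two support conditions.
  · exfalso
    have hd : lorentz (u - u') (u - u') ≤ 0 := by
      simp only [lorentz_sub_left, lorentz_sub_right, hu, hu', lorentz_comm u' u]; linarith
    rcases futureCausal_or_neg hd (sub_ne_zero.2 hne) with h1 | h1
    · have := lorentz_neg_of_futureTimelike hv h1
      rw [lorentz_comm, lorentz_sub_left] at this
      linarith
    · have := lorentz_neg_of_futureTimelike hv' h1
      rw [lorentz_comm, lorentz_neg_left, lorentz_sub_left] at this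
      linarith

/-- The point of the curve polar to `W` in the direction of angle `φ`. -/
noncomputable def linkPt (o e₁ e₂ : Minkowski) (W : Finset (ℝ × ℝ)) (hW : W.Nonempty) (φ : ℝ) :
    Minkowski :=
  unitVec o e₁ e₂ (support W hW φ) φ

namespace LinkFrame

variable {q o e₁ e₂ : Minkowski} {W : Finset (ℝ × ℝ)} {hW : W.Nonempty}

theorem linkPt_eq {w : ℝ × ℝ} (hw : w ∈ W) {φ : ℝ} (h : φ ∈ cell W w) :
    linkPt o e₁ e₂ W hW φ = unitVec o e₁ e₂ (height w φ) φ := by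
  rw [linkPt, support_eq_of_mem_cell hW hw h]

theorem one_sub_support_sq_pos (hD : ∀ w ∈ W, 0 < disc w) (φ : ℝ) :
    0 < 1 - support W hW φ ^ 2 := by
  obtain ⟨w, hw, h⟩ := exists_mem_cell hW φ
  rw [support_eq_of_mem_cell hW hw h]
  exact one_sub_height_sq_pos (hD w hw) φ

theorem linkPt_rotate (hD : ∀ w ∈ W, 0 < disc w) {w : ℝ × ℝ} (hw : w ∈ W) {φ ψ : ℝ}
    (h : Set.uIcc φ ψ ⊆ cell W w) :
    linkPt o e₁ e₂ W hW ψ =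
      Real.cos (linkLength W ψ - linkLength W φ) • linkPt o e₁ e₂ W hW φ +
        Real.sin (linkLength W ψ - linkLength W φ) • dirVec o e₁ e₂ w φ := by
  refine eq_of_forall_lorentz_eq fun z => ?_
  rw [linkPt_eq hw (h Set.right_mem_uIcc), linkPt_eq hw (h Set.left_mem_uIcc), lorentz_add_left,
    lorentz_smul_left, lorentz_smul_left, lorentz_unitVec_right, lorentz_unitVec_right,
    lorentz_dirVec_right, linkLength_sub_of_cell hD hw h]
  exact arcPos_eq (hD w hw) _ _ _

theorem linkPt_add_two_pi (φ : ℝ) :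
    linkPt o e₁ e₂ W hW (φ + 2 * Real.pi) = linkPt o e₁ e₂ W hW φ := by
  simp [linkPt, support_add_two_pi, unitVec, rayVec]

/-- Near every direction the support is given by one element on each side, hence the curve by one
great-circle arc on each side. `τ` inverts arc length. -/
theorem exists_brokenGeodesic (F : LinkFrame q o e₁ e₂) (hD : ∀ w ∈ W, 0 < disc w) {τ : ℝ → ℝ}
    (hτ : ∀ α, linkLength W (τ α) = α) :
    ∃ u w, IsBrokenGeodesic (fun α => linkPt o e₁ e₂ W hW (τ α)) u w := by
  have hmono := linkLength_strictMono hW hD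
  choose wr hwr δr hδr hr using fun φ => exists_cell_right hW φ
  choose wl hwl δl hδl hl using fun φ => exists_cell_left hW φ
  have hcr : ∀ φ, φ ∈ cell W (wr φ) := fun φ => hr φ ⟨le_rfl, by linarith [hδr φ]⟩
  have hcl : ∀ φ, φ ∈ cell W (wl φ) := fun φ => hl φ ⟨by linarith [hδl φ], le_rfl⟩
  refine ⟨fun α => dirVec o e₁ e₂ (wr (τ α)) (τ α), fun α => -dirVec o e₁ e₂ (wl (τ α)) (τ α),
    ?_, ?_, ?_, ?_, ?_, ?_, ?_⟩
  · exact fun t => F.unitVec_self (one_sub_support_sq_pos hD _) _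
  · exact fun t => F.dirVec_self (hD _ (hwr _)) _
  · exact fun t => by simpa using F.dirVec_self (hD _ (hwl _)) _
  · exact fun t => by
      simp only [linkPt_eq (hwr (τ t)) (hcr (τ t))]
      exact F.unitVec_dirVec _ _
  · exact fun t => by
      simp only [linkPt_eq (hwl (τ t)) (hcl (τ t)), lorentz_neg_right, neg_eq_zero]
      exact F.unitVec_dirVec _ _
  · intro t
    simp only [← sub_eq_add_neg]
    have heq : height (wr (τ t)) (τ t) = height (wl (τ t)) (τ t) :=
      le_antisymm (hcl _ _ (hwr _)) (hcr _ _ (hwl _))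
    -- The element supporting on the right has the larger slope, as it overtakes or equals the other
    -- one just beyond the direction.
    refine F.dirVec_bend (hD _ (hwr _)) (hD _ (hwl _)) heq ?_
    have hx : 0 < min (δr (τ t)) (Real.pi / 2) := lt_min (hδr _) (by linarith [Real.pi_pos])
    set x := min (δr (τ t)) (Real.pi / 2)
    have h1 := hr (τ t) (a := τ t + x) ⟨by linarith, by linarith [min_le_left (δr (τ t)) (Real.pi / 2)]⟩
      _ (hwl (τ t))
    rw [height_add, height_add, heq] at h1
    have hs := Real.sin_pos_of_pos_of_lt_pi hx
      (by linarith [min_le_right (δr (τ t)) (Real.pi / 2), Real.pi_pos])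
    exact le_of_mul_le_mul_right (by linarith) hs
  · intro t
    have e1 := hmono (show τ t < τ t + δr (τ t) by linarith [hδr (τ t)])
    have e2 := hmono (show τ t - δl (τ t) < τ t by linarith [hδl (τ t)])
    refine ⟨min (linkLength W (τ t + δr (τ t)) - linkLength W (τ t))
      (linkLength W (τ t) - linkLength W (τ t - δl (τ t))),
      lt_min (by linarith) (by linarith), fun s hs => ⟨?_, ?_⟩⟩
    · have h1 : τ t ≤ τ (t + s) := by
        rw [← hmono.le_iff_le, hτ, hτ]; linarith [hs.1]
      have h2 : τ (t + s) ≤ τ t + δr (τ t) := by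
        rw [← hmono.le_iff_le, hτ]
        have := hs.2.trans_le (min_le_left _ _)
        rw [hτ] at this
        linarith
      have := linkPt_rotate (hW := hW) (o := o) (e₁ := e₁) (e₂ := e₂) hD (hwr (τ t))
        (φ := τ t) (ψ := τ (t + s))
        (by rw [Set.uIcc_of_le h1]; exact (Set.Icc_subset_Icc_right h2).trans (hr (τ t)))
      rwa [hτ, hτ, add_sub_cancel_left] at this
    · have h1 : τ (t - s) ≤ τ t := by
        rw [← hmono.le_iff_le, hτ, hτ]; linarith [hs.1]
      have h2 : τ t - δl (τ t) ≤ τ (t - s) := by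
        rw [← hmono.le_iff_le, hτ]
        have := hs.2.trans_le (min_le_right _ _)
        rw [hτ] at this
        linarith
      have := linkPt_rotate (hW := hW) (o := o) (e₁ := e₁) (e₂ := e₂) hD (hwl (τ t))
        (φ := τ t) (ψ := τ (t - s))
        (by rw [Set.uIcc_of_ge h1]; exact (Set.Icc_subset_Icc_left h2).trans (hl (τ t)))
      rw [hτ, hτ, sub_sub_cancel_left, Real.cos_neg, Real.sin_neg] at this
      simp only [smul_neg]
      rw [this, neg_smul]

theorem lorentz_unitVec_o (F : LinkFrame q o e₁ e₂) (h φ : ℝ) :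
    lorentz (unitVec o e₁ e₂ h φ) o = -((Real.sqrt (1 - h ^ 2))⁻¹ * h) := by
  simp only [unitVec, rayVec, lorentz_add_left, lorentz_smul_left, lorentz_comm e₁ o,
    lorentz_comm e₂ o, F.oe₁, F.oe₂, F.o_mem.2]
  ring

theorem lorentz_unitVec_e₁ (F : LinkFrame q o e₁ e₂) (h φ : ℝ) :
    lorentz (unitVec o e₁ e₂ h φ) e₁ = (Real.sqrt (1 - h ^ 2))⁻¹ * Real.cos φ := by
  simp only [unitVec, rayVec, lorentz_add_left, lorentz_smul_left, lorentz_comm e₂ e₁, F.e₁₂,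
    F.oe₁, F.e₁₁]
  ring

theorem lorentz_unitVec_e₂ (F : LinkFrame q o e₁ e₂) (h φ : ℝ) :
    lorentz (unitVec o e₁ e₂ h φ) e₂ = (Real.sqrt (1 - h ^ 2))⁻¹ * Real.sin φ := by
  simp only [unitVec, rayVec, lorentz_add_left, lorentz_smul_left, F.e₁₂, F.oe₂, F.e₂₂]
  ring

theorem support_add_int_mul (φ : ℝ) (k : ℤ) :
    support W hW (φ + 2 * Real.pi * k) = support W hW φ := by
  have : Function.Periodic (support W hW) (2 * Real.pi) := support_add_two_pi hW
  rw [mul_comm]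
  exact this.int_mul k φ

/-- Antipodal points of the polar curve lie in opposite directions in which `W` has no width. -/
theorem antipodal (F : LinkFrame q o e₁ e₂) (hD : ∀ w ∈ W, 0 < disc w) {φ ψ : ℝ}
    (h : linkPt o e₁ e₂ W hW ψ = -linkPt o e₁ e₂ W hW φ) :
    support W hW (φ + Real.pi) = -support W hW φ ∧ ∃ k : ℤ, ψ = φ + Real.pi + 2 * Real.pi * k := by
  have h1 := congrArg (fun x => lorentz x e₁) h
  have h2 := congrArg (fun x => lorentz x e₂) h
  have h3 := congrArg (fun x => lorentz x o) h
  simp only [linkPt, lorentz_neg_left, F.lorentz_unitVec_e₁, F.lorentz_unitVec_e₂,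
    F.lorentz_unitVec_o] at h1 h2 h3
  have p1 : 0 < (Real.sqrt (1 - support W hW φ ^ 2))⁻¹ :=
    inv_pos.2 (Real.sqrt_pos.2 (one_sub_support_sq_pos hD φ))
  have p2 : 0 < (Real.sqrt (1 - support W hW ψ ^ 2))⁻¹ :=
    inv_pos.2 (Real.sqrt_pos.2 (one_sub_support_sq_pos hD ψ))
  generalize (Real.sqrt (1 - support W hW φ ^ 2))⁻¹ = r at *
  generalize (Real.sqrt (1 - support W hW ψ ^ 2))⁻¹ = r' at *
  have hr : r = r' := by
    have : r ^ 2 = r' ^ 2 := by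
      have a1 := Real.sin_sq_add_cos_sq φ
      have a2 := Real.sin_sq_add_cos_sq ψ
      have b1 : (r' * Real.cos ψ) ^ 2 + (r' * Real.sin ψ) ^ 2 =
        (r * Real.cos φ) ^ 2 + (r * Real.sin φ) ^ 2 := by rw [h1, h2]; ring
      linear_combination (-r ^ 2) * a1 + r' ^ 2 * a2 - b1
    exact (sq_eq_sq₀ p1.le p2.le).1 this
  subst hr
  have c1 : Real.cos ψ = Real.cos (φ + Real.pi) := by
    rw [Real.cos_add_pi]
    have : r * (Real.cos ψ + Real.cos φ) = 0 := by linarith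
    linarith [(mul_eq_zero.1 this).resolve_left p1.ne']
  have c2 : Real.sin ψ = Real.sin (φ + Real.pi) := by
    rw [Real.sin_add_pi]
    have : r * (Real.sin ψ + Real.sin φ) = 0 := by linarith
    linarith [(mul_eq_zero.1 this).resolve_left p1.ne']
  have c3 : support W hW ψ = -support W hW φ := by
    have : r * (support W hW ψ + support W hW φ) = 0 := by linarith
    linarith [(mul_eq_zero.1 this).resolve_left p1.ne']
  obtain ⟨k, hk⟩ := Real.Angle.angle_eq_iff_two_pi_dvd_sub.1 (Real.Angle.cos_sin_inj c1 c2)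
  have hψ : ψ = φ + Real.pi + 2 * Real.pi * k := by linarith
  refine ⟨?_, k, hψ⟩
  rw [← c3, hψ, support_add_int_mul]

theorem linkPt_add_pi (h : support W hW (φ + Real.pi) = -support W hW φ) :
    linkPt o e₁ e₂ W hW (φ + Real.pi) = -linkPt o e₁ e₂ W hW φ := by
  simp only [linkPt, h, unitVec, rayVec, neg_sq, Real.cos_add_pi, Real.sin_add_pi]
  module

end LinkFrame

/-! ### Links and their arc length parametrization -/

/-- The link of the polar surface of `V` at `q`, if `V` is the set of vertices orthogonal to `q`. -/
def linkSet (q : Minkowski) (V : Finset Minkowski) : Set Minkowski :=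
  {x | lorentz x x = 1 ∧ lorentz x q = 0 ∧ (∀ v ∈ V, lorentz x v ≤ 0) ∧ ∃ v ∈ V, lorentz x v = 0}

/-- `c` is an arc length parametrization of the link, which has length `θ`. -/
structure IsLinkCurve (q : Minkowski) (V : Finset Minkowski) (θ : ℝ) (c : ℝ → Minkowski) :
    Prop where
  two_pi_le : 2 * Real.pi ≤ θ
  periodic : Function.Periodic c θ
  mem_range : ∀ x, (∃ α, c α = x) ↔ x ∈ linkSet q V
  cell : ∀ v ∈ V, ∀ α β, lorentz (c α) v = 0 → lorentz (c β) v = 0 →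
    ‖((α - β : ℝ) : AddCircle θ)‖ ≤ Real.pi ∧
      lorentz (c α) (c β) = Real.cos ‖((α - β : ℝ) : AddCircle θ)‖
  bend : ∀ α β, Real.pi ≤ ‖((α - β : ℝ) : AddCircle θ)‖ →
    c α + c β = 0 ∨ FutureTimelike (c α + c β)
  excess : θ = 2 * Real.pi ∨ 2 * Real.pi < θ ∧ ∀ x ∈ linkSet q V, -x ∉ linkSet q V
  right : ∀ α, ∃ δ > 0, ∃ v ∈ V, ∀ β ∈ Set.Icc α (α + δ), lorentz (c β) v = 0
  left : ∀ α, ∃ δ > 0, ∃ v ∈ V, ∀ β ∈ Set.Icc (α - δ) α, lorentz (c β) v = 0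

theorem lorentz_neg_of_mem {o v : Minkowski} (ho : o ∈ hyperbolicSpace)
    (hv : FutureCausal v) : 0 < -lorentz o v :=
  neg_pos.2 (lorentz_neg_of_futureTimelike (FutureTimelike.of_mem ho) hv)

namespace LinkFrame

variable {q o e₁ e₂ : Minkowski}

/-- In projective coordinates, the sign of a pairing with a future causal vector is a comparison of
heights. This translates supporting planes into support functions. -/
theorem lorentz_rayVec (F : LinkFrame q o e₁ e₂) {y : Minkowski} (hy : FutureCausal y)
    (h φ : ℝ) : lorentz (rayVec o e₁ e₂ h φ) y =
      -lorentz o y * (height (toPlane o e₁ e₂ y) φ - h) := by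
  have hk := lorentz_neg_of_mem F.o_mem hy
  have hk' : lorentz o y ≠ 0 := (neg_pos.1 hk).ne
  simp only [rayVec, lorentz_add_left, lorentz_smul_left, height, toPlane]
  field_simp
  ring

theorem disc_toPlane_pos (F : LinkFrame q o e₁ e₂) {v : Minkowski} (hv : v ∈ hyperbolicSpace)
    (hvq : lorentz v q = 0) : 0 < disc (toPlane o e₁ e₂ v) := by
  have hk := lorentz_neg_of_mem F.o_mem (FutureTimelike.of_mem hv).futureCausal
  have h1 := F.parseval v v
  rw [hv.2, hvq, lorentz_comm v o, lorentz_comm v e₁, lorentz_comm v e₂] at h1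
  have hk' : lorentz o v ≠ 0 := (neg_pos.1 hk).ne
  simp only [disc, toPlane]
  rw [div_pow, div_pow]
  have : 1 - lorentz e₁ v ^ 2 / (-lorentz o v) ^ 2 - lorentz e₂ v ^ 2 / (-lorentz o v) ^ 2 =
      1 / (-lorentz o v) ^ 2 := by
    rw [neg_sq]
    field_simp
    linarith
  rw [this]
  positivity

variable {V : Finset Minkowski}

theorem lorentz_linkPt (F : LinkFrame q o e₁ e₂) {W : Finset (ℝ × ℝ)} {hW : W.Nonempty}
    {y : Minkowski} (hy : FutureCausal y) (φ : ℝ) :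
    lorentz (linkPt o e₁ e₂ W hW φ) y = (Real.sqrt (1 - support W hW φ ^ 2))⁻¹ *
      (-lorentz o y * (height (toPlane o e₁ e₂ y) φ - support W hW φ)) := by
  rw [linkPt, unitVec, lorentz_smul_left, F.lorentz_rayVec hy]

theorem lorentz_linkPt_nonneg_iff (F : LinkFrame q o e₁ e₂) {W : Finset (ℝ × ℝ)} {hW : W.Nonempty}
    (hD : ∀ w ∈ W, 0 < disc w) {y : Minkowski} (hy : FutureCausal y) (φ : ℝ) :
    0 ≤ lorentz (linkPt o e₁ e₂ W hW φ) y ↔ support W hW φ ≤ height (toPlane o e₁ e₂ y) φ := by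
  have hk := lorentz_neg_of_mem F.o_mem hy
  have hs := Real.sqrt_pos.2 (one_sub_support_sq_pos (hW := hW) hD φ)
  rw [F.lorentz_linkPt hy, mul_nonneg_iff_of_pos_left (inv_pos.2 hs), mul_nonneg_iff_of_pos_left hk,
    sub_nonneg]

theorem lorentz_linkPt_eq_zero_iff (F : LinkFrame q o e₁ e₂) {W : Finset (ℝ × ℝ)} {hW : W.Nonempty}
    (hD : ∀ w ∈ W, 0 < disc w) {y : Minkowski} (hy : FutureCausal y) (φ : ℝ) :
    lorentz (linkPt o e₁ e₂ W hW φ) y = 0 ↔ support W hW φ = height (toPlane o e₁ e₂ y) φ := by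
  have hk := lorentz_neg_of_mem F.o_mem hy
  have hs := Real.sqrt_pos.2 (one_sub_support_sq_pos (hW := hW) hD φ)
  rw [F.lorentz_linkPt hy, mul_eq_zero_iff_left (inv_pos.2 hs).ne', mul_eq_zero_iff_left hk.ne',
    sub_eq_zero, eq_comm]

end LinkFrame

theorem norm_coe_addCircle_le (θ x : ℝ) : ‖(x : AddCircle θ)‖ ≤ |x| :=
  QuotientAddGroup.norm_mk_le_norm

theorem norm_coe_sub_comm (θ x y : ℝ) :
    ‖((x - y : ℝ) : AddCircle θ)‖ = ‖((y - x : ℝ) : AddCircle θ)‖ := by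
  rw [← neg_sub, AddCircle.coe_neg, norm_neg]

/-- Any two points of a circle of length `θ` have representatives at most half a turn apart. -/
theorem exists_ordered_representatives {θ : ℝ} (hθ : 0 < θ) {τ : ℝ → ℝ}
    (hτ : ∀ α, τ (α + θ) = τ α + 2 * Real.pi) {X : Type*} {c : ℝ → X}
    (hc : Function.Periodic c θ) (α β : ℝ) :
    ∃ α' β', α' ≤ β' ∧ τ β' ≤ τ α' + Real.pi ∧
      ‖((α' - β' : ℝ) : AddCircle θ)‖ = ‖((α - β : ℝ) : AddCircle θ)‖ ∧
      (c α' = c α ∧ c β' = c β ∨ c α' = c β ∧ c β' = c α) := by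
  set β₁ := toIcoMod hθ α β with hβ₁
  have h1 := toIcoMod_mem_Ico hθ α β
  have hβ : β₁ = β - toIcoDiv hθ α β • θ := rfl
  have hcβ : c β₁ = c β := by rw [hβ, hc.sub_zsmul_eq]
  have hcoe : ((β₁ : ℝ) : AddCircle θ) = β := by
    rw [hβ, AddCircle.coe_sub, AddCircle.coe_zsmul, AddCircle.coe_period, smul_zero, sub_zero]
  -- The angles swept from `α` to `β₁` and from `β₁` to `α + θ` add up to `2π`; take a side where
  -- the sweep is at most `π`.
  rcases le_total (τ β₁) (τ α + Real.pi) with h | h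
  · refine ⟨α, β₁, h1.1, h, ?_, Or.inl ⟨rfl, hcβ⟩⟩
    rw [AddCircle.coe_sub, hcoe, AddCircle.coe_sub]
  · refine ⟨β₁, α + θ, h1.2.le, ?_, ?_, Or.inr ⟨hcβ, hc α⟩⟩
    · rw [hτ]; linarith
    · rw [AddCircle.coe_sub, hcoe, AddCircle.coe_add, AddCircle.coe_period, add_zero,
        ← AddCircle.coe_sub, norm_coe_sub_comm]

/-- The link of the polar surface is a closed curve with cone angle at least `2π`. -/
theorem exists_linkCurve {q : Minkowski} (hq : lorentz q q = 1) {V : Finset Minkowski}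
    (hV : V.Nonempty) (hVq : ∀ v ∈ V, v ∈ hyperbolicSpace ∧ lorentz v q = 0) :
    ∃ θ c, IsLinkCurve q V θ c := by
  classical
  obtain ⟨o, hoV⟩ := hV
  obtain ⟨e₁, e₂, F⟩ := exists_linkFrame (hVq o hoV).1 hq (hVq o hoV).2
  have hFC : ∀ v ∈ V, FutureCausal v := fun v hv => (FutureTimelike.of_mem (hVq v hv).1).futureCausal
  set W := V.image (toPlane o e₁ e₂) with hWdef
  have hW : W.Nonempty := Finset.Nonempty.image ⟨o, hoV⟩ _
  have hVW : ∀ v ∈ V, toPlane o e₁ e₂ v ∈ W := fun v hv => Finset.mem_image_of_mem _ hv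
  have hD : ∀ w ∈ W, 0 < disc w := by
    intro w hw
    obtain ⟨v, hv, rfl⟩ := Finset.mem_image.1 hw
    exact F.disc_toPlane_pos (hVq v hv).1 (hVq v hv).2
  have hmono := linkLength_strictMono hW hD
  choose τ hτ using linkLength_surjective hW hD
  have hτl : ∀ φ, τ (linkLength W φ) = φ := fun φ => hmono.injective (hτ _)
  have hτmono : StrictMono τ := fun a b hab => by rwa [← hmono.lt_iff_lt, hτ, hτ]
  set θ := linkLength W (2 * Real.pi) with hθdef
  have hθ : 0 < θ := by
    have h0 : linkLength W 0 = 0 := by simp [linkLength]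
    rw [← h0]
    exact hmono (by positivity)
  have hτadd : ∀ α, τ (α + θ) = τ α + 2 * Real.pi := fun α => by
    apply hmono.injective
    rw [hτ, linkLength_add_two_pi hD, hτ]
  set c : ℝ → Minkowski := fun α => linkPt o e₁ e₂ W hW (τ α) with hc
  obtain ⟨u, w, hB⟩ := F.exists_brokenGeodesic (hW := hW) hD hτ
  change IsBrokenGeodesic c u w at hB
  have hper : Function.Periodic c θ := fun α => by
    simp only [hc, hτadd, LinkFrame.linkPt_add_two_pi]
  -- the dichotomy on the width of `W`
  have hdich : θ = 2 * Real.pi ∨ 2 * Real.pi < θ ∧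
      ∀ φ, support W hW (φ + Real.pi) ≠ -support W hW φ := by
    by_cases h : ∃ φ, support W hW (φ + Real.pi) = -support W hW φ
    · obtain ⟨φ, hφ⟩ := h
      exact Or.inl (linkLength_two_pi_of_half hW hD hφ)
    · push Not at h
      refine Or.inr ⟨hB.two_pi_lt hθ hper fun t ht => ?_, h⟩
      exact h _ (F.antipodal hD ht).1
  have h2π : 2 * Real.pi ≤ θ := by
    rcases hdich with h | h
    · exact h.ge
    · exact h.1.le
  have hzero : ∀ v ∈ V, ∀ φ, lorentz (linkPt o e₁ e₂ W hW φ) v = 0 ↔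
      φ ∈ cell W (toPlane o e₁ e₂ v) := fun v hv φ => by
    rw [F.lorentz_linkPt_eq_zero_iff hD (hFC v hv)]
    exact ⟨mem_cell_of_support_eq hW, support_eq_of_mem_cell hW (hVW v hv)⟩
  have hrange : ∀ x, (∃ α, c α = x) ↔ x ∈ linkSet q V := by
    intro x
    constructor
    · rintro ⟨α, rfl⟩
      refine ⟨hB.self α, F.unitVec_q _ _, fun v hv => ?_, ?_⟩
      · have hk := lorentz_neg_of_mem F.o_mem (hFC v hv)
        have hs := Real.sqrt_pos.2 (LinkFrame.one_sub_support_sq_pos (hW := hW) hD (τ α))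
        simp only [hc, F.lorentz_linkPt (hFC v hv)]
        exact mul_nonpos_of_nonneg_of_nonpos (inv_pos.2 hs).le
          (mul_nonpos_of_nonneg_of_nonpos hk.le
            (sub_nonpos.2 (height_le_support hW (hVW v hv) _)))
      · obtain ⟨w, hw, h⟩ := exists_mem_cell hW (τ α)
        obtain ⟨v, hv, rfl⟩ := Finset.mem_image.1 hw
        exact ⟨v, hv, (hzero v hv _).2 h⟩
    · rintro ⟨hxx, hxq, hxV, v₀, hv₀, hx0⟩
      have hp := F.parseval x x
      rw [hxx, hxq] at hp
      -- The argument of this nonzero complex number is the direction of `x`; its modulus is the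
      -- scale relative to the unnormalized ray vector.
      set z : ℂ := ⟨lorentz x e₁, lorentz x e₂⟩ with hz
      have hz2 : ‖z‖ ^ 2 = 1 + lorentz x o ^ 2 := by
        rw [← Complex.normSq_eq_norm_sq, Complex.normSq_apply]
        simp only [hz]
        linarith
      have hρ : 0 < ‖z‖ := by
        rcases (norm_nonneg z).eq_or_lt with h | h
        · rw [← h] at hz2; nlinarith
        · exact h
      have hz0 : z ≠ 0 := norm_pos_iff.1 hρ
      have hcos : ‖z‖ * Real.cos z.arg = lorentz x e₁ := Complex.norm_mul_cos_arg z
      have hsin : ‖z‖ * Real.sin z.arg = lorentz x e₂ := Complex.norm_mul_sin_arg z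
      set φ := z.arg
      set h := -lorentz x o / ‖z‖ with hh
      have hxray : x = ‖z‖ • rayVec o e₁ e₂ h φ := by
        refine eq_of_forall_lorentz_eq fun y => ?_
        rw [F.parseval x y, hxq, ← hcos, ← hsin]
        simp only [rayVec, lorentz_smul_left, lorentz_add_left, lorentz_comm o y,
          lorentz_comm e₁ y, lorentz_comm e₂ y, hh]
        field_simp
        ring
      have hxv : ∀ v ∈ V, lorentz x v =
          ‖z‖ * (-lorentz o v * (height (toPlane o e₁ e₂ v) φ - h)) := fun v hv => by
        conv_lhs => rw [hxray]
        rw [lorentz_smul_left, F.lorentz_rayVec (hFC v hv)]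
      have hsup : support W hW φ = h := by
        refine le_antisymm (Finset.sup'_le _ _ fun w hw => ?_) ?_
        · obtain ⟨v, hv, rfl⟩ := Finset.mem_image.1 hw
          have h1 := hxV v hv
          rw [hxv v hv] at h1
          by_contra! hcon
          have := mul_pos hρ (mul_pos (lorentz_neg_of_mem F.o_mem (hFC v hv)) (sub_pos.2 hcon))
          linarith
        · rw [hxv v₀ hv₀] at hx0
          have h1 := (mul_eq_zero.1 ((mul_eq_zero.1 hx0).resolve_left hρ.ne')).resolve_left
            (lorentz_neg_of_mem F.o_mem (hFC v₀ hv₀)).ne'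
          have := height_le_support hW (hVW v₀ hv₀) φ
          linarith
      refine ⟨linkLength W φ, ?_⟩
      simp only [hc, hτl, linkPt, hsup, unitVec]
      conv_rhs => rw [hxray]
      congr 1
      have : Real.sqrt (1 - h ^ 2) = ‖z‖⁻¹ := by
        rw [← Real.sqrt_sq (inv_pos.2 hρ).le]
        congr 1
        rw [hh, div_pow, inv_pow, hz2]
        field_simp
        ring
      rw [this, inv_inv]
  refine ⟨θ, c, h2π, hper, hrange, ?_, ?_, ?_, ?_, ?_⟩
  · intro v hv α β hα hβ
    obtain ⟨α', β', hle, hπ, hn, hcc⟩ := exists_ordered_representatives hθ hτadd hper α β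
    rw [← hn]
    have hval : lorentz (c α) (c β) = lorentz (c α') (c β') := by
      rcases hcc with ⟨h1, h2⟩ | ⟨h1, h2⟩ <;> rw [h1, h2]
      exact lorentz_comm _ _
    have h1 : lorentz (c α') v = 0 := by rcases hcc with ⟨h1, h2⟩ | ⟨h1, h2⟩ <;> rw [h1] <;> assumption
    have h2 : lorentz (c β') v = 0 := by rcases hcc with ⟨h1, h2⟩ | ⟨h1, h2⟩ <;> rw [h2] <;> assumption
    rw [hval]
    have hc1 := (hzero v hv _).1 h1
    have hc2 := (hzero v hv _).1 h2
    have hτle := hτmono.monotone hle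
    have key : β' - α' ≤ Real.pi ∧ lorentz (c α') (c β') = Real.cos (β' - α') := by
      -- At exactly opposite directions interval convexity of the cell fails, but a cell containing
      -- both has zero width there, so its ends are antipodal at length `π`. Otherwise the two
      -- points lie on one arc.
      rcases hπ.eq_or_lt with h | h
      · have hs : support W hW (τ α' + Real.pi) = -support W hW (τ α') := by
          rw [← h, support_eq_of_mem_cell hW (hVW v hv) hc2,
            support_eq_of_mem_cell hW (hVW v hv) hc1, h, height_add_pi]
        have hl := linkLength_half hW hD hs
        rw [← h, hτ, hτ] at hl
        refine ⟨hl.le, ?_⟩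
        rw [hl, Real.cos_pi]
        simp only [hc]
        rw [h, LinkFrame.linkPt_add_pi hs, lorentz_neg_right]
        have := hB.self α'
        simp only [hc] at this
        rw [this]
      · have hsub : Set.uIcc (τ α') (τ β') ⊆ cell W (toPlane o e₁ e₂ v) := by
          rw [Set.uIcc_of_le hτle]
          exact Icc_subset_cell h hc1 hc2
        have hr := LinkFrame.linkPt_rotate (hW := hW) (o := o) (e₁ := e₁) (e₂ := e₂) hD (hVW v hv)
          hsub
        have hl := linkLength_sub_of_cell hD (hVW v hv) hsub
        rw [hτ, hτ] at hl hr
        have hle2 := integral_angSpeed_le_pi (hD _ (hVW v hv)) (φ := τ α') (x := τ β' - τ α')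
          (by linarith) (by linarith)
        rw [add_sub_cancel] at hle2
        refine ⟨by rw [hl]; exact hle2, ?_⟩
        have hs := hB.self α'
        simp only [hc] at hs ⊢
        rw [hr, lorentz_add_right, lorentz_smul_right, lorentz_smul_right, hs,
          LinkFrame.linkPt_eq (hVW v hv) hc1, F.unitVec_dirVec]
        ring
    have habs : |α' - β'| = β' - α' := by rw [abs_sub_comm, abs_of_nonneg (by linarith)]
    have hnorm : ‖((α' - β' : ℝ) : AddCircle θ)‖ = β' - α' := by
      rw [← habs, AddCircle.norm_coe_eq_abs_iff θ hθ.ne', habs, abs_of_pos hθ]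
      linarith [key.1]
    rw [hnorm]
    exact key
  · intro α β hπ
    obtain ⟨α', β', hle, hτπ, hn, hcc⟩ := exists_ordered_representatives hθ hτadd hper α β
    have hval : c α + c β = c α' + c β' := by
      rcases hcc with ⟨h1, h2⟩ | ⟨h1, h2⟩ <;> rw [h1, h2]
      exact add_comm _ _
    rw [hval]
    have hlen : Real.pi ≤ β' - α' := by
      rw [← hn] at hπ
      refine hπ.trans ((norm_coe_addCircle_le _ _).trans ?_)
      rw [abs_sub_comm, abs_of_nonneg (by linarith)]
    by_contra! hcon
    obtain ⟨h0, hF⟩ := hcon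
    have hτlt : τ α' < τ β' := hτmono (by linarith [Real.pi_pos])
    obtain ⟨-, -, hα1, v, hv, hα2⟩ := (hrange (c α')).1 ⟨α', rfl⟩
    obtain ⟨-, -, hβ1, v', hv', hβ2⟩ := (hrange (c β')).1 ⟨β', rfl⟩
    -- For opposite directions a causal separator would have height at least the support at both,
    -- which forces zero width and hence antipodal points, contrary to `h0`.
    have hπne : τ β' < τ α' + Real.pi := by
      refine lt_of_le_of_ne hτπ fun h => ?_
      by_cases hs : support W hW (τ α' + Real.pi) = -support W hW (τ α')
      · apply h0
        simp only [hc, h, LinkFrame.linkPt_add_pi hs, add_neg_cancel]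
      · by_cases hne : c α' = c β'
        · have e1 := congrArg (fun x => lorentz x e₁) hne
          have e2 := congrArg (fun x => lorentz x e₂) hne
          simp only [hc, linkPt, F.lorentz_unitVec_e₁, F.lorentz_unitVec_e₂, h, Real.cos_add_pi,
            Real.sin_add_pi] at e1 e2
          have p1 : 0 < (Real.sqrt (1 - support W hW (τ α') ^ 2))⁻¹ :=
            inv_pos.2 (Real.sqrt_pos.2 (LinkFrame.one_sub_support_sq_pos hD _))
          have p2 : 0 < (Real.sqrt (1 - support W hW (τ α' + Real.pi) ^ 2))⁻¹ :=
            inv_pos.2 (Real.sqrt_pos.2 (LinkFrame.one_sub_support_sq_pos hD _))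
          generalize (Real.sqrt (1 - support W hW (τ α') ^ 2))⁻¹ = r at *
          generalize (Real.sqrt (1 - support W hW (τ α' + Real.pi) ^ 2))⁻¹ = r' at *
          have : r + r' = 0 := by
            linear_combination Real.cos (τ α') * e1 + Real.sin (τ α') * e2 -
              (r + r') * Real.sin_sq_add_cos_sq (τ α')
          linarith
        · obtain ⟨y, hy, hy1, hy2⟩ := exists_causal_of_not_bend F.o_mem (hB.self α') (hB.self β')
            (FutureTimelike.of_mem (hVq v hv).1) (FutureTimelike.of_mem (hVq v' hv').1) hα2
            (hα1 v' hv') hβ2 (hβ1 v hv) hne h0 hF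
          have s1 := (F.lorentz_linkPt_nonneg_iff (hW := hW) hD hy (τ α')).1 hy2
          have s2 := (F.lorentz_linkPt_nonneg_iff (hW := hW) hD hy (τ β')).1 (hy1 ▸ hy2)
          rw [h, height_add_pi] at s2
          obtain ⟨w, hw⟩ := hW
          have t1 := height_le_support ⟨w, hw⟩ hw (τ α')
          have t2 := height_le_support ⟨w, hw⟩ hw (τ α' + Real.pi)
          rw [height_add_pi] at t2
          exact hs (by linarith)
    have hne : c α' ≠ c β' := by
      intro hne
      have e1 := congrArg (fun x => lorentz x e₁) hne
      have e2 := congrArg (fun x => lorentz x e₂) hne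
      simp only [hc, linkPt, F.lorentz_unitVec_e₁, F.lorentz_unitVec_e₂] at e1 e2
      have p1 : 0 < (Real.sqrt (1 - support W hW (τ α') ^ 2))⁻¹ :=
        inv_pos.2 (Real.sqrt_pos.2 (LinkFrame.one_sub_support_sq_pos hD _))
      have hsin : 0 < Real.sin (τ β' - τ α') :=
        Real.sin_pos_of_pos_of_lt_pi (by linarith) (by linarith)
      rw [Real.sin_sub] at hsin
      have p2 : 0 < (Real.sqrt (1 - support W hW (τ β') ^ 2))⁻¹ :=
        inv_pos.2 (Real.sqrt_pos.2 (LinkFrame.one_sub_support_sq_pos hD _))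
      generalize (Real.sqrt (1 - support W hW (τ α') ^ 2))⁻¹ = r at *
      generalize (Real.sqrt (1 - support W hW (τ β') ^ 2))⁻¹ = r' at *
      have : r * (Real.sin (τ β') * Real.cos (τ α') - Real.cos (τ β') * Real.sin (τ α')) = 0 := by
        linear_combination Real.sin (τ β') * e1 - Real.cos (τ β') * e2
      exact (mul_pos p1 hsin).ne' this
    obtain ⟨y, hy, hy1, hy2⟩ := exists_causal_of_not_bend F.o_mem (hB.self α') (hB.self β')
      (FutureTimelike.of_mem (hVq v hv).1) (FutureTimelike.of_mem (hVq v' hv').1) hα2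
      (hα1 v' hv') hβ2 (hβ1 v hv) hne h0 hF
    have s1 := (F.lorentz_linkPt_nonneg_iff (hW := hW) hD hy (τ α')).1 hy2
    have s2 := (F.lorentz_linkPt_nonneg_iff (hW := hW) hD hy (τ β')).1 (hy1 ▸ hy2)
    -- The separator dominates the support at both ends, hence on the whole angular interval, which
    -- contains the point reached after length `π`.
    have hmid : 0 ≤ lorentz (c (α' + Real.pi)) y := by
      refine (F.lorentz_linkPt_nonneg_iff (hW := hW) hD hy _).2 (Finset.sup'_le _ _ fun w hw => ?_)
      exact height_le_between (φ := τ α') (ψ := τ β') (hτmono.monotone (by linarith [Real.pi_pos]))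
        (hτmono.monotone (by linarith)) hπne ((height_le_support hW hw _).trans s1)
        ((height_le_support hW hw _).trans s2)
    -- Any bend would make the pairing at `α' + π` less than minus the nonnegative pairing at `α'`,
    -- contradicting `hmid`.
    have hstraight : ∀ x ∈ Set.Ioo 0 Real.pi, u (α' + x) + w (α' + x) = 0 := by
      intro x hx
      refine (hB.bend (α' + x)).resolve_right fun hb => ?_
      have := hB.sturm_strict (y := y) (t := α') le_rfl
        (fun x _ => hB.bend_lorentz_nonpos _ hy) hx (lorentz_neg_of_futureTimelike hb hy)
      rw [Real.cos_pi, Real.sin_pi] at this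
      linarith
    have hanti : c (α' + Real.pi) = -c α' := by
      rw [hB.eq_arc Real.pi_pos.le le_rfl hstraight]; simp
    -- Antipodal points have directions differing by `π` modulo `2π`, but here the difference lies
    -- strictly between `0` and `π`.
    obtain ⟨k, hk⟩ := (F.antipodal hD hanti).2
    have k1 : τ α' < τ (α' + Real.pi) := hτmono (by linarith [Real.pi_pos])
    have k2 : τ (α' + Real.pi) ≤ τ β' := hτmono.monotone (by linarith)
    have k3 : (k : ℝ) < 0 := by
      by_contra! h
      have := mul_nonneg (mul_nonneg zero_le_two Real.pi_pos.le) h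
      linarith
    have k4 : (-1 : ℝ) < k := by
      by_contra! h
      have := mul_le_mul_of_nonneg_left h (mul_nonneg zero_le_two Real.pi_pos.le)
      linarith
    have k5 : k < 0 := by exact_mod_cast k3
    have k6 : -1 < k := by exact_mod_cast k4
    omega
  · rcases hdich with h | ⟨h, h'⟩
    · exact Or.inl h
    · refine Or.inr ⟨h, fun x hx hx' => ?_⟩
      obtain ⟨α, rfl⟩ := (hrange x).2 hx
      obtain ⟨β, hβ⟩ := (hrange _).2 hx'
      exact h' _ (F.antipodal hD hβ).1
  · intro α
    obtain ⟨w, hw, δ, hδ, h⟩ := exists_cell_right hW (τ α)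
    obtain ⟨v, hv, rfl⟩ := Finset.mem_image.1 hw
    have hlt := hmono (show τ α < τ α + δ by linarith)
    rw [hτ] at hlt
    refine ⟨linkLength W (τ α + δ) - α, by linarith, v, hv, fun β hβ => ?_⟩
    refine (hzero v hv _).2 (h ⟨hτmono.monotone hβ.1, ?_⟩)
    rw [← hτl (τ α + δ)]
    exact hτmono.monotone (by linarith [hβ.2])
  · intro α
    obtain ⟨w, hw, δ, hδ, h⟩ := exists_cell_left hW (τ α)
    obtain ⟨v, hv, rfl⟩ := Finset.mem_image.1 hw
    have hlt := hmono (show τ α - δ < τ α by linarith)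
    rw [hτ] at hlt
    refine ⟨α - linkLength W (τ α - δ), by linarith, v, hv, fun β hβ => ?_⟩
    refine (hzero v hv _).2 (h ⟨?_, hτmono.monotone hβ.2⟩)
    rw [← hτl (τ α - δ)]
    exact hτmono.monotone (by linarith [hβ.1])

/-! ### Polar surfaces of finite vertex sets and local comparison with cones -/

section

/-- A finite set of points of `H³` in convex position that spans Minkowski space. -/
structure IsVertexSet (V : Finset Minkowski) : Prop where
  mem : ∀ v ∈ V, v ∈ hyperbolicSpace
  nondegenerate : ∀ n, (∀ v ∈ V, lorentz n v = 0) → n = 0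
  strict : ∀ v ∈ V, ∃ n, lorentz n n = 1 ∧ lorentz n v = 0 ∧ ∀ w ∈ V, w ≠ v → lorentz n w < 0

/-- The outward unit normals of the planes supporting `V`. -/
def polarSurface (V : Finset Minkowski) : Set Minkowski :=
  {n | lorentz n n = 1 ∧ (∀ v ∈ V, lorentz n v ≤ 0) ∧ ∃ v ∈ V, lorentz n v = 0}

/-- A step inside one cell of the polar surface of `V`. -/
def cellStep (V : Finset Minkowski) {Q : Type*} (ι : Q → Minkowski) (x y : Q) (ℓ : ℝ) : Prop :=
  ∃ v ∈ V, lorentz (ι x) v = 0 ∧ lorentz (ι y) v = 0 ∧ ℓ = Real.arccos (lorentz (ι x) (ι y))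

/-- `Q` is identified with the polar surface of `V` through `ι`. -/
structure IsPolarModel (V : Finset Minkowski) {Q : Type*} (ι : Q → Minkowski) : Prop where
  injective : Function.Injective ι
  range : Set.range ι = polarSurface V

/-- `Q` is the polar surface of `V` with its intrinsic metric. -/
structure IsPolarSpace (V : Finset Minkowski) (Q : Type*) [MetricSpace Q] (ι : Q → Minkowski) :
    Prop extends IsPolarModel V ι where
  dist : ∀ x y, IsGLB {L : ℝ | PathLength (cellStep V ι) x y L} (dist x y)

/-- A bound for the time coordinates of the points of `V`. -/
noncomputable def timeBound (V : Finset Minkowski) : ℝ := 1 + ∑ v ∈ V, |v 0|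

theorem timeBound_pos (V : Finset Minkowski) : 0 < timeBound V := by
  have : 0 ≤ ∑ v ∈ V, |v 0| := Finset.sum_nonneg fun _ _ => abs_nonneg _
  rw [timeBound]; linarith

theorem le_timeBound {V : Finset Minkowski} {v : Minkowski} (hv : v ∈ V) : v 0 ≤ timeBound V := by
  have := Finset.single_le_sum (f := fun v : Minkowski => |v 0|) (fun _ _ => abs_nonneg _) hv
  have h := le_abs_self (v 0)
  rw [timeBound]; linarith

namespace PathLength

variable {X : Type*} {step : X → X → ℝ → Prop} {x y z : X} {L M : ℝ}

theorem single {ℓ : ℝ} (h : step x y ℓ) : PathLength step x y ℓ := by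
  simpa using PathLength.cons h (PathLength.refl y)

theorem trans (h : PathLength step x y L) (h' : PathLength step y z M) :
    PathLength step x z (L + M) := by
  induction h with
  | refl => simpa using h'
  | cons hs _ ih => rw [add_assoc]; exact .cons hs (ih h')

theorem symm (hs : ∀ a b ℓ, step a b ℓ → step b a ℓ) (h : PathLength step x y L) :
    PathLength step y x L := by
  induction h with
  | refl => exact .refl _
  | cons h1 _ ih => rw [add_comm]; exact ih.trans (single (hs _ _ _ h1))

theorem nonneg (hs : ∀ a b ℓ, step a b ℓ → 0 ≤ ℓ) (h : PathLength step x y L) : 0 ≤ L := by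
  induction h with
  | refl => exact le_rfl
  | cons h1 _ ih => exact add_nonneg (hs _ _ _ h1) ih

end PathLength

variable {V : Finset Minkowski} {Q : Type*} {ι : Q → Minkowski}

theorem cellStep_symm (x y : Q) (ℓ : ℝ) (h : cellStep V ι x y ℓ) : cellStep V ι y x ℓ := by
  obtain ⟨v, hv, hx, hy, rfl⟩ := h
  exact ⟨v, hv, hy, hx, by rw [lorentz_comm]⟩

theorem cellStep_nonneg (x y : Q) (ℓ : ℝ) (h : cellStep V ι x y ℓ) : 0 ≤ ℓ := by
  obtain ⟨v, hv, hx, hy, rfl⟩ := h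
  exact Real.arccos_nonneg _

theorem IsVertexSet.neg_notMem (hV : IsVertexSet V) {n : Minkowski} (h : n ∈ polarSurface V) :
    -n ∉ polarSurface V := by
  intro h'
  have : n = 0 := hV.nondegenerate n fun v hv => by
    have h1 := h.2.1 v hv
    have h2 := h'.2.1 v hv
    rw [lorentz_neg_left] at h2
    linarith
  have h1 := h.1
  simp [this] at h1

namespace IsPolarModel

variable (hι : IsPolarModel V ι)
include hι

theorem mem (x : Q) : ι x ∈ polarSurface V := hι.range ▸ Set.mem_range_self x

theorem exists_eq {n : Minkowski} (h : n ∈ polarSurface V) : ∃ x, ι x = n := by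
  rwa [← hι.range] at h

theorem norm_sub_le_of_step (hV : IsVertexSet V) {x y : Q} {ℓ : ℝ} (h : cellStep V ι x y ℓ) :
    ‖ι x - ι y‖ ≤ timeBound V * ℓ := by
  obtain ⟨v, hv, hx, hy, rfl⟩ := h
  exact (norm_sub_le_arccos (hV.mem v hv) hx hy (hι.mem x).1 (hι.mem y).1).trans
    (mul_le_mul_of_nonneg_right (le_timeBound hv) (Real.arccos_nonneg _))

/-- Chords are shorter than arcs, summed along the path. This confines short paths to a star and
later separates points in the intrinsic metric. -/
theorem norm_sub_le (hV : IsVertexSet V) {x y : Q} {L : ℝ}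
    (h : PathLength (cellStep V ι) x y L) : ‖ι x - ι y‖ ≤ timeBound V * L := by
  induction h with
  | refl => simp
  | cons h1 _ ih =>
    rw [mul_add]
    exact (norm_sub_le_norm_sub_add_norm_sub _ _ _).trans
      (add_le_add (hι.norm_sub_le_of_step hV h1) ih)

end IsPolarModel

/-- Near `q`, only the vertices orthogonal to `q` matter. -/
theorem exists_star_radius {q : Minkowski} (hq : q ∈ polarSurface V) :
    ∃ ρ > 0, ∀ x : Minkowski, ‖x - q‖ < ρ → ∀ v ∈ V, lorentz q v ≠ 0 → lorentz x v < 0 := by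
  have h : ∀ᶠ x in nhds q, ∀ v ∈ V, lorentz q v ≠ 0 → lorentz x v < 0 := by
    rw [Filter.eventually_all_finset]
    intro v hv
    by_cases h0 : lorentz q v = 0
    · exact Filter.Eventually.of_forall fun x h => absurd h0 h
    · have hc : Continuous fun x => lorentz x v := by fun_prop
      exact (hc.continuousAt.eventually_lt continuousAt_const
        (lt_of_le_of_ne (hq.2.1 v hv) h0)).mono fun x hx _ => hx
  obtain ⟨ρ, hρ, h⟩ := Metric.eventually_nhds_iff.1 h
  exact ⟨ρ, hρ, fun x hx => h (by rwa [dist_eq_norm])⟩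

/-- The vertices orthogonal to `q`. -/
noncomputable def faceVertices (V : Finset Minkowski) (q : Minkowski) : Finset Minkowski :=
  V.filter fun v => lorentz q v = 0

theorem mem_faceVertices {q v : Minkowski} : v ∈ faceVertices V q ↔ v ∈ V ∧ lorentz q v = 0 := by
  simp [faceVertices]

theorem exists_linkCurve_faceVertices (hV : IsVertexSet V) {q : Minkowski}
    (hq : q ∈ polarSurface V) : ∃ θ c, IsLinkCurve q (faceVertices V q) θ c := by
  obtain ⟨v, hv, h0⟩ := hq.2.2
  refine exists_linkCurve hq.1 ⟨v, mem_faceVertices.2 ⟨hv, h0⟩⟩ fun v hv => ?_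
  rw [mem_faceVertices] at hv
  exact ⟨hV.mem v hv.1, by rw [lorentz_comm]; exact hv.2⟩

namespace IsLinkCurve

variable {q : Minkowski} {U : Finset Minkowski} {θ : ℝ} {c : ℝ → Minkowski}
  (hc : IsLinkCurve q U θ c)
include hc

theorem mem (α : ℝ) : c α ∈ linkSet q U := (hc.mem_range _).1 ⟨α, rfl⟩

theorem pos : 0 < θ := by linarith [hc.two_pi_le, Real.pi_pos]

theorem lorentz_polar (hq : lorentz q q = 1) (r s α β : ℝ) :
    lorentz (Real.cos r • q + Real.sin r • c α) (Real.cos s • q + Real.sin s • c β) =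
      Real.cos r * Real.cos s + Real.sin r * Real.sin s * lorentz (c α) (c β) := by
  simp only [lorentz_add_left, lorentz_add_right, lorentz_smul_left, lorentz_smul_right, hq,
    lorentz_comm q (c β), (hc.mem _).2.1]
  ring

/-- The spherical distance inside one cell is the distance in the cone. -/
theorem arccos_eq_coneDist (hq : lorentz q q = 1) {v : Minkowski} (hv : v ∈ U)
    (hqv : lorentz q v = 0) {r s α β : ℝ}
    (hx : lorentz (Real.cos r • q + Real.sin r • c α) v = 0)
    (hy : lorentz (Real.cos s • q + Real.sin s • c β) v = 0) :
    Real.arccos (lorentz (Real.cos r • q + Real.sin r • c α) (Real.cos s • q + Real.sin s • c β)) =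
      coneDist r s ‖((α - β : ℝ) : AddCircle θ)‖ := by
  rw [hc.lorentz_polar hq, coneDist]
  simp only [lorentz_add_left, lorentz_smul_left, hqv, mul_zero, zero_add, mul_eq_zero] at hx hy
  rcases hx with hx | hx
  · simp [hx]
  rcases hy with hy | hy
  · simp [hy]
  obtain ⟨h1, h2⟩ := hc.cell v hv α β hx hy
  rw [h2, min_eq_left h1]

end IsLinkCurve

theorem exists_norm_coe_eq_abs (θ x : ℝ) : ∃ k : ℤ, ‖(x : AddCircle θ)‖ = |x - k * θ| :=
  ⟨_, AddCircle.norm_eq _⟩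

section Chart

variable {q : Q} {θ ρ : ℝ} {c : ℝ → Minkowski}

theorem IsPolarModel.norm_sub_center_le (hV : IsVertexSet V) (hι : IsPolarModel V ι)
    (hc : IsLinkCurve (ι q) (faceVertices V (ι q)) θ c) {r : ℝ} (hr : r ∈ Set.Icc 0 Real.pi)
    (α : ℝ) :
    ‖Real.cos r • ι q + Real.sin r • c α - ι q‖ ≤ timeBound V * r := by
  obtain ⟨v, hv, h0⟩ := (hc.mem α).2.2.2
  obtain ⟨hvV, hqv⟩ := mem_faceVertices.1 hv
  have h1 := norm_sub_le_arccos (hV.mem v hvV) (x := Real.cos r • ι q + Real.sin r • c α)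
    (y := ι q) (by simp [hqv, h0]) hqv
    (by rw [hc.lorentz_polar (hι.mem q).1, (hc.mem α).1]
        linear_combination Real.sin_sq_add_cos_sq r) (hι.mem q).1
  have h2 : lorentz (Real.cos r • ι q + Real.sin r • c α) (ι q) = Real.cos r := by
    simp [(hι.mem q).1, (hc.mem α).2.1]
  rw [h2, Real.arccos_cos hr.1 hr.2] at h1
  exact h1.trans (mul_le_mul_of_nonneg_right (le_timeBound hvV) hr.1)

/-- Near `q` the vertices not orthogonal to `q` impose no active constraint, and the remaining ones
constrain only the link direction. -/
theorem IsPolarModel.exists_of_polar (hV : IsVertexSet V) (hι : IsPolarModel V ι)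
    (hc : IsLinkCurve (ι q) (faceVertices V (ι q)) θ c)
    (hρ : ∀ x : Minkowski, ‖x - ι q‖ < ρ → ∀ v ∈ V, lorentz (ι q) v ≠ 0 → lorentz x v < 0)
    {r : ℝ} (hr : r ∈ Set.Icc 0 Real.pi) (hrρ : timeBound V * r < ρ) (α : ℝ) :
    ∃ x, ι x = Real.cos r • ι q + Real.sin r • c α := by
  apply hι.exists_eq
  have hs := Real.sin_nonneg_of_mem_Icc hr
  refine ⟨?_, fun v hv => ?_, ?_⟩
  · rw [hc.lorentz_polar (hι.mem q).1, (hc.mem α).1]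
    linear_combination Real.sin_sq_add_cos_sq r
  · by_cases h0 : lorentz (ι q) v = 0
    · simp only [lorentz_add_left, lorentz_smul_left, h0, mul_zero, zero_add]
      exact mul_nonpos_of_nonneg_of_nonpos hs
        ((hc.mem α).2.2.1 v (mem_faceVertices.2 ⟨hv, h0⟩))
    · exact (hρ _ ((hι.norm_sub_center_le hV hc hr α).trans_lt hrρ) v hv h0).le
  · obtain ⟨v, hv, h0⟩ := (hc.mem α).2.2.2
    obtain ⟨hvV, hqv⟩ := mem_faceVertices.1 hv
    exact ⟨v, hvV, by simp [hqv, h0]⟩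

theorem IsPolarModel.exists_polar (hV : IsVertexSet V) (hι : IsPolarModel V ι)
    (hc : IsLinkCurve (ι q) (faceVertices V (ι q)) θ c)
    (hρ : ∀ x : Minkowski, ‖x - ι q‖ < ρ → ∀ v ∈ V, lorentz (ι q) v ≠ 0 → lorentz x v < 0)
    {x : Q} (hx : ‖ι x - ι q‖ < ρ) :
    ∃ r ∈ Set.Ico 0 Real.pi, ∃ α, ι x = Real.cos r • ι q + Real.sin r • c α := by
  obtain ⟨hq1, hqV, -⟩ := hι.mem q
  obtain ⟨hx1, hxV, v, hv, hxv⟩ := hι.mem x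
  have hqv : lorentz (ι q) v = 0 := by
    by_contra h0
    exact (hρ _ hx v hv h0).ne hxv
  have habs := abs_le.1 (abs_lorentz_le_one (hV.mem v hv) hxv hqv hx1 hq1)
  set r := Real.arccos (lorentz (ι x) (ι q)) with hr
  have hcos : Real.cos r = lorentz (ι x) (ι q) := Real.cos_arccos habs.1 habs.2
  have hsum : Real.cos r ^ 2 + Real.sin r ^ 2 = 1 := by
    rw [add_comm]; exact Real.sin_sq_add_cos_sq r
  set z := ι x - Real.cos r • ι q with hz
  have hzz : lorentz z z = Real.sin r ^ 2 := by
    simp only [hz, lorentz_sub_left, lorentz_sub_right, lorentz_smul_left, lorentz_smul_right, hx1,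
      hq1, lorentz_comm (ι q) (ι x), ← hcos]
    linarith
  have hzv : lorentz z v = 0 := by simp [hz, hxv, hqv]
  have hxz : ι x = Real.cos r • ι q + z := by rw [hz]; abel
  have hr0 : 0 ≤ r := Real.arccos_nonneg _
  -- At distance `π` the point would be the antipode of `q`, which is not in the polar surface.
  have hrπ : r < Real.pi := by
    refine lt_of_le_of_ne (Real.arccos_le_pi _) fun h => ?_
    have hz0 : z = 0 := by
      by_contra h0
      have := lorentz_self_pos (hV.mem v hv) hzv h0
      rw [hzz, h, Real.sin_pi] at this
      norm_num at this
    rw [hz0, h, Real.cos_pi, add_zero, neg_one_smul] at hxz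
    exact hV.neg_notMem (hι.mem q) (hxz ▸ hι.mem x)
  refine ⟨r, ⟨hr0, hrπ⟩, ?_⟩
  rcases hr0.eq_or_lt with h0 | h0
  · refine ⟨0, ?_⟩
    have hz0 : z = 0 := by
      by_contra h
      have := lorentz_self_pos (hV.mem v hv) hzv h
      rw [hzz, ← h0, Real.sin_zero] at this
      norm_num at this
    rw [hxz, hz0, ← h0]
    simp
  · have hs : 0 < Real.sin r := Real.sin_pos_of_pos_of_lt_pi h0 hrπ
    obtain ⟨α, hα⟩ : ∃ α, c α = (Real.sin r)⁻¹ • z := by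
      rw [hc.mem_range]
      refine ⟨?_, ?_, fun w hw => ?_, v, mem_faceVertices.2 ⟨hv, hqv⟩, by simp [hzv]⟩
      · simp only [lorentz_smul_left, lorentz_smul_right, hzz]
        field_simp
      · simp only [lorentz_smul_left, hz, lorentz_sub_left, hq1, ← hcos]
        ring
      · obtain ⟨hwV, hqw⟩ := mem_faceVertices.1 hw
        simp only [lorentz_smul_left, hz, lorentz_sub_left, hqw, mul_zero, sub_zero]
        exact mul_nonpos_of_nonneg_of_nonpos (inv_pos.2 hs).le (hxV w hwV)
    refine ⟨α, ?_⟩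
    rw [hα, smul_inv_smul₀ hs.ne']
    exact hxz

/-- Short paths near `q` are at least as long as in the cone. -/
theorem IsPolarModel.coneDist_le (hV : IsVertexSet V) (hι : IsPolarModel V ι)
    (hc : IsLinkCurve (ι q) (faceVertices V (ι q)) θ c)
    (hρ : ∀ x : Minkowski, ‖x - ι q‖ < ρ → ∀ v ∈ V, lorentz (ι q) v ≠ 0 → lorentz x v < 0)
    {x y : Q} {L : ℝ} (h : PathLength (cellStep V ι) x y L)
    (hL : ‖ι x - ι q‖ + timeBound V * L < ρ) {r s α β : ℝ} (hr : r ∈ Set.Ico 0 Real.pi)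
    (hs : s ∈ Set.Ico 0 Real.pi) (hx : ι x = Real.cos r • ι q + Real.sin r • c α)
    (hy : ι y = Real.cos s • ι q + Real.sin s • c β) :
    coneDist r s ‖((α - β : ℝ) : AddCircle θ)‖ ≤ L := by
  have hface : ∀ {x : Q}, ‖ι x - ι q‖ < ρ → ∀ v ∈ V, lorentz (ι x) v = 0 →
      lorentz (ι q) v = 0 := fun hx v hv h0 => by
    by_contra h1
    exact (hρ _ hx v hv h1).ne h0
  have hstep : ∀ {x y : Q} {r s α β : ℝ}, ‖ι x - ι q‖ < ρ →
      ι x = Real.cos r • ι q + Real.sin r • c α → ι y = Real.cos s • ι q + Real.sin s • c β →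
      ∀ v ∈ V, lorentz (ι x) v = 0 → lorentz (ι y) v = 0 →
      coneDist r s ‖((α - β : ℝ) : AddCircle θ)‖ = Real.arccos (lorentz (ι x) (ι y)) := by
    intro x y r s α β hxρ hx hy v hv h1 h2
    have hqv := hface hxρ v hv h1
    rw [hx] at h1
    rw [hy] at h2
    rw [hx, hy, hc.arccos_eq_coneDist (hι.mem q).1 (mem_faceVertices.2 ⟨hv, hqv⟩) hqv h1 h2]
  have hn : ∀ {a b : Q} {M : ℝ}, PathLength (cellStep V ι) a b M → 0 ≤ timeBound V * M :=
    fun h => mul_nonneg (timeBound_pos V).le (h.nonneg cellStep_nonneg)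
  -- The bound `hL` keeps every point of the path in the star, where it has polar coordinates; steps
  -- are exact in the cone and add up by its triangle inequality.
  induction h generalizing r α with
  | refl x =>
    obtain ⟨v, hv, h0⟩ := (hι.mem x).2.2
    rw [hstep (by linarith) hx hy v hv h0 h0, (hι.mem x).1, Real.arccos_one]
  | @cons x y z ℓ L h1 h2 ih =>
    have hℓ : 0 ≤ timeBound V * ℓ := mul_nonneg (timeBound_pos V).le (cellStep_nonneg _ _ _ h1)
    have hxy : ‖ι y - ι q‖ ≤ ‖ι x - ι q‖ + timeBound V * ℓ := by
      have := norm_sub_le_norm_sub_add_norm_sub (ι y) (ι x) (ι q)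
      rw [norm_sub_rev (ι y) (ι x)] at this
      linarith [hι.norm_sub_le_of_step hV h1]
    rw [mul_add] at hL
    obtain ⟨t, ht, γ, hyt⟩ := hι.exists_polar hV hc hρ (x := y) (by linarith [hn h2])
    have h3 := ih (by linarith) ht hyt hy
    obtain ⟨v, hv, hxv, hyv, rfl⟩ := h1
    have h4 := hstep (by linarith [hn h2]) hx hyt v hv hxv hyv
    rw [← h4]
    refine (coneDist_triangle ⟨hr.1, hr.2.le⟩ ⟨ht.1, ht.2.le⟩ ⟨hs.1, hs.2.le⟩ (norm_nonneg _)
      (norm_nonneg _) (norm_nonneg _) ?_).trans (add_le_add_right h3 _)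
    rw [show (α - β : ℝ) = (α - γ) + (γ - β) by ring, AddCircle.coe_add]
    exact norm_add_le _ _

end Chart

end

/-! ### Polar charts -/

section

variable {V : Finset Minkowski} {Q : Type*} [MetricSpace Q] {ι : Q → Minkowski}

/-- Polar coordinates around `q`: the ball of radius `ε` is the ball in the cone over the circle of
length `θ`, through `(r, α) ↦ cos r • q + sin r • c α`. -/
structure IsPolarChart (V : Finset Minkowski) (ι : Q → Minkowski) (q : Q) (θ ε : ℝ)
    (c : ℝ → Minkowski) : Prop where
  link : IsLinkCurve (ι q) (faceVertices V (ι q)) θ c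
  pos : 0 < ε
  le : ε ≤ Real.pi / 2
  exists_point : ∀ r ∈ Set.Ico 0 ε, ∀ α, ∃ x, ι x = Real.cos r • ι q + Real.sin r • c α
  mem_ball : ∀ x, dist x q < ε →
    ∃ r ∈ Set.Ico 0 ε, ∃ α, ι x = Real.cos r • ι q + Real.sin r • c α
  dist : ∀ x y r s α β, r ∈ Set.Ico 0 ε → s ∈ Set.Ico 0 ε →
    ι x = Real.cos r • ι q + Real.sin r • c α → ι y = Real.cos s • ι q + Real.sin s • c β →
    dist x y = coneDist r s ‖((α - β : ℝ) : AddCircle θ)‖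

namespace IsPolarSpace

variable (hV : IsVertexSet V) (hQ : IsPolarSpace V Q ι)
include hQ

theorem dist_le_of_path {x y : Q} {L : ℝ} (h : PathLength (cellStep V ι) x y L) :
    Dist.dist x y ≤ L :=
  (hQ.dist x y).1 h

theorem dist_le_arccos {x y : Q} {v : Minkowski} (hv : v ∈ V) (hx : lorentz (ι x) v = 0)
    (hy : lorentz (ι y) v = 0) : Dist.dist x y ≤ Real.arccos (lorentz (ι x) (ι y)) :=
  hQ.dist_le_of_path (.single ⟨v, hv, hx, hy, rfl⟩)

theorem exists_path_lt {x y : Q} {M : ℝ} (h : Dist.dist x y < M) :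
    ∃ L < M, PathLength (cellStep V ι) x y L := by
  obtain ⟨L, hL, -, hLM⟩ := (hQ.dist x y).exists_between h
  exact ⟨L, hLM, hL⟩

/-- Inside a quarter sphere around `q`, distances are at most those of the cone. -/
theorem dist_le_coneDist {q : Q} {θ ε : ℝ} {c : ℝ → Minkowski}
    (hc : IsLinkCurve (ι q) (faceVertices V (ι q)) θ c) (hε : ε ≤ Real.pi / 2)
    (hp : ∀ r ∈ Set.Ico 0 ε, ∀ α, ∃ x, ι x = Real.cos r • ι q + Real.sin r • c α) {x y : Q}
    {r s α β : ℝ} (hr : r ∈ Set.Ico 0 ε) (hs : s ∈ Set.Ico 0 ε)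
    (hx : ι x = Real.cos r • ι q + Real.sin r • c α)
    (hy : ι y = Real.cos s • ι q + Real.sin s • c β) :
    Dist.dist x y ≤ coneDist r s ‖((α - β : ℝ) : AddCircle θ)‖ := by
  have hπ := Real.pi_pos
  have hq := (hQ.mem q).1
  -- two points in one cell
  have hcell : ∀ v ∈ faceVertices V (ι q), ∀ {x y : Q} {r s α β : ℝ}, r ∈ Set.Ico 0 ε →
      s ∈ Set.Ico 0 ε → ι x = Real.cos r • ι q + Real.sin r • c α →
      ι y = Real.cos s • ι q + Real.sin s • c β → lorentz (c α) v = 0 → lorentz (c β) v = 0 →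
      α ≤ β → Dist.dist x y ≤ coneDist r s (β - α) := by
    intro v hv x y r s α β hr hs hx hy hα hβ hαβ
    obtain ⟨hvV, hqv⟩ := mem_faceVertices.1 hv
    have h1 : lorentz (ι x) v = 0 := by rw [hx]; simp [hα, hqv]
    have h2 : lorentz (ι y) v = 0 := by rw [hy]; simp [hβ, hqv]
    have h3 := hQ.dist_le_arccos hvV h1 h2
    rw [hx] at h1
    rw [hy] at h2
    rw [hx, hy, hc.arccos_eq_coneDist hq hv hqv h1 h2] at h3
    refine h3.trans (coneDist_mono ⟨hr.1, by linarith [hr.2]⟩ ⟨hs.1, by linarith [hs.2]⟩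
      (norm_nonneg _) ((norm_coe_addCircle_le _ _).trans ?_))
    rw [abs_sub_comm, abs_of_nonneg (by linarith)]
  -- the radial bound
  have hrad : ∀ {x : Q} {r α : ℝ}, r ∈ Set.Ico 0 ε → ι x = Real.cos r • ι q + Real.sin r • c α →
      Dist.dist x q ≤ r := by
    intro x r α hr hx
    obtain ⟨v, hv, h0⟩ := (hc.mem α).2.2.2
    have h1 := hcell v hv (x := x) (y := q) (α := α) hr ⟨le_rfl, hr.1.trans_lt hr.2⟩ hx
      (by simp) h0 h0 le_rfl
    rwa [coneDist_zero_right _ ⟨hr.1, by linarith [hr.2]⟩] at h1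
  -- The upper bound for a whole sector at once: all radii are quantified, so that a geodesic can be
  -- cut at its crossing of an intermediate ray.
  let P : ℝ → ℝ → Prop := fun α β => ∀ r ∈ Set.Ico 0 ε, ∀ s ∈ Set.Ico 0 ε, ∀ x y : Q,
    ι x = Real.cos r • ι q + Real.sin r • c α → ι y = Real.cos s • ι q + Real.sin s • c β →
    Dist.dist x y ≤ coneDist r s (β - α)
  have htrans : ∀ {α β γ : ℝ}, α ≤ β → β ≤ γ → γ - α < Real.pi → P α β → P β γ → P α γ := by
    intro α β γ h1 h2 h3 hP1 hP2 r hr s hs x y hx hy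
    obtain ⟨t, ht, hadd⟩ := exists_coneDist_add (a := β - α) (b := γ - β) hε hr hs (by linarith)
      (by linarith) (by linarith)
    obtain ⟨z, hz⟩ := hp t ht β
    rw [show γ - α = (β - α) + (γ - β) by ring, ← hadd]
    exact (dist_triangle _ z _).trans (add_le_add (hP1 r hr t ht x z hx hz)
      (hP2 t ht s hs z y hz hy))
  have hright : ∀ α, ∃ δ > 0, ∀ x ∈ Set.Ico 0 δ, P α (α + x) := by
    intro α
    obtain ⟨δ, hδ, v, hv, h⟩ := hc.right α
    exact ⟨δ, hδ, fun t ht r hr s hs x y hx hy => hcell v hv hr hs hx hy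
      (h α ⟨le_rfl, by linarith⟩) (h _ ⟨by linarith [ht.1], by linarith [ht.2]⟩)
      (by linarith [ht.1])⟩
  have hleft : ∀ α, ∃ δ > 0, ∀ x ∈ Set.Ico 0 δ, P (α - x) α := by
    intro α
    obtain ⟨δ, hδ, v, hv, h⟩ := hc.left α
    exact ⟨δ, hδ, fun t ht r hr s hs x y hx hy => hcell v hv hr hs hx hy
      (h _ ⟨by linarith [ht.2], by linarith [ht.1]⟩) (h α ⟨by linarith, le_rfl⟩)
      (by linarith [ht.1])⟩
  have hrefl : ∀ α, P α α := fun α => by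
    obtain ⟨δ, hδ, h⟩ := hright α
    simpa using h 0 ⟨le_rfl, hδ⟩
  have hmain : ∀ a b, a ≤ b → b - a < Real.pi → P a b := by
    classical
    intro a b hab hlt
    -- Continuous induction on the opening angle, encoded as local antitonicity of the indicator of
    -- failure.
    set f : ℝ → ℝ := fun t => if t ∈ Set.Icc a b → P a t then 0 else 1 with hf
    have h0 : ∀ {t}, f t ≤ 0 ↔ (t ∈ Set.Icc a b → P a t) := by
      intro t
      simp only [hf]
      split_ifs with h
      · exact ⟨fun _ => h, fun _ => le_rfl⟩
      · exact ⟨fun h' => absurd h' (by norm_num), fun h' => absurd h' h⟩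
    have hf1 : ∀ t, f t = 0 ∨ f t = 1 := fun t => by simp only [hf]; split_ifs <;> simp
    have hmono : ∀ {t u}, ((t ∈ Set.Icc a b → P a t) → (u ∈ Set.Icc a b → P a u)) → f u ≤ f t := by
      intro t u h
      rcases hf1 t with h1 | h1
      · rw [h1]; exact h0.2 (h (h0.1 h1.le))
      · rw [h1]; rcases hf1 u with h2 | h2 <;> rw [h2]; norm_num
    have hle : f b ≤ f a := by
      refine le_of_locally_antitone hab (fun t ht => ?_) fun t ht => ?_
      · obtain ⟨δ, hδ, h⟩ := hright t
        refine ⟨δ, hδ, fun u hu => hmono fun hPt htu => ?_⟩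
        exact htrans ht.1 (by linarith [hu.1]) (by linarith [htu.2]) (hPt ⟨ht.1, ht.2.le⟩) (h u hu)
      · obtain ⟨δ, hδ, h⟩ := hleft t
        refine ⟨min δ (t - a), lt_min hδ (by linarith [ht.1]), fun u hu => hmono fun hPt _ => ?_⟩
        have h1 := hu.2.trans_le (min_le_left _ _)
        have h2 := hu.2.trans_le (min_le_right _ _)
        exact htrans (by linarith) (by linarith [hu.1]) (by linarith [ht.2])
          (hPt ⟨by linarith, by linarith [hu.1, ht.2]⟩) (h u ⟨hu.1, h1⟩)
    exact h0.1 (hle.trans (h0.2 fun _ => hrefl a)) ⟨hab, le_rfl⟩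
  -- At link distance at least `π` the shortest way passes through the apex. Otherwise choose
  -- representatives realizing the circle distance and use one sector.
  rcases le_or_gt Real.pi ‖((α - β : ℝ) : AddCircle θ)‖ with h | h
  · rw [coneDist_of_pi_le hr.1 hs.1 (by linarith [hr.2, hs.2]) h]
    refine (dist_triangle x q y).trans (add_le_add (hrad hr hx) ?_)
    rw [dist_comm]
    exact hrad hs hy
  · obtain ⟨k, hk⟩ := exists_norm_coe_eq_abs θ (α - β)
    rw [hk] at h ⊢
    have hcβ : c (β + k * θ) = c β := by
      have := hc.periodic.int_mul k β
      exact this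
    rw [← hcβ] at hy
    rcases le_total α (β + k * θ) with h1 | h1
    · have e : |α - β - k * θ| = β + k * θ - α := by
        rw [abs_of_nonpos (by linarith)]; ring
      rw [e] at h ⊢
      exact hmain _ _ h1 h r hr s hs x y hx hy
    · have e : |α - β - k * θ| = α - (β + k * θ) := by
        rw [abs_of_nonneg (by linarith)]; ring
      rw [e] at h ⊢
      rw [coneDist_comm, dist_comm]
      exact hmain _ _ h1 h s hs r hr y x hy hx

include hV

theorem norm_sub_le_dist (x y : Q) : ‖ι x - ι y‖ ≤ timeBound V * Dist.dist x y := by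
  by_contra! h
  rw [mul_comm, ← lt_div_iff₀ (timeBound_pos V)] at h
  obtain ⟨L, hL, hp⟩ := hQ.exists_path_lt h
  rw [lt_div_iff₀ (timeBound_pos V), mul_comm] at hL
  exact (hQ.norm_sub_le hV hp).not_gt hL

theorem exists_polarChart (q : Q) : ∃ θ ε c, IsPolarChart V ι q θ ε c := by
  obtain ⟨θ, c, hc⟩ := exists_linkCurve_faceVertices hV (hQ.mem q)
  obtain ⟨ρ, hρ0, hρ⟩ := exists_star_radius (hQ.mem q)
  have hΛ := timeBound_pos V
  have hπ := Real.pi_pos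
  -- A path starting within `ε` of the centre and shorter than `2ε` stays in the star, as three
  -- quarters of `ρ` suffice. A longer path already exceeds the sum of the two radii.
  set ε := min (Real.pi / 2) (ρ / (4 * timeBound V)) with hε
  have hε0 : 0 < ε := lt_min (by linarith) (by positivity)
  have hεπ : ε ≤ Real.pi / 2 := min_le_left _ _
  have hερ : timeBound V * ε ≤ ρ / 4 := by
    have := mul_le_mul_of_nonneg_left (min_le_right (Real.pi / 2) (ρ / (4 * timeBound V))) hΛ.le
    refine this.trans (le_of_eq ?_)
    field_simp
  have hI : ∀ {r}, r ∈ Set.Ico 0 ε → r ∈ Set.Ico 0 Real.pi := fun hr => ⟨hr.1, by linarith [hr.2]⟩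
  have hIcc : ∀ {r}, r ∈ Set.Ico 0 ε → r ∈ Set.Icc 0 Real.pi := fun hr => ⟨hr.1, by linarith [hr.2]⟩
  have hlt : ∀ {r}, r < ε → timeBound V * r < ρ / 4 := fun hr =>
    (mul_lt_mul_of_pos_left hr hΛ).trans_le hερ
  have hp : ∀ r ∈ Set.Ico 0 ε, ∀ α, ∃ x, ι x = Real.cos r • ι q + Real.sin r • c α :=
    fun r hr α => hQ.exists_of_polar hV hc hρ (hIcc hr) (by linarith [hlt hr.2]) α
  have hdist : ∀ x y r s α β, r ∈ Set.Ico 0 ε → s ∈ Set.Ico 0 ε →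
      ι x = Real.cos r • ι q + Real.sin r • c α → ι y = Real.cos s • ι q + Real.sin s • c β →
      Dist.dist x y = coneDist r s ‖((α - β : ℝ) : AddCircle θ)‖ := by
    intro x y r s α β hr hs hx hy
    refine le_antisymm (hQ.dist_le_coneDist hc hεπ hp hr hs hx hy) ?_
    refine (hQ.dist x y).2 fun L hL => ?_
    rcases lt_or_ge L (2 * ε) with h | h
    · refine hQ.coneDist_le hV hc hρ hL ?_ (hI hr) (hI hs) hx hy
      have h1 := hQ.norm_sub_center_le hV hc (hIcc hr) α
      rw [← hx] at h1
      have h2 := mul_lt_mul_of_pos_left h hΛ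
      linarith [hlt hr.2]
    · refine (coneDist_le_add hr.1 hs.1 (by linarith [hr.2, hs.2]) (norm_nonneg _)).trans ?_
      linarith [hr.2, hs.2]
  refine ⟨θ, ε, c, hc, hε0, hεπ, hp, fun x hx => ?_, hdist⟩
  have h1 := hQ.norm_sub_le_dist hV x q
  obtain ⟨r, hr, α, hα⟩ := hQ.exists_polar hV hc hρ (x := x) (by linarith [hlt hx])
  refine ⟨r, ⟨hr.1, ?_⟩, α, hα⟩
  -- Comparison with the apex bounds the radial coordinate by the length of any short path to the
  -- centre.
  obtain ⟨L, hL, hp⟩ := hQ.exists_path_lt hx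
  have h2 := hQ.coneDist_le hV hc hρ hp (by linarith [hlt hx, hlt hL]) hr
    ⟨le_rfl, Real.pi_pos⟩ hα (s := 0) (β := 0) (by simp)
  rw [coneDist_zero_right _ ⟨hr.1, hr.2.le⟩] at h2
  linarith

end IsPolarSpace

end

/-! ### Cone angles and closed geodesics -/

section

variable {V : Finset Minkowski} {Q : Type*} [MetricSpace Q] {ι : Q → Minkowski}

theorem IsLinkCurve.eq_of_norm_eq_zero {q : Minkowski} {U : Finset Minkowski} {θ : ℝ}
    {c : ℝ → Minkowski} (hc : IsLinkCurve q U θ c) {α β : ℝ}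
    (h : ‖((α - β : ℝ) : AddCircle θ)‖ = 0) : c α = c β := by
  obtain ⟨k, hk⟩ := exists_norm_coe_eq_abs θ (α - β)
  rw [hk, abs_eq_zero] at h
  rw [show α = β + k * θ by linarith]
  exact hc.periodic.int_mul k β

/-- On the unit sphere, the cone distance is the angle. -/
theorem coneDist_two_pi (r s α β : ℝ) :
    coneDist r s ‖((α - β : ℝ) : AddCircle (2 * Real.pi))‖ =
      InnerProductGeometry.angle (sphPt r α) (sphPt s β) := by
  have h := AddCircle.norm_le_half_period (2 * Real.pi) (x := ((α - β : ℝ) : AddCircle _))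
    (by positivity)
  rw [abs_of_pos (by positivity), mul_div_cancel_left₀ _ two_ne_zero] at h
  obtain ⟨k, hk⟩ := exists_norm_coe_eq_abs (2 * Real.pi) (α - β)
  rw [angle_sphPt, coneDist, min_eq_left h, hk, Real.cos_abs, Real.cos_sub_int_mul_two_pi]

theorem exists_sphPt {u : E3} (hu : ‖u‖ = 1) (a : ℝ) :
    ∃ b, u = sphPt (InnerProductGeometry.angle (sphPt 0 a) u) b := by
  have hsum : u 0 ^ 2 + u 1 ^ 2 + u 2 ^ 2 = 1 := by
    have := real_inner_self_eq_norm_sq u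
    rw [inner_E3, hu] at this
    linarith
  have hangle : InnerProductGeometry.angle (sphPt 0 a) u = Real.arccos (u 2) := by
    rw [InnerProductGeometry.angle, norm_sphPt, hu, inner_E3]
    simp [sphPt]
  set z : ℂ := ⟨u 0, u 1⟩ with hz
  have hsin : Real.sin (Real.arccos (u 2)) = ‖z‖ := by
    rw [Real.sin_arccos, Complex.norm_def, Complex.normSq_apply]
    congr 1
    simp only [hz]
    linarith
  have hcos : Real.cos (Real.arccos (u 2)) = u 2 :=
    Real.cos_arccos (by nlinarith [sq_nonneg (u 0), sq_nonneg (u 1)])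
      (by nlinarith [sq_nonneg (u 0), sq_nonneg (u 1)])
  refine ⟨z.arg, ?_⟩
  have h1 : ‖z‖ * Real.cos z.arg = u 0 := Complex.norm_mul_cos_arg z
  have h2 : ‖z‖ * Real.sin z.arg = u 1 := Complex.norm_mul_sin_arg z
  rw [hangle]
  ext i
  fin_cases i <;> simp [sphPt, hsin, hcos, h1, h2]

namespace IsPolarChart

variable {q : Q} {θ ε : ℝ} {c : ℝ → Minkowski} (C : IsPolarChart V ι q θ ε c)
include C

theorem dist_center {x : Q} {r α : ℝ} (hr : r ∈ Set.Ico 0 ε)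
    (hx : ι x = Real.cos r • ι q + Real.sin r • c α) : Dist.dist x q = r := by
  have h := C.dist x q r 0 α 0 hr ⟨le_rfl, C.pos⟩ hx (by simp)
  rwa [coneDist_zero_right _ ⟨hr.1, by linarith [hr.2, C.le, Real.pi_pos]⟩] at h

theorem hasConeAngle (hinj : Function.Injective ι) : HasConeAngle q θ := by
  classical
  refine ⟨C.link.pos, ε, C.pos, C.le, ?_⟩
  set d : AddCircle θ → Minkowski := C.link.periodic.lift
  have hd : ∀ α : ℝ, d α = c α := fun α => C.link.periodic.lift_coe α
  have hex : ∀ r ∈ Set.Ico 0 ε, ∀ a, ∃ x, ι x = Real.cos r • ι q + Real.sin r • d a := by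
    intro r hr a
    obtain ⟨α, rfl⟩ := QuotientAddGroup.mk_surjective a
    obtain ⟨x, hx⟩ := C.exists_point r hr α
    exact ⟨x, by rw [hx, ← hd]⟩
  -- The default value `q` is never taken for radii in `[0, ε)`.
  set f : ℝ → AddCircle θ → Q := fun r a =>
    if h : ∃ x, ι x = Real.cos r • ι q + Real.sin r • d a then h.choose else q
  have hf : ∀ r ∈ Set.Ico 0 ε, ∀ α : ℝ, ι (f r α) = Real.cos r • ι q + Real.sin r • c α := by
    intro r hr α
    have h := hex r hr α
    simp only [f, dif_pos h]
    rw [h.choose_spec, hd]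
  refine ⟨f, fun a => ?_, fun x => ⟨fun hx => ?_, ?_⟩, ?_⟩
  · obtain ⟨α, rfl⟩ := QuotientAddGroup.mk_surjective a
    exact hinj ((hf 0 ⟨le_rfl, C.pos⟩ α).trans (by simp))
  · obtain ⟨r, hr, α, hα⟩ := C.mem_ball x hx
    exact ⟨r, hr, α, hinj ((hf r hr α).trans hα.symm)⟩
  · rintro ⟨r, hr, a, rfl⟩
    obtain ⟨α, rfl⟩ := QuotientAddGroup.mk_surjective a
    exact (C.dist_center hr (hf r hr α)).trans_lt hr.2
  · intro r hr s hs a b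
    obtain ⟨α, rfl⟩ := QuotientAddGroup.mk_surjective a
    obtain ⟨β, rfl⟩ := QuotientAddGroup.mk_surjective b
    have := C.dist _ _ r s α β hr hs (hf r hr α) (hf s hs β)
    rw [AddCircle.coe_sub] at this
    exact this

theorem isSphericalAt (hθ : θ = 2 * Real.pi) : IsSphericalAt q := by
  classical
  subst hθ
  set f : Q → E3 := fun x =>
    if h : ∃ p : ℝ × ℝ, p.1 ∈ Set.Ico 0 ε ∧ ι x = Real.cos p.1 • ι q + Real.sin p.1 • c p.2
    then sphPt h.choose.1 h.choose.2 else 0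
  have hf : ∀ x ∈ Metric.ball q ε, ∃ r ∈ Set.Ico 0 ε, ∃ α,
      ι x = Real.cos r • ι q + Real.sin r • c α ∧ f x = sphPt r α := by
    intro x hx
    have h : ∃ p : ℝ × ℝ, p.1 ∈ Set.Ico 0 ε ∧
        ι x = Real.cos p.1 • ι q + Real.sin p.1 • c p.2 := by
      obtain ⟨r, hr, α, hα⟩ := C.mem_ball x hx
      exact ⟨(r, α), hr, hα⟩
    exact ⟨h.choose.1, h.choose_spec.1, h.choose.2, h.choose_spec.2, by simp only [f, dif_pos h]⟩
  refine ⟨ε, C.pos, f, fun x hx => ?_, fun x hx y hy => ?_, fun u hu hlt => ?_⟩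
  · obtain ⟨r, -, α, -, h⟩ := hf x hx
    rw [h, norm_sphPt]
  · obtain ⟨r, hr, α, hα, h⟩ := hf x hx
    obtain ⟨s, hs, β, hβ, h'⟩ := hf y hy
    rw [h, h', C.dist x y r s α β hr hs hα hβ, coneDist_two_pi]
  · obtain ⟨r, hr, α, hα, h⟩ := hf q (Metric.mem_ball_self C.pos)
    have hr0 : r = 0 := by rw [← C.dist_center hr hα, dist_self]
    rw [h, hr0] at hlt
    obtain ⟨b, hb⟩ := exists_sphPt hu α
    set s := InnerProductGeometry.angle (sphPt 0 α) u
    have hs : s ∈ Set.Ico 0 ε := ⟨InnerProductGeometry.angle_nonneg _ _, hlt⟩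
    obtain ⟨x, hx⟩ := C.exists_point s hs b
    have hxε : x ∈ Metric.ball q ε := (C.dist_center hs hx).trans_lt hs.2
    refine ⟨x, hxε, ?_⟩
    obtain ⟨t, ht, β, hβ, h'⟩ := hf x hxε
    have h0 := C.dist x x t s β b ht hs hβ hx
    rw [dist_self, coneDist_two_pi, ← h', ← hb] at h0
    have h1 : ‖f x‖ = 1 := by rw [h', norm_sphPt]
    have h2 := InnerProductGeometry.cos_angle (f x) u
    rw [← h0, Real.cos_zero, h1, hu, mul_one, div_one] at h2
    exact (inner_eq_one_iff_of_norm_eq_one h1 hu).1 h2.symm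

end IsPolarChart

/-- A cone point is determined by the set of its vertices. -/
theorem IsVertexSet.eq_of_faceVertices_eq (hV : IsVertexSet V) {q q' : Minkowski}
    (hq : q ∈ polarSurface V) (hq' : q' ∈ polarSurface V)
    (hface : faceVertices V q = faceVertices V q')
    (hno : ∀ x ∈ linkSet q (faceVertices V q), -x ∉ linkSet q (faceVertices V q)) : q = q' := by
  obtain ⟨v, hv, hqv⟩ := hq.2.2
  have hvf : v ∈ faceVertices V q := mem_faceVertices.2 ⟨hv, hqv⟩
  have horth : ∀ w ∈ faceVertices V q, lorentz q' w = 0 := fun w hw =>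
    (mem_faceVertices.1 (hface ▸ hw)).2
  -- If this component were nonzero, its normalization and the negative would both be link
  -- directions, because it is orthogonal to all the shared vertices. Thus `q'` is plus or minus
  -- `q`.
  set z := q' - lorentz q' q • q with hz
  have hzw : ∀ w ∈ faceVertices V q, lorentz z w = 0 := fun w hw => by
    simp [hz, horth w hw, (mem_faceVertices.1 hw).2]
  have hzq : lorentz z q = 0 := by simp [hz, hq.1]
  have hz0 : z = 0 := by
    by_contra h0
    have hpos := lorentz_self_pos (hV.mem v hv) (hzw v hvf) h0
    have hs := Real.sqrt_pos.2 hpos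
    set x := (Real.sqrt (lorentz z z))⁻¹ • z with hx
    have hxx : lorentz x x = 1 := by
      simp only [hx, lorentz_smul_left, lorentz_smul_right]
      rw [← mul_assoc, ← mul_inv, Real.mul_self_sqrt hpos.le, inv_mul_cancel₀ hpos.ne']
    have hxw : ∀ w ∈ faceVertices V q, lorentz x w = 0 := fun w hw => by simp [hx, hzw w hw]
    have hxq : lorentz x q = 0 := by simp [hx, hzq]
    refine hno x ⟨hxx, hxq, fun w hw => (hxw w hw).le, v, hvf, hxw v hvf⟩
      ⟨by simp [hxx], by simp [hxq], fun w hw => by simp [hxw w hw], v, hvf, by simp [hxw v hvf]⟩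
  rw [sub_eq_zero] at hz0
  have h1 := hq'.1
  rw [hz0] at h1
  simp only [lorentz_smul_left, lorentz_smul_right, hq.1, mul_one] at h1
  rcases mul_self_eq_one_iff.1 h1 with h | h
  · rw [hz0, h, one_smul]
  · rw [h, neg_one_smul] at hz0
    exact absurd (hz0 ▸ hq') (hV.neg_notMem hq)

namespace IsPolarSpace

variable (hV : IsVertexSet V) (hQ : IsPolarSpace V Q ι)
include hV hQ

/-- A point with angle above `2π` has no antipodal link directions, so its set of orthogonal
vertices determines it, and there are finitely many such sets. -/
theorem exists_conePoints : ∃ S : Set Q, S.Finite ∧ (∀ q, q ∉ S → IsSphericalAt q) ∧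
    ∀ q ∈ S, ∃ θ, 2 * Real.pi < θ ∧ HasConeAngle q θ := by
  choose θ ε c C using hQ.exists_polarChart hV
  refine ⟨{q | 2 * Real.pi < θ q}, ?_, fun q hq => ?_, fun q hq => ?_⟩
  · refine Set.Finite.of_finite_image (f := fun q => faceVertices V (ι q))
      (V.powerset.finite_toSet.subset ?_) ?_
    · rintro _ ⟨q, -, rfl⟩
      exact Finset.mem_coe.2 (Finset.mem_powerset.2 (Finset.filter_subset _ _))
    · intro q hq q' hq' h
      refine hQ.injective (hV.eq_of_faceVertices_eq (hQ.mem q) (hQ.mem q') h ?_)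
      rcases (C q).link.excess with h1 | h1
      · exact absurd h1 (ne_of_gt hq)
      · exact h1.2
  · refine (C q).isSphericalAt ((C q).link.excess.resolve_right fun h => hq h.1)
  · exact ⟨θ q, hq, (C q).hasConeAngle hQ.injective⟩

/-- Closed geodesics of the polar surface are longer than `2π`. -/
theorem two_pi_lt_of_isClosedGeodesic {L : ℝ} {γ : ℝ → Q} (hγ : IsClosedGeodesic L γ) :
    2 * Real.pi < L := by
  obtain ⟨hL, hper, hgeo⟩ := hγ
  have hloc : ∀ t, ∃ u w : Minkowski, lorentz u u = 1 ∧ lorentz w w = 1 ∧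
      lorentz (ι (γ t)) u = 0 ∧ lorentz (ι (γ t)) w = 0 ∧
      (u + w = 0 ∨ FutureTimelike (u + w)) ∧ ∃ δ > 0, ∀ s ∈ Set.Ico 0 δ,
        ι (γ (t + s)) = Real.cos s • ι (γ t) + Real.sin s • u ∧
        ι (γ (t - s)) = Real.cos s • ι (γ t) + Real.sin s • w := by
    intro t
    obtain ⟨θ, ε, c, C⟩ := hQ.exists_polarChart hV (γ t)
    obtain ⟨δ, hδ, hd⟩ := hgeo t
    have hπ := Real.pi_pos
    have hm : 0 < min δ ε := lt_min hδ C.pos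
    set m := min δ ε
    have hball : ∀ {x}, |x| < m → t + x ∈ Metric.ball t δ := fun hx => by
      rw [Metric.mem_ball, Real.dist_eq, add_sub_cancel_left]
      exact hx.trans_le (min_le_left _ _)
    have hpol : ∀ x, |x| < m → ∃ α, |x| ∈ Set.Ico 0 ε ∧
        ι (γ (t + x)) = Real.cos |x| • ι (γ t) + Real.sin |x| • c α := by
      intro x hx
      have hdx : Dist.dist (γ (t + x)) (γ t) = |x| := by
        rw [hd _ (hball hx) _ (Metric.mem_ball_self hδ), add_sub_cancel_left]
      obtain ⟨r, hr, α, hα⟩ := C.mem_ball (γ (t + x)) (by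
        rw [hdx]; exact hx.trans_le (min_le_right _ _))
      have := C.dist_center hr hα
      rw [hdx] at this
      exact ⟨α, this ▸ hr, this ▸ hα⟩
    choose α hα using hpol
    have hcd : ∀ x (hx : |x| < m) y (hy : |y| < m),
        coneDist |x| |y| ‖((α x hx - α y hy : ℝ) : AddCircle θ)‖ = |x - y| := by
      intro x hx y hy
      rw [← C.dist _ _ _ _ _ _ (hα x hx).1 (hα y hy).1 (hα x hx).2 (hα y hy).2,
        hd _ (hball hx) _ (hball hy), add_sub_add_left_eq_sub]
    have hI : ∀ {x : ℝ}, 0 < x → x < m → x ∈ Set.Ioo 0 Real.pi := fun h h' =>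
      ⟨h, by linarith [min_le_right δ ε, C.le]⟩
    have hpos : |m / 2| = m / 2 := abs_of_pos (by linarith)
    have hp : |m / 2| < m := by rw [hpos]; linarith
    have hn : |-(m / 2)| < m := by rw [abs_neg]; exact hp
    -- Times on the same side of `t` realize the difference of the radii, so the points lie on one
    -- ray. Hence the directions at times `m / 2` and `-(m / 2)` describe the geodesic on all of its
    -- two sides.
    have hsame : ∀ x (hx : |x| < m) y (hy : |y| < m), x ≠ 0 → y ≠ 0 → |x - y| = abs (|x| - |y|) →
        c (α x hx) = c (α y hy) := by
      intro x hx y hy hx0 hy0 h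
      exact C.link.eq_of_norm_eq_zero (eq_zero_of_coneDist (hI (abs_pos.2 hx0) hx)
        (hI (abs_pos.2 hy0) hy) (norm_nonneg _) ((hcd x hx y hy).trans h))
    refine ⟨c (α _ hp), c (α _ hn), (C.link.mem _).1, (C.link.mem _).1, ?_, ?_, ?_, m, hm, ?_⟩
    · rw [lorentz_comm]; exact (C.link.mem _).2.1
    · rw [lorentz_comm]; exact (C.link.mem _).2.1
    -- Points on opposite sides realize the sum of the radii, so the directions are at link distance
    -- at least `π`.
    · refine C.link.bend _ _ (pi_le_of_coneDist (r := |m / 2|) (s := |-(m / 2)|) ?_ ?_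
        (norm_nonneg _) ?_)
      · rw [hpos]; exact hI (by linarith) (by linarith)
      · rw [abs_neg, hpos]; exact hI (by linarith) (by linarith)
      · rw [hcd, abs_neg, hpos, abs_of_pos] <;> linarith
    · intro s hs
      rcases hs.1.eq_or_lt with h0 | h0
      · simp [← h0]
      have hsa : |s| = s := abs_of_pos h0
      have h1 : |s| < m := by rw [hsa]; exact hs.2
      have h2 : |-s| < m := by rwa [abs_neg]
      constructor
      · have := (hα s h1).2
        rwa [hsa, hsame s h1 _ hp h0.ne' (by linarith) (by rw [hsa, hpos])] at this
      · have := (hα (-s) h2).2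
        rw [abs_neg, hsa, hsame (-s) h2 _ hn (by linarith) (by linarith) (by
          rw [abs_neg, abs_neg, hsa, hpos, abs_sub_comm]
          congr 1
          ring)] at this
        exact this
  choose u w h1 h2 h3 h4 h5 h6 using hloc
  have hB : IsBrokenGeodesic (ι ∘ γ) u w := ⟨fun t => (hQ.mem _).1, h1, h2, h3, h4, h5, h6⟩
  refine hB.two_pi_lt hL (fun t => congrArg ι (hper t)) fun t ht => ?_
  exact hV.neg_notMem (hQ.mem (γ t)) (ht ▸ hQ.mem (γ (t + Real.pi)))

end IsPolarSpace

end

/-! ### The homeomorphism with the sphere and existence of the metric -/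

/-- The point of the polar surface in the direction `e` is proportional to `(h, e)`, where `h` is
the value of this function at `e`. -/
noncomputable def polarHeight (V : Finset Minkowski) (hne : V.Nonempty) (e : E3) : ℝ :=
  V.sup' hne fun v => (e 0 * v 1 + e 1 * v 2 + e 2 * v 3) / v 0

/-- The radial parametrization of the polar surface by the unit sphere. -/
noncomputable def polarPoint (V : Finset Minkowski) (hne : V.Nonempty) (e : E3) : Minkowski :=
  (Real.sqrt (1 - polarHeight V hne e ^ 2))⁻¹ • ![polarHeight V hne e, e 0, e 1, e 2]

section

variable {V : Finset Minkowski} {hne : V.Nonempty}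

theorem norm_sq_E3 (e : E3) : ‖e‖ ^ 2 = e 0 ^ 2 + e 1 ^ 2 + e 2 ^ 2 := by
  rw [← real_inner_self_eq_norm_sq, inner_E3]
  ring

theorem continuous_polarHeight : Continuous (polarHeight V hne) := by
  unfold polarHeight
  refine continuous_iff_continuousAt.2 fun e => ContinuousAt.finset_sup'_apply hne fun v _ => ?_
  fun_prop

theorem IsVertexSet.nonempty (hV : IsVertexSet V) : V.Nonempty := by
  by_contra h
  rw [Finset.not_nonempty_iff_eq_empty] at h
  have := congrFun (hV.nondegenerate (fun _ => 1) (by simp [h])) 0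
  simp at this

theorem lorentz_cons (h : ℝ) (e : E3) (v : Minkowski) :
    lorentz ![h, e 0, e 1, e 2] v = e 0 * v 1 + e 1 * v 2 + e 2 * v 3 - h * v 0 := by
  simp [lorentz]
  ring

variable (hV : IsVertexSet V)
include hV

/-- The supremum is attained at a vertex, whose projective coordinates lie in the open unit ball;
apply Cauchy-Schwarz. -/
theorem IsVertexSet.sq_polarHeight_lt_one {e : E3} (he : ‖e‖ = 1) : polarHeight V hne e ^ 2 < 1 := by
  obtain ⟨v, hv, h⟩ := Finset.exists_mem_eq_sup' hne
    fun v : Minkowski => (e 0 * v 1 + e 1 * v 2 + e 2 * v 3) / v 0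
  obtain ⟨h0, h1⟩ := hV.mem v hv
  rw [polarHeight, h, div_pow, div_lt_one (by positivity)]
  have hs := norm_sq_E3 e
  rw [he] at hs
  rw [lorentz] at h1
  nlinarith [sq_nonneg (e 0 * v 2 - e 1 * v 1), sq_nonneg (e 0 * v 3 - e 2 * v 1),
    sq_nonneg (e 1 * v 3 - e 2 * v 2)]

theorem IsVertexSet.polarPoint_mem {e : E3} (he : ‖e‖ = 1) :
    polarPoint V hne e ∈ polarSurface V := by
  have hlt := hV.sq_polarHeight_lt_one (hne := hne) he
  have hs := Real.sqrt_pos.2 (sub_pos.2 hlt)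
  have hsq := Real.mul_self_sqrt (sub_pos.2 hlt).le
  refine ⟨?_, fun v hv => ?_, ?_⟩
  · have hn := norm_sq_E3 e
    rw [he] at hn
    have : lorentz ![polarHeight V hne e, e 0, e 1, e 2] ![polarHeight V hne e, e 0, e 1, e 2] =
        1 - polarHeight V hne e ^ 2 := by
      simp [lorentz]; linarith
    rw [polarPoint, lorentz_smul_left, lorentz_smul_right, this, ← mul_assoc, ← mul_inv, hsq,
      inv_mul_cancel₀ (sub_pos.2 hlt).ne']
  · rw [polarPoint, lorentz_smul_left, lorentz_cons]
    refine mul_nonpos_of_nonneg_of_nonpos (inv_pos.2 hs).le ?_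
    have h := Finset.le_sup' (fun v : Minkowski => (e 0 * v 1 + e 1 * v 2 + e 2 * v 3) / v 0) hv
    rw [div_le_iff₀ (hV.mem v hv).1] at h
    exact sub_nonpos.2 h
  · obtain ⟨v, hv, h⟩ := Finset.exists_mem_eq_sup' hne
      fun v : Minkowski => (e 0 * v 1 + e 1 * v 2 + e 2 * v 3) / v 0
    refine ⟨v, hv, ?_⟩
    rw [eq_div_iff (hV.mem v hv).1.ne'] at h
    rw [polarPoint, lorentz_smul_left, lorentz_cons, polarHeight, h, sub_self, mul_zero]

theorem IsVertexSet.polarPoint_injective {e e' : E3} (he : ‖e‖ = 1) (he' : ‖e'‖ = 1)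
    (h : polarPoint V hne e = polarPoint V hne e') : e = e' := by
  have hs := inv_pos.2 (Real.sqrt_pos.2 (sub_pos.2 (hV.sq_polarHeight_lt_one (hne := hne) he)))
  have hs' := inv_pos.2 (Real.sqrt_pos.2 (sub_pos.2 (hV.sq_polarHeight_lt_one (hne := hne) he')))
  unfold polarPoint at h
  generalize (Real.sqrt (1 - polarHeight V hne e ^ 2))⁻¹ = r at *
  generalize (Real.sqrt (1 - polarHeight V hne e' ^ 2))⁻¹ = r' at *
  have h1 : r • e = r' • e' := by
    ext i
    fin_cases i
    · simpa using congrFun h 1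
    · simpa using congrFun h 2
    · simpa using congrFun h 3
  have h2 := congrArg norm h1
  rw [norm_smul, norm_smul, he, he', mul_one, mul_one, Real.norm_of_nonneg hs.le,
    Real.norm_of_nonneg hs'.le] at h2
  rw [← h2] at h1
  exact smul_right_injective _ hs.ne' h1

theorem IsVertexSet.exists_polarPoint_eq {n : Minkowski} (hn : n ∈ polarSurface V) :
    ∃ e : E3, ‖e‖ = 1 ∧ polarPoint V hne e = n := by
  obtain ⟨hn1, hnV, v, hv, hnv⟩ := hn
  set z : E3 := !₂[n 1, n 2, n 3] with hz
  have hzn : ‖z‖ ^ 2 = 1 + n 0 ^ 2 := by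
    rw [norm_sq_E3]
    simp only [lorentz] at hn1
    simp [hz]
    linarith
  have hz0 : 0 < ‖z‖ := by
    rcases (norm_nonneg z).eq_or_lt with h | h
    · rw [← h] at hzn; nlinarith
    · exact h
  have hi : ∀ w : Minkowski, lorentz n w = n 1 * w 1 + n 2 * w 2 + n 3 * w 3 - n 0 * w 0 :=
    fun w => by rw [lorentz]; ring
  have hquot : ∀ w : Minkowski, ((‖z‖⁻¹ • z) 0 * w 1 + (‖z‖⁻¹ • z) 1 * w 2 + (‖z‖⁻¹ • z) 2 * w 3) =
      (n 1 * w 1 + n 2 * w 2 + n 3 * w 3) / ‖z‖ := fun w => by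
    simp [hz]
    ring
  have hh : polarHeight V hne (‖z‖⁻¹ • z) = n 0 / ‖z‖ := by
    refine le_antisymm (Finset.sup'_le _ _ fun w hw => ?_) ?_
    · have := hnV w hw
      rw [hi] at this
      rw [hquot, div_le_iff₀ (hV.mem w hw).1, div_mul_eq_mul_div]
      exact div_le_div_of_nonneg_right (by linarith) hz0.le
    · refine le_trans (le_of_eq ?_) (Finset.le_sup' (fun w : Minkowski =>
        ((‖z‖⁻¹ • z) 0 * w 1 + (‖z‖⁻¹ • z) 1 * w 2 + (‖z‖⁻¹ • z) 2 * w 3) / w 0) hv)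
      rw [hi] at hnv
      rw [hquot, eq_div_iff (hV.mem v hv).1.ne', div_mul_eq_mul_div]
      congr 1
      linarith
  refine ⟨‖z‖⁻¹ • z, norm_smul_inv_norm (norm_pos_iff.1 hz0), ?_⟩
  have hsqrt : Real.sqrt (1 - (n 0 / ‖z‖) ^ 2) = ‖z‖⁻¹ := by
    rw [← Real.sqrt_sq (inv_pos.2 hz0).le]
    congr 1
    rw [div_pow, inv_pow, hzn]
    field_simp
    ring
  rw [polarPoint, hh, hsqrt, inv_inv]
  funext i
  fin_cases i
  · simp [mul_div_cancel₀ _ hz0.ne']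
  · simpa [hz] using mul_inv_cancel_left₀ hz0.ne' (n 1)
  · simpa [hz] using mul_inv_cancel_left₀ hz0.ne' (n 2)
  · simpa [hz] using mul_inv_cancel_left₀ hz0.ne' (n 3)

theorem IsVertexSet.continuous_polarPoint :
    Continuous fun e : Metric.sphere (0 : E3) 1 => polarPoint V hne e := by
  have hc : Continuous fun e : Metric.sphere (0 : E3) 1 => polarHeight V hne e :=
    continuous_polarHeight.comp continuous_subtype_val
  have hc' : Continuous fun e : Metric.sphere (0 : E3) 1 => (e : E3) := continuous_subtype_val
  unfold polarPoint
  refine Continuous.smul (Continuous.inv₀ (continuous_const.sub (hc.pow 2)).sqrt fun e => ?_) ?_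
  · exact (Real.sqrt_pos.2 (sub_pos.2
      (hV.sq_polarHeight_lt_one (norm_eq_of_mem_sphere e)))).ne'
  · refine continuous_pi fun i => ?_
    fin_cases i
    · simpa using hc
    all_goals simp; fun_prop

end

section

variable {V : Finset Minkowski} {Q : Type*} {ι : Q → Minkowski}

/-- Nearby points of the polar surface lie in a common cell. -/
theorem eventually_exists_mem_cell {q : Minkowski} (hq : q ∈ polarSurface V) :
    ∀ᶠ x in nhds q, x ∈ polarSurface V → ∃ v ∈ V, lorentz q v = 0 ∧ lorentz x v = 0 := by
  obtain ⟨ρ, hρ, h⟩ := exists_star_radius hq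
  refine Metric.eventually_nhds_iff.2 ⟨ρ, hρ, fun x hx hxV => ?_⟩
  obtain ⟨v, hv, h0⟩ := hxV.2.2
  refine ⟨v, hv, ?_, h0⟩
  by_contra h1
  rw [dist_eq_norm] at hx
  exact (h x hx v hv h1).ne h0

theorem IsPolarModel.exists_equiv_sphere (hV : IsVertexSet V) (hι : IsPolarModel V ι) :
    ∃ G : Metric.sphere (0 : E3) 1 ≃ Q, Continuous fun e => ι (G e) := by
  have hne := hV.nonempty
  choose g hg using fun e : Metric.sphere (0 : E3) 1 =>
    hι.exists_eq (hV.polarPoint_mem (hne := hne) (norm_eq_of_mem_sphere e))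
  refine ⟨Equiv.ofBijective g ⟨fun e e' h => ?_, fun x => ?_⟩, ?_⟩
  · refine Subtype.ext (hV.polarPoint_injective (hne := hne) (norm_eq_of_mem_sphere e)
      (norm_eq_of_mem_sphere e') ?_)
    rw [← hg, ← hg, h]
  · obtain ⟨e, he, h⟩ := hV.exists_polarPoint_eq (hne := hne) (hι.mem x)
    exact ⟨⟨e, by simpa using he⟩, hι.injective ((hg _).trans h)⟩
  · change Continuous fun e => ι (g e)
    rw [show (fun e => ι (g e)) = _ from funext hg]
    exact hV.continuous_polarPoint

/-- Nearby points share a cell, so joinability is locally satisfied on a connected sphere. -/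
theorem IsPolarModel.exists_path (hV : IsVertexSet V) (hι : IsPolarModel V ι) (x y : Q) :
    ∃ L, PathLength (cellStep V ι) x y L := by
  obtain ⟨G, hG⟩ := hι.exists_equiv_sphere hV
  have hconn : PreconnectedSpace (Metric.sphere (0 : E3) 1) :=
    Subtype.preconnectedSpace (isPreconnected_sphere (by
      rw [← Module.finrank_eq_rank, finrank_euclideanSpace_fin]; norm_num) 0 1)
  have key := PreconnectedSpace.induction₂' (α := Metric.sphere (0 : E3) 1)
    (fun e e' => ∃ L, PathLength (cellStep V ι) (G e) (G e') L) (fun e => ?_)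
    ⟨fun _ _ _ ⟨L, h⟩ ⟨M, h'⟩ => ⟨L + M, h.trans h'⟩⟩ (G.symm x) (G.symm y)
  · simpa using key
  · have h1 := hG.continuousAt.eventually (eventually_exists_mem_cell (hι.mem (G e)))
    filter_upwards [h1] with e' h
    obtain ⟨v, hv, h2, h3⟩ := h (hι.mem _)
    have h4 : PathLength (cellStep V ι) (G e) (G e') _ := .single ⟨v, hv, h2, h3, rfl⟩
    exact ⟨⟨_, h4⟩, ⟨_, h4.symm cellStep_symm⟩⟩

theorem IsPolarModel.exists_metricSpace (hV : IsVertexSet V) (hι : IsPolarModel V ι) :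
    ∃ m : MetricSpace Q, @IsPolarSpace V Q m ι := by
  have hbdd : ∀ x y, BddBelow {L | PathLength (cellStep V ι) x y L} := fun x y =>
    ⟨0, fun L h => h.nonneg cellStep_nonneg⟩
  have hex : ∀ x y, {L | PathLength (cellStep V ι) x y L}.Nonempty := hι.exists_path hV
  have hglb : ∀ x y, IsGLB {L | PathLength (cellStep V ι) x y L}
      (sInf {L | PathLength (cellStep V ι) x y L}) := fun x y => isGLB_csInf (hex x y) (hbdd x y)
  let m : MetricSpace Q :=
    { dist := fun x y => sInf {L | PathLength (cellStep V ι) x y L}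
      dist_self := fun x => le_antisymm ((hglb x x).1 (.refl x))
        ((hglb x x).2 fun L h => h.nonneg cellStep_nonneg)
      dist_comm := fun x y => by
        congr 1
        ext L
        exact ⟨fun h => h.symm cellStep_symm, fun h => h.symm cellStep_symm⟩
      dist_triangle := fun x y z => by
        rw [← sub_le_iff_le_add]
        refine (hglb x y).2 fun L hL => ?_
        rw [sub_le_comm]
        refine (hglb y z).2 fun M hM => ?_
        rw [sub_le_iff_le_add']
        exact (hglb x z).1 (PathLength.trans hL hM)
      eq_of_dist_eq_zero := fun {x y} h => by
        -- Definiteness comes from the coordinate distance, which bounds all path lengths below up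
        -- to a constant.
        have h0 : ‖ι x - ι y‖ / timeBound V ≤ sInf {L | PathLength (cellStep V ι) x y L} :=
          (hglb x y).2 fun L hL => by
            rw [div_le_iff₀' (timeBound_pos V)]
            exact hι.norm_sub_le hV hL
        change sInf {L | PathLength (cellStep V ι) x y L} = 0 at h
        rw [h, div_le_iff₀' (timeBound_pos V), mul_zero] at h0
        exact hι.injective (sub_eq_zero.1 (norm_le_zero_iff.1 h0)) }
  exact ⟨m, @IsPolarSpace.mk V Q m ι hι hglb⟩

end

/-- Radial projection is continuous for the intrinsic metric because nearby points lie in a common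
cell and their arc length tends to zero. Compactness of the sphere does the rest. -/
theorem IsPolarSpace.homeomorphic_sphere {V : Finset Minkowski} {Q : Type*} [MetricSpace Q]
    {ι : Q → Minkowski} (hV : IsVertexSet V) (hQ : IsPolarSpace V Q ι) :
    Nonempty (Q ≃ₜ Metric.sphere (0 : E3) 1) := by
  obtain ⟨G, hG⟩ := hQ.exists_equiv_sphere hV
  have hcont : Continuous G := by
    refine continuous_iff_continuousAt.2 fun e => tendsto_iff_dist_tendsto_zero.2 ?_
    have h1 := hG.continuousAt.eventually (eventually_exists_mem_cell (hQ.mem (G e)))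
    have hlim : Filter.Tendsto (fun e' => Real.arccos (lorentz (ι (G e')) (ι (G e)))) (nhds e)
        (nhds 0) := by
      have hc : Continuous fun e' => Real.arccos (lorentz (ι (G e')) (ι (G e))) :=
        Real.continuous_arccos.comp (hG.lorentz continuous_const)
      have := hc.tendsto e
      rwa [(hQ.mem (G e)).1, Real.arccos_one] at this
    refine squeeze_zero' (Filter.Eventually.of_forall fun _ => dist_nonneg) ?_ hlim
    filter_upwards [h1] with e' h
    obtain ⟨v, hv, h2, h3⟩ := h (hQ.mem _)
    exact hQ.dist_le_arccos hv h3 h2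
  exact ⟨(Continuous.homeoOfEquivCompactToT2 hcont).symm⟩

/-! ### The cells as convex spherical polygons -/

/-- The orthogonal projection of `w` onto the orthogonal complement of `v`, as a vector of
Euclidean space. -/
noncomputable def tangentPart (v w : Minkowski) : E3 := unboost v (w + lorentz v w • v)

theorem lorentz_boost_eq_inner_tangentPart {v : Minkowski} (hv : v ∈ hyperbolicSpace)
    (w : Minkowski) (x : E3) : lorentz (boost v x) w = inner ℝ (tangentPart v w) x := by
  have h : lorentz (w + lorentz v w • v) v = 0 := by
    rw [lorentz_add_left, lorentz_smul_left, hv.2, lorentz_comm w v]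
    ring
  rw [real_inner_comm, tangentPart, ← lorentz_boost_eq_inner_unboost hv h, lorentz_add_right,
    lorentz_smul_right, lorentz_boost_left hv, mul_zero, add_zero]

/-- The cell of the polar surface belonging to `v`, as a subset of the unit sphere. -/
def sphericalCell (V : Finset Minkowski) (v : Minkowski) : Set E3 :=
  {x | ‖x‖ = 1 ∧ ∀ w ∈ V, lorentz (boost v x) w ≤ 0}

namespace IsVertexSet

variable {V : Finset Minkowski} (hV : IsVertexSet V) {v : Minkowski} (hv : v ∈ V)
include hV hv

theorem lorentz_boost_self {x : E3} (hx : ‖x‖ = 1) : lorentz (boost v x) (boost v x) = 1 := by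
  rw [lorentz_boost_boost (hV.mem v hv), real_inner_self_eq_norm_sq, hx, one_pow]

theorem boost_mem_polarSurface {x : E3} (hx : x ∈ sphericalCell V v) :
    boost v x ∈ polarSurface V :=
  ⟨hV.lorentz_boost_self hv hx.1, hx.2, v, hv, lorentz_boost_left (hV.mem v hv) x⟩

theorem exists_boost_eq {n : Minkowski} (hn : n ∈ polarSurface V) (h0 : lorentz n v = 0) :
    ∃ x ∈ sphericalCell V v, boost v x = n := by
  have hb := boost_unboost (hV.mem v hv) h0
  refine ⟨unboost v n, ⟨?_, fun w hw => ?_⟩, hb⟩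
  · have h := real_inner_self_eq_norm_sq (unboost v n)
    rw [← lorentz_boost_boost (hV.mem v hv), hb, hn.1] at h
    exact (pow_eq_one_iff_of_nonneg (norm_nonneg _) two_ne_zero).1 h.symm
  · rw [hb]
    exact hn.2.1 w hw

theorem exists_interior_point :
    ∃ x ∈ sphericalCell V v, ∀ w ∈ V, w ≠ v → lorentz (boost v x) w < 0 := by
  obtain ⟨n, hn1, hnv, hn⟩ := hV.strict v hv
  have hmem : n ∈ polarSurface V := ⟨hn1, fun w hw => by
    by_cases h : w = v
    · rw [h, hnv]
    · exact (hn w hw h).le, v, hv, hnv⟩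
  obtain ⟨x, hx, rfl⟩ := hV.exists_boost_eq hv hmem hnv
  exact ⟨x, hx, hn⟩

theorem isConvexSphericalPolygon : IsConvexSphericalPolygon (sphericalCell V v) := by
  classical
  have hvH := hV.mem v hv
  -- The vertex `v` is left out because its inequality is identically an equality and would destroy
  -- strict positivity at the interior point.
  set e := (V.erase v).equivFin
  have hinner : ∀ (w : Minkowski) (x : E3),
      inner ℝ (-tangentPart v w) x = -lorentz (boost v x) w := fun w x => by
    rw [inner_neg_left, lorentz_boost_eq_inner_tangentPart hvH]
  refine ⟨(V.erase v).card, fun i => -tangentPart v (e.symm i), ?_, ?_, fun x hx hx' => ?_⟩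
  · ext x
    refine and_congr_right fun hx => ⟨fun h i => ?_, fun h w hw => ?_⟩
    · rw [hinner, neg_nonneg]
      exact h _ (Finset.mem_of_mem_erase (e.symm i).2)
    · by_cases hwv : w = v
      · rw [hwv, lorentz_boost_left hvH]
      · have := h (e ⟨w, Finset.mem_erase.2 ⟨hwv, hw⟩⟩)
        rwa [hinner, neg_nonneg, Equiv.symm_apply_apply] at this
  · obtain ⟨x, hx, h⟩ := hV.exists_interior_point hv
    refine ⟨x, hx, fun i => ?_⟩
    rw [hinner, neg_pos]
    exact h _ (Finset.mem_of_mem_erase (e.symm i).2) (Finset.ne_of_mem_erase (e.symm i).2)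
  · refine hV.neg_notMem (hV.boost_mem_polarSurface hv hx) ?_
    have : -boost v x = boost v (-x) := eq_of_forall_lorentz_eq fun z => by
      rw [lorentz_neg_left, lorentz_boost_eq_inner_tangentPart hvH,
        lorentz_boost_eq_inner_tangentPart hvH, inner_neg_right]
    rw [this]
    exact hV.boost_mem_polarSurface hv hx'

end IsVertexSet

namespace IsPolarSpace

variable {V : Finset Minkowski} {Q : Type*} [MetricSpace Q] {ι : Q → Minkowski}
  (hV : IsVertexSet V) (hQ : IsPolarSpace V Q ι)
include hV hQ

theorem isPiecewiseSpherical : IsPiecewiseSpherical Q := by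
  classical
  have hQne : Nonempty Q := by
    obtain ⟨v, hv⟩ := hV.nonempty
    obtain ⟨x, hx, -⟩ := hV.exists_interior_point hv
    exact ⟨(hQ.exists_eq (hV.boost_mem_polarSurface hv hx)).choose⟩
  set v : Fin V.card → Minkowski := fun i => V.equivFin.symm i with hvdef
  have hv : ∀ i, v i ∈ V := fun i => (V.equivFin.symm i).2
  have hvinj : Function.Injective v := Subtype.val_injective.comp V.equivFin.symm.injective
  have hvsurj : ∀ w ∈ V, ∃ i, v i = w := fun w hw => ⟨V.equivFin ⟨w, hw⟩, by simp [hvdef]⟩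
  set φ : Fin V.card → E3 → Q := fun i x => Function.invFun ι (boost (v i) x) with hφ
  have hιφ : ∀ i, ∀ x ∈ sphericalCell V (v i), ι (φ i x) = boost (v i) x := fun i x hx =>
    Function.invFun_eq (hQ.exists_eq (hV.boost_mem_polarSurface (hv i) hx))
  have himage : ∀ i q, q ∈ φ i '' sphericalCell V (v i) ↔ lorentz (ι q) (v i) = 0 := by
    intro i q
    constructor
    · rintro ⟨x, hx, rfl⟩
      rw [hιφ i x hx, lorentz_boost_left (hV.mem _ (hv i))]
    · intro h
      obtain ⟨x, hx, hxq⟩ := hV.exists_boost_eq (hv i) (hQ.mem q) h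
      exact ⟨x, hx, hQ.injective ((hιφ i x hx).trans hxq)⟩
  have hangle : ∀ i, ∀ x ∈ sphericalCell V (v i), ∀ y ∈ sphericalCell V (v i),
      InnerProductGeometry.angle x y = Real.arccos (lorentz (ι (φ i x)) (ι (φ i y))) := by
    intro i x hx y hy
    rw [hιφ i x hx, hιφ i y hy, lorentz_boost_boost (hV.mem _ (hv i)), InnerProductGeometry.angle,
      hx.1, hy.1, mul_one, div_one]
  refine ⟨V.card, fun i => sphericalCell V (v i), φ,
    fun i => hV.isConvexSphericalPolygon (hv i), fun i x hx y hy h => ?_, fun q => ?_,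
    fun i j hij => ?_, fun i j x hx x' hx' y hy y' hy' h h' => ?_, fun q q' => ?_⟩
  · refine boost_injective (hV.mem _ (hv i)) ?_
    rw [← hιφ i x hx, ← hιφ i y hy, h]
  · obtain ⟨w, hw, h0⟩ := (hQ.mem q).2.2
    obtain ⟨i, rfl⟩ := hvsurj w hw
    exact ⟨i, (himage i q).2 h0⟩
  -- The points of cell `i` that lie in cell `j` are cut out by the linear form of `v j`; the face
  -- is proper because that form is strict at the interior point.
  · have hb : ∀ x, inner ℝ (-tangentPart (v i) (v j)) x = -lorentz (boost (v i) x) (v j) :=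
      fun x => by rw [inner_neg_left, lorentz_boost_eq_inner_tangentPart (hV.mem _ (hv i))]
    refine ⟨fun h => ?_, -tangentPart (v i) (v j), fun x hx => ?_, ?_⟩
    · obtain ⟨x, hx, hlt⟩ := hV.exists_interior_point (hv i)
      have hx' : x ∈ {x | x ∈ sphericalCell V (v i) ∧ φ i x ∈ φ j '' sphericalCell V (v j)} :=
        h ▸ hx
      have h0 := (himage j _).1 hx'.2
      rw [hιφ i x hx] at h0
      exact (hlt _ (hv j) fun h => hij (hvinj h).symm).ne h0
    · rw [hb, neg_nonneg]
      exact hx.2 _ (hv j)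
    · ext x
      refine and_congr_right fun hx => ?_
      rw [himage, hιφ i x hx, hb, neg_eq_zero]
  · rw [hangle i x hx x' hx', hangle j y hy y' hy', h, h']
  · have hstep : (fun a b ℓ => ∃ i, ∃ x ∈ sphericalCell V (v i), ∃ y ∈ sphericalCell V (v i),
        φ i x = a ∧ φ i y = b ∧ ℓ = InnerProductGeometry.angle x y) = cellStep V ι := by
      funext a b ℓ
      refine propext ⟨?_, ?_⟩
      · rintro ⟨i, x, hx, y, hy, rfl, rfl, rfl⟩
        exact ⟨v i, hv i, (himage i _).1 ⟨x, hx, rfl⟩, (himage i _).1 ⟨y, hy, rfl⟩,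
          hangle i x hx y hy⟩
      · rintro ⟨w, hw, ha, hb, rfl⟩
        obtain ⟨i, rfl⟩ := hvsurj w hw
        obtain ⟨x, hx, rfl⟩ := (himage i _).2 ha
        obtain ⟨y, hy, rfl⟩ := (himage i _).2 hb
        exact ⟨i, x, hx, y, hy, rfl, rfl, (hangle i x hx y hy).symm⟩
    rw [hstep]
    exact hQ.dist q q'

theorem isAdmissible : IsAdmissible Q where
  homeomorphic_sphere := hQ.homeomorphic_sphere hV
  piecewiseSpherical := hQ.isPiecewiseSpherical hV
  conePoints := hQ.exists_conePoints hV
  closedGeodesics := fun _ _ h => hQ.two_pi_lt_of_isClosedGeodesic hV h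

end IsPolarSpace

/-! ### Vertices of a compact polyhedron -/

theorem eq_one_of_smul_mem {v : Minkowski} {c : ℝ} (hv : v ∈ hyperbolicSpace)
    (hcv : c • v ∈ hyperbolicSpace) : c = 1 := by
  have h1 := hcv.2
  rw [lorentz_smul_left, lorentz_smul_right, hv.2] at h1
  rcases mul_self_eq_one_iff.1 (show c * c = 1 by linarith) with h | h
  · exact h
  · have h0 := hcv.1
    have hv0 := hv.1
    rw [h] at h0
    simp at h0
    linarith

theorem eventually_futureTimelike {x : Minkowski} (hx : x ∈ hyperbolicSpace) :
    ∀ᶠ y in nhds x, FutureTimelike y := by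
  have h0 : Continuous fun y : Minkowski => y 0 := by fun_prop
  have h1 : Continuous fun y : Minkowski => lorentz y y := by fun_prop
  have h := FutureTimelike.of_mem hx
  exact (h0.continuousAt.eventually_const_lt h.1).and (h1.continuousAt.eventually_lt_const h.2)

theorem tendsto_add_smul (x y : Minkowski) :
    Filter.Tendsto (fun t : ℝ => x + t • y) (nhds 0) (nhds x) := by
  have h : Continuous fun t : ℝ => x + t • y := by fun_prop
  simpa using h.tendsto 0

/-- A linear functional that vanishes on a neighbourhood in `H³` vanishes. -/
theorem eq_zero_of_eventually {P : Set Minkowski} {x n : Minkowski} (hx : x ∈ hyperbolicSpace)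
    (hP : P ∈ nhdsWithin x hyperbolicSpace) (h : ∀ y ∈ P, lorentz n y = 0) : n = 0 := by
  refine eq_of_forall_lorentz_eq fun y => ?_
  rw [lorentz_zero_left]
  have hxP : lorentz n x = 0 := h x (mem_of_mem_nhdsWithin hx hP)
  -- Radial retraction to the hyperboloid, used to move along straight lines through `x` while
  -- staying in `P`.
  set g : Minkowski → Minkowski := fun z => (Real.sqrt (-lorentz z z))⁻¹ • z with hg
  have hsqrt : Real.sqrt (-lorentz x x) = 1 := by rw [hx.2]; simp
  have hgx : g x = x := by simp only [hg, hsqrt, inv_one, one_smul]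
  have hgc : ContinuousAt g x := by
    have : Continuous fun z => Real.sqrt (-lorentz z z) := by fun_prop
    exact (this.continuousAt.inv₀ (by rw [hsqrt]; exact one_ne_zero)).smul continuousAt_id
  have hgH : ∀ z, FutureTimelike z → g z ∈ hyperbolicSpace := by
    intro z hz
    have hs : 0 < Real.sqrt (-lorentz z z) := Real.sqrt_pos.2 (by linarith [hz.2])
    refine ⟨by simpa [hg] using mul_pos (inv_pos.2 hs) hz.1, ?_⟩
    simp only [hg, lorentz_smul_left, lorentz_smul_right]
    have h2 := Real.mul_self_sqrt (show 0 ≤ -lorentz z z by linarith [hz.2])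
    rw [← mul_assoc, ← mul_inv, h2, inv_neg, neg_mul, inv_mul_cancel₀ hz.2.ne]
  have h1 : Filter.Tendsto g (nhds x) (nhdsWithin x hyperbolicSpace) := by
    refine tendsto_nhdsWithin_iff.2 ⟨by simpa only [ContinuousAt, hgx] using hgc, ?_⟩
    exact (eventually_futureTimelike hx).mono hgH
  have h2 := (tendsto_add_smul x y).eventually
    ((h1.eventually hP).and (eventually_futureTimelike hx))
  obtain ⟨δ, hδ, h3⟩ := Metric.eventually_nhds_iff.1 h2
  obtain ⟨h4, h5⟩ := h3 (y := δ / 2) (by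
    rw [dist_zero_right, Real.norm_of_nonneg (by linarith)]; linarith)
  have h6 := h _ h4
  have hs : 0 < Real.sqrt (-lorentz (x + (δ / 2) • y) (x + (δ / 2) • y)) :=
    Real.sqrt_pos.2 (by linarith [h5.2])
  simp only [hg] at h6
  rw [lorentz_smul_right, mul_eq_zero, or_iff_right (inv_pos.2 hs).ne'] at h6
  have h7 : δ / 2 * lorentz n y = 0 := by simpa [hxP] using h6
  exact (mul_eq_zero.1 h7).resolve_left (by positivity)

/-- A linear functional, normalized by the time coordinate, attains its maximum over a compact set
at a vertex. -/
theorem exists_isVertex_le {P : Set Minkowski} (hc : IsCompact P) (hH : P ⊆ hyperbolicSpace)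
    (n : Minkowski) {x : Minkowski} (hx : x ∈ P) :
    ∃ v, IsVertex P v ∧ lorentz n x / x 0 ≤ lorentz n v / v 0 := by
  -- In the projective model hyperbolic segments become affine ones, so extreme points of the image
  -- are vertices of `P`; an extreme point of the maximal face exists by compactness.
  set C : Set Minkowski := (fun x : Minkowski => (x 0)⁻¹ • x) '' P with hC
  have hCc : IsCompact C := by
    refine hc.image_of_continuousOn (ContinuousOn.smul (ContinuousOn.inv₀
      (continuous_apply (0 : Fin 4)).continuousOn ?_) continuousOn_id)
    exact fun x hx => (hH hx).1.ne'
  let l₀ : Minkowski →ₗ[ℝ] ℝ :=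
    { toFun := lorentz n, map_add' := lorentz_add_right n, map_smul' := fun a y => by simp }
  set l : StrongDual ℝ Minkowski := LinearMap.toContinuousLinearMap l₀
  have hl : ∀ y, l y = lorentz n y := fun y => rfl
  obtain ⟨z, hz, hmax⟩ := hCc.exists_isMaxOn ⟨_, x, hx, rfl⟩ l.continuous.continuousOn
  have hexp : IsExposed ℝ C (l.toExposed C) := ContinuousLinearMap.toExposed.isExposed
  obtain ⟨y, hy⟩ := (hexp.isCompact hCc).extremePoints_nonempty ⟨z, hz, hmax⟩
  have hyl : ∀ w ∈ C, l w ≤ l y := (extremePoints_subset hy).2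
  have hyC := hexp.isExtreme.extremePoints_subset_extremePoints hy
  rw [mem_extremePoints] at hyC
  obtain ⟨⟨v, hv, rfl⟩, hext⟩ := hyC
  have hdiv : ∀ w : Minkowski, l ((w 0)⁻¹ • w) = lorentz n w / w 0 := fun w => by
    rw [hl, lorentz_smul_right, div_eq_inv_mul]
  refine ⟨v, ⟨hv, fun p hp q hq a b ha hb hvab => ?_⟩, ?_⟩
  · have hv0 := (hH hv).1
    have hp0 := (hH hp).1
    have hq0 := (hH hq).1
    have hsum : v 0 = a * p 0 + b * q 0 := by simpa using congrFun hvab 0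
    have hinj : ∀ p ∈ P, (p 0)⁻¹ • p = (v 0)⁻¹ • v → p = v := by
      intro p hp h
      have hpv : p = (p 0 / v 0) • v := by
        rw [div_eq_mul_inv, mul_smul, ← h, smul_inv_smul₀ (hH hp).1.ne']
      have h1 := eq_one_of_smul_mem (hH hv) (hpv ▸ hH hp)
      rw [hpv, h1, one_smul]
    obtain ⟨h1, h2⟩ := hext _ ⟨p, hp, rfl⟩ _ ⟨q, hq, rfl⟩
      ⟨a * p 0 / v 0, b * q 0 / v 0, by positivity, by positivity,
        by rw [← add_div, ← hsum, div_self hv0.ne'], by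
          dsimp only
          conv_rhs => rw [hvab, smul_add, ← hvab]
          rw [smul_smul, smul_smul, smul_smul, smul_smul]
          congr 2 <;> field_simp⟩
    exact ⟨hinj p hp h1, hinj q hq h2⟩
  · have := hyl _ ⟨x, hx, rfl⟩
    dsimp only at this
    rwa [hdiv, hdiv] at this

/-- At a vertex, the active normals determine the vertex. -/
theorem exists_eq_smul_of_isVertex {P N : Set Minkowski} (hN : N.Finite)
    (hPN : P = {x | x ∈ hyperbolicSpace ∧ ∀ n ∈ N, lorentz n x ≤ 0}) {v w : Minkowski}
    (hv : IsVertex P v) (hw : ∀ n ∈ N, lorentz n v = 0 → lorentz n w = 0) : ∃ c : ℝ, w = c • v := by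
  have hvP : v ∈ {x | x ∈ hyperbolicSpace ∧ ∀ n ∈ N, lorentz n x ≤ 0} := hPN ▸ hv.1
  obtain ⟨hvH, hvN⟩ := hvP
  have hlocal : ∀ y : Minkowski, (∀ n ∈ N, lorentz n v = 0 → lorentz n y = 0) →
      ∀ᶠ t : ℝ in nhds 0, FutureTimelike (v + t • y) ∧ ∀ n ∈ N, lorentz n (v + t • y) ≤ 0 := by
    intro y hy
    refine (tendsto_add_smul v y).eventually (eventually_futureTimelike hvH) |>.and ?_
    rw [Set.Finite.eventually_all hN]
    intro n hn
    by_cases h0 : lorentz n v = 0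
    · exact Filter.Eventually.of_forall fun t => by simp [h0, hy n hn h0]
    · have hc : Continuous fun z => lorentz n z := by fun_prop
      exact ((hc.continuousAt.tendsto.comp (tendsto_add_smul v y)).eventually_lt_const
        (lt_of_le_of_ne (hvN n hn) h0)).mono fun t ht => le_of_lt ht
  -- Small moves along `w` and `-w` both stay in the cone over `P`, with `v` as midpoint; the vertex
  -- property collapses them.
  obtain ⟨δ, hδ, h⟩ := Metric.eventually_nhds_iff.1
    ((hlocal w hw).and (hlocal (-w) fun n hn h0 => by simp [hw n hn h0]))
  obtain ⟨⟨h1, h2⟩, h3, h4⟩ := h (y := δ / 2) (by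
    rw [dist_zero_right, Real.norm_of_nonneg (by linarith)]; linarith)
  have hmem : ∀ (y : Minkowski) (c : ℝ), 0 < c → c • y ∈ hyperbolicSpace → (∀ n ∈ N, lorentz n y ≤ 0) → c • y ∈ P := by
    intro y c hc hy hyN
    rw [hPN]
    exact ⟨hy, fun n hn => by
      rw [lorentz_smul_right]; exact mul_nonpos_of_nonneg_of_nonpos hc.le (hyN n hn)⟩
  obtain ⟨a, ha, ha'⟩ := h1.exists_smul_mem
  obtain ⟨b, hb, hb'⟩ := h3.exists_smul_mem
  obtain ⟨h5, -⟩ := hv.2 _ (hmem _ a ha ha' h2) _ (hmem _ b hb hb' h4) (2 * a)⁻¹ (2 * b)⁻¹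
    (by positivity) (by positivity) (by
      rw [smul_smul, smul_smul, mul_inv, mul_inv, mul_assoc, mul_assoc, inv_mul_cancel₀ ha.ne',
        inv_mul_cancel₀ hb.ne']
      module)
  refine ⟨(a⁻¹ - 1) * (δ / 2)⁻¹, ?_⟩
  have h6 : (δ / 2) • w = (a⁻¹ - 1) • v := by
    rw [sub_smul, one_smul, eq_sub_iff_add_eq']
    conv_rhs => rw [← h5]
    rw [inv_smul_smul₀ ha.ne']
  rw [mul_comm, mul_smul, ← h6, inv_smul_smul₀ (by positivity)]

/-- The vertices of a compact convex polyhedron form a finite set in convex position, which has the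
same polar surface as the polyhedron. -/
theorem IsCompactConvexPolyhedron.exists_vertexSet {P : Set Minkowski}
    (hP : IsCompactConvexPolyhedron P) :
    ∃ V : Finset Minkowski, (∀ v, v ∈ V ↔ IsVertex P v) ∧ IsVertexSet V ∧
      polar P = polarSurface V := by
  classical
  obtain ⟨N, hN, hNS, hPN⟩ := hP.exists_halfSpaces
  replace hPN : P = {x | x ∈ hyperbolicSpace ∧ ∀ n ∈ N, lorentz n x ≤ 0} := by
    rw [hPN]
    ext x
    exact and_congr_right fun hx => forall₂_congr fun n _ => and_iff_right hx
  have hPH : P ⊆ hyperbolicSpace := by rw [hPN]; exact fun x hx => hx.1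
  have hPle : ∀ x ∈ P, ∀ n ∈ N, lorentz n x ≤ 0 := by
    intro x hx
    rw [hPN] at hx
    exact hx.2
  have hunique : ∀ v, IsVertex P v → ∀ w ∈ P,
      (∀ n ∈ N, lorentz n v = 0 → lorentz n w = 0) → w = v := by
    intro v hv w hw h
    obtain ⟨c, rfl⟩ := exists_eq_smul_of_isVertex hN hPN hv h
    rw [eq_one_of_smul_mem (hPH hv.1) (hPH hw), one_smul]
  have hfin : {v | IsVertex P v}.Finite := by
    -- Vertices are determined by their sets of active normals, which are subsets of the finite set
    -- `N`.
    refine Set.Finite.of_finite_image (f := fun v => {n | n ∈ N ∧ lorentz n v = 0})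
      (hN.finite_subsets.subset ?_) ?_
    · rintro _ ⟨v, -, rfl⟩
      exact fun n hn => hn.1
    · intro v hv w hw h
      refine (hunique v hv w hw.1 fun n hn h0 => ?_).symm
      exact ((Set.ext_iff.1 h n).1 ⟨hn, h0⟩).2
  set V := hfin.toFinset with hVdef
  have hmemV : ∀ v, v ∈ V ↔ IsVertex P v := fun v => by simp [hVdef]
  have hle : ∀ n, (∀ v ∈ V, lorentz n v ≤ 0) → ∀ x ∈ P, lorentz n x ≤ 0 := by
    intro n hn x hx
    obtain ⟨v, hv, h⟩ := exists_isVertex_le hP.isCompact hPH n hx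
    have h1 : lorentz n x / x 0 ≤ 0 := h.trans
      (div_nonpos_of_nonpos_of_nonneg (hn v ((hmemV v).2 hv)) (hPH hv.1).1.le)
    by_contra! h2
    exact (div_pos h2 (hPH hx).1).not_ge h1
  obtain ⟨x₀, hx₀, hint⟩ := hP.exists_interior
  have hnd : ∀ n, (∀ v ∈ V, lorentz n v = 0) → n = 0 := by
    intro n hn
    refine eq_zero_of_eventually hx₀ hint fun y hy => le_antisymm ?_ ?_
    · exact hle n (fun v hv => (hn v hv).le) y hy
    · have := hle (-n) (fun v hv => by simp [hn v hv]) y hy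
      rw [lorentz_neg_left] at this
      linarith
  refine ⟨V, hmemV, ⟨fun v hv => hPH ((hmemV v).1 hv).1, hnd, fun v hv => ?_⟩, ?_⟩
  · have hvV := (hmemV v).1 hv
    have hvH := hPH hvV.1
    -- The sum of the active normals is strictly negative at every other vertex, since a vertex
    -- where all active normals vanish must be `v`.
    set m := ∑ n ∈ hN.toFinset with lorentz n v = 0, n with hm
    have hmN : ∀ n ∈ hN.toFinset.filter (fun n => lorentz n v = 0), n ∈ N ∧ lorentz n v = 0 :=
      fun n hn => by simpa using hn
    have hmv : lorentz m v = 0 := by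
      rw [hm, lorentz_sum_left]
      exact Finset.sum_eq_zero fun n hn => (hmN n hn).2
    have hmw : ∀ w ∈ V, w ≠ v → lorentz m w < 0 := by
      intro w hw hwv
      have hwP := ((hmemV w).1 hw).1
      have hterm : ∀ n ∈ hN.toFinset.filter (fun n => lorentz n v = 0), lorentz n w ≤ 0 :=
        fun n hn => hPle w hwP n (hmN n hn).1
      rw [hm, lorentz_sum_left]
      refine lt_of_le_of_ne (Finset.sum_nonpos hterm) fun h => hwv ?_
      refine hunique v hvV w hwP fun n hn h0 => ?_
      exact (Finset.sum_eq_zero_iff_of_nonpos hterm).1 h n (by simp [hn, h0])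
    -- If `m` vanished there would be no other vertex, and any boosted unit vector would then
    -- annihilate the whole vertex set.
    have hm0 : m ≠ 0 := by
      intro h0
      have h1 : boost v (sphPt 0 0) = 0 := hnd _ fun w hw => by
        by_cases hwv : w = v
        · rw [hwv, lorentz_boost_left hvH]
        · have := hmw w hw hwv
          simp [h0] at this
      have h2 := lorentz_boost_boost hvH (sphPt 0 0) (sphPt 0 0)
      rw [h1, real_inner_self_eq_norm_sq, norm_sphPt] at h2
      simp at h2
    have hpos := lorentz_self_pos hvH hmv hm0
    have hs := inv_pos.2 (Real.sqrt_pos.2 hpos)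
    refine ⟨(Real.sqrt (lorentz m m))⁻¹ • m, ?_, by simp [hmv], fun w hw hwv => ?_⟩
    · rw [lorentz_smul_left, lorentz_smul_right, ← mul_assoc, ← mul_inv,
        Real.mul_self_sqrt hpos.le, inv_mul_cancel₀ hpos.ne']
    · rw [lorentz_smul_left]
      exact mul_neg_of_pos_of_neg hs (hmw w hw hwv)
  · ext n
    constructor
    · rintro ⟨h1, h2, x, hx, h3⟩
      refine ⟨h1, fun v hv => h2 v ((hmemV v).1 hv).1, ?_⟩
      obtain ⟨v, hv, h⟩ := exists_isVertex_le hP.isCompact hPH n hx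
      refine ⟨v, (hmemV v).2 hv, le_antisymm (h2 v hv.1) ?_⟩
      rw [h3, zero_div] at h
      by_contra! h4
      exact (div_neg_of_neg_of_pos h4 (hPH hv.1).1).not_ge h
    · rintro ⟨h1, h2, v, hv, h3⟩
      exact ⟨h1, hle n h2, v, ((hmemV v).1 hv).1, h3⟩

theorem proposition3p6 (P : Set Minkowski) (hP : IsCompactConvexPolyhedron P) :
    ∃ m : MetricSpace (polar P), IsPolarMetric P m ∧ @IsAdmissible (polar P) m := by
  obtain ⟨V, hmem, hV, hpolar⟩ := hP.exists_vertexSet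
  have hι : IsPolarModel V (Subtype.val : polar P → Minkowski) :=
    ⟨Subtype.val_injective, by rw [Subtype.range_coe, hpolar]⟩
  obtain ⟨m, hm⟩ := hι.exists_metricSpace hV
  have hstep : polarStep P = cellStep V (Subtype.val : polar P → Minkowski) := by
    funext x y ℓ
    simp only [polarStep, cellStep, hmem]
  refine ⟨m, fun x y => ?_, hm.isAdmissible hV⟩
  rw [hstep]
  exact hm.dist x y
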